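/- Theorem 1.5. For $(u,\eta)\in\mathbb R^2$ and $f\in L^2(\mathbb R)$ let $\pi(u,\eta)f(x)=e^{2\pi i\eta x}f(x-u)$. Let $g\in L^2(\mathbb R)$ and let $\Lambda=A\mathbb Z^2$ with $A\in \mathrm{GL}(2,\mathbb Q)$, such that the Gabor system $(\pi(a,b)g)_{(a,b)\in\Lambda}$ is a Riesz basis of its closed linear span $\mathcal G(g,\Lambda)\subset L^2(\mathbb R)$ (i.e. the image of an orthonormal basis under a bounded invertible operator onto $\mathcal G(g,\Lambda)$). If $\pi(u,\eta)g\in\mathcal G(g,\Lambda)$ for some $(u,\eta)\in\mathbb R^2\setminus\Lambda$, then $Zg\notin \mathrm{VMO}_{\mathrm{loc}}(\mathbb R^2)$. Here $Zf$ denotes the Zak transform of $f\in L^2(\mathbb R)$: on $[0,1]^2$ it is $Zf(x,\omega)=\sum_{k\in\mathbb Z}f(x+k)e^{-2\pi ik\omega}$, with convergence in $L^2([0,1]^2)$, and it is extended to a function in $L^2_{\mathrm{loc}}(\mathbb R^2)$ by $Zf(x+m,\omega+n)=e^{2\pi im\omega}Zf(x,\omega)$ for $m,n\in\mathbb Z$.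 A function $F\in L^1_{\mathrm{loc}}(\mathbb R^2)$ belongs to $\mathrm{VMO}_{\mathrm{loc}}(\mathbb R^2)$ if for every bounded open set $U\subset\mathbb R^2$ $$\sup_{Q\subset U}M_Q(F)<\infty\quad\text{and}\quad \lim_{\varepsilon\to0}\ \sup_{Q\subset U,\ |Q|<\varepsilon}M_Q(F)=0,$$ where $Q$ runs over the closed axis-parallel squares of positive side length, $M_Q(F)=\frac1{|Q|}\int_Q|F-F_Q|$ and $F_Q=\frac1{|Q|}\int_QF$. -/

import Mathlib

open MeasureTheory Set Filter Topology
open scoped ENNReal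

/-! ## Time-frequency shifts and Gabor systems on `L²(ℝ)` -/

/-- The Hilbert space `L²(ℝ)` of complex-valued functions. -/
abbrev L2R : Type := Lp ℂ 2 (volume : Measure ℝ)

theorem memLp_timeFreqShift (u η : ℝ) (f : L2R) :
    MemLp (fun x : ℝ => Complex.exp (2 * Real.pi * Complex.I * η * x) * f (x - u)) 2 volume := by
  have h1 : MemLp (fun x : ℝ => f (x - u)) 2 volume :=
    (Lp.memLp f).comp_measurePreserving (measurePreserving_sub_right volume u)
  refine h1.of_le_mul (c := 1) ?_ (Eventually.of_forall fun x => ?_)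
  · exact (by fun_prop : Continuous fun x : ℝ =>
      Complex.exp (2 * Real.pi * Complex.I * η * x)).aestronglyMeasurable.mul h1.1
  · have : ‖Complex.exp (2 * Real.pi * Complex.I * η * x)‖ = 1 := by
      rw [show 2 * Real.pi * Complex.I * η * x = ((2 * Real.pi * η * x : ℝ) : ℂ) * Complex.I by
        push_cast; ring]
      exact Complex.norm_exp_ofReal_mul_I _
    simp [this]

/-- The time-frequency shift `π(u, η) f (x) = e^{2πiηx} f(x - u)`, where `z = (u, η)`. -/
noncomputable def timeFreqShift (z : ℝ × ℝ) (f : L2R) : L2R :=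
  (memLp_timeFreqShift z.1 z.2 f).toLp

/-- The lattice `A ℤ² ⊆ ℝ²` of an invertible rational matrix `A`. -/
def rationalLattice (A : GL (Fin 2) ℚ) : Set (ℝ × ℝ) :=
  {z | ∃ m n : ℤ, z = ((A.1 0 0 : ℝ) * m + (A.1 0 1 : ℝ) * n,
                       (A.1 1 0 : ℝ) * m + (A.1 1 1 : ℝ) * n)}

/-- The closed linear span `𝒢(g, Λ)` of the Gabor system `{π(z) g : z ∈ Λ}` in `L²(ℝ)`. -/
noncomputable def gaborSpace (g : L2R) (Λ : Set (ℝ × ℝ)) : Submodule ℂ L2R :=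
  (Submodule.span ℂ (range fun z : Λ => timeFreqShift z g)).topologicalClosure

/-- The Gabor system `(π(z) g)_{z ∈ Λ}` as a family in its closed linear span. -/
noncomputable def gaborFamily (g : L2R) (Λ : Set (ℝ × ℝ)) (z : Λ) : gaborSpace g Λ :=
  ⟨timeFreqShift z g, Submodule.le_topologicalClosure _ (Submodule.subset_span ⟨z, rfl⟩)⟩

open Classical in
/-- A family `v` in a Hilbert space `K` is a Riesz basis of `K` if it is the image of an
orthonormal basis under a bounded invertible operator; the orthonormal basis is taken to be the
standard one of `ℓ²(ι)`. -/
def IsRieszBasis {ι K : Type*} [NormedAddCommGroup K] [InnerProductSpace ℂ K] (v : ι → K) : Prop :=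
  ∃ T : lp (fun _ : ι => ℂ) 2 ≃L[ℂ] K, ∀ i, T (lp.single 2 i 1) = v i

/-! ## The Zak transform -/

/-- The unit square `[0,1]²`. -/
def unitSquare : Set (ℝ × ℝ) := Icc 0 1 ×ˢ Icc 0 1

theorem restrict_unitSquare : (volume : Measure (ℝ × ℝ)).restrict unitSquare =
    (volume.restrict (Icc (0 : ℝ) 1)).prod (volume.restrict (Icc (0 : ℝ) 1)) := by
  rw [Measure.prod_restrict, unitSquare, Measure.volume_eq_prod]

theorem norm_zakPhase (k : ℤ) (ω : ℝ) : ‖Complex.exp (-2 * Real.pi * Complex.I * k * ω)‖ = 1 := by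
  rw [show -2 * Real.pi * Complex.I * k * ω = ((-2 * Real.pi * k * ω : ℝ) : ℂ) * Complex.I by
    push_cast; ring]
  exact Complex.norm_exp_ofReal_mul_I _

theorem memLp_zakTerm (f : L2R) (k : ℤ) :
    MemLp (fun p : ℝ × ℝ => f (p.1 + k) * Complex.exp (-2 * Real.pi * Complex.I * k * p.2)) 2
      (volume.restrict unitSquare) := by
  have h1 : MemLp (fun x : ℝ => f (x + k)) 2 volume :=
    (Lp.memLp f).comp_measurePreserving (measurePreserving_add_right volume (k : ℝ))
  have h2 : MemLp (fun p : ℝ × ℝ => f (p.1 + k)) 2 (volume.restrict unitSquare) := by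
    rw [restrict_unitSquare]
    exact (h1.restrict (Icc 0 1)).comp_fst (volume.restrict (Icc (0 : ℝ) 1))
  refine h2.of_le_mul (c := 1) ?_ (Eventually.of_forall fun p => ?_)
  · exact h2.1.mul (by fun_prop : Continuous fun p : ℝ × ℝ =>
      Complex.exp (-2 * Real.pi * Complex.I * k * p.2)).aestronglyMeasurable
  · rw [norm_mul, norm_zakPhase, mul_one, one_mul]

/-- The term `f(x + k) e^{-2πikω}` of the Zak series, as an element of `L²([0,1]²)`. -/
noncomputable def zakTerm (f : L2R) (k : ℤ) :
    Lp ℂ 2 ((volume : Measure (ℝ × ℝ)).restrict unitSquare) :=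
  (memLp_zakTerm f k).toLp

/-- The restriction of the Zak transform `Zf` to `[0,1]²`: the sum in `L²([0,1]²)` of
`∑ₖ f(x + k) e^{-2πikω}`. -/
noncomputable def zakSquare (f : L2R) :
    Lp ℂ 2 ((volume : Measure (ℝ × ℝ)).restrict unitSquare) :=
  ∑' k : ℤ, zakTerm f k

/-- The Zak transform `Zf` on `ℝ²`: the extension of its restriction to `[0,1]²` by the
quasi-periodicity `Zf(x + m, ω + n) = e^{2πimω} Zf(x, ω)`, `m, n ∈ ℤ`. -/
noncomputable def zak (f : L2R) (p : ℝ × ℝ) : ℂ :=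
  Complex.exp (2 * Real.pi * Complex.I * ⌊p.1⌋ * p.2) *
    zakSquare f (Int.fract p.1, Int.fract p.2)

theorem integral_zakPhase {n : ℤ} (hn : n ≠ 0) :
    ∫ ω in Icc (0 : ℝ) 1, Complex.exp (2 * Real.pi * Complex.I * n * ω) = 0 := by
  rw [integral_Icc_eq_integral_Ioc, ← intervalIntegral.integral_of_le zero_le_one]
  have hc : 2 * Real.pi * Complex.I * n ≠ 0 := by
    simp [Real.pi_ne_zero, hn]
  rw [integral_exp_mul_complex hc]
  have : Complex.exp (2 * Real.pi * Complex.I * n) = 1 := by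
    rw [Complex.exp_eq_one_iff]; exact ⟨n, by ring⟩
  simp [this]

theorem inner_zakTerm (f : L2R) {j k : ℤ} (hjk : j ≠ k) :
    inner ℂ (zakTerm f j) (zakTerm f k) = 0 := by
  rw [L2.inner_def]
  have h : ∀ᵐ p : ℝ × ℝ ∂(volume.restrict unitSquare),
      inner ℂ (zakTerm f j p) (zakTerm f k p) =
        (f (p.1 + k) * (starRingEnd ℂ) (f (p.1 + j))) *
          Complex.exp (2 * Real.pi * Complex.I * (j - k : ℤ) * p.2) := by
    filter_upwards [(memLp_zakTerm f j).coeFn_toLp, (memLp_zakTerm f k).coeFn_toLp] with p hj hk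
    rw [zakTerm, zakTerm, hj, hk, RCLike.inner_apply, map_mul, ← Complex.exp_conj]
    rw [mul_mul_mul_comm, ← Complex.exp_add]
    congr 2
    simp only [map_mul, map_neg, Complex.conj_ofReal, Complex.conj_I, map_intCast, map_ofNat]
    push_cast
    ring
  rw [integral_congr_ae h, restrict_unitSquare,
    integral_prod_mul (fun x : ℝ => f (x + k) * (starRingEnd ℂ) (f (x + j)))
      (fun ω : ℝ => Complex.exp (2 * Real.pi * Complex.I * (j - k : ℤ) * ω)),
    integral_zakPhase (sub_ne_zero.2 hjk), mul_zero]

theorem norm_sq_zakTerm (f : L2R) (k : ℤ) :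
    ‖zakTerm f k‖ ^ 2 = ∫ x in (0 : ℝ)..1, ‖f (x + k)‖ ^ 2 := by
  have h0 : ((‖zakTerm f k‖ ^ 2 : ℝ) : ℂ) = inner ℂ (zakTerm f k) (zakTerm f k) := by
    rw [inner_self_eq_norm_sq_to_K]; simp
  have h : ∀ᵐ p : ℝ × ℝ ∂(volume.restrict unitSquare),
      inner ℂ (zakTerm f k p) (zakTerm f k p) =
        ((‖f (p.1 + k)‖ ^ 2 : ℝ) : ℂ) * (fun _ : ℝ => (1 : ℂ)) p.2 := by
    filter_upwards [(memLp_zakTerm f k).coeFn_toLp] with p hk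
    rw [zakTerm, hk, inner_self_eq_norm_sq_to_K, norm_mul, norm_zakPhase]
    simp
  have h1 : ∫ p : ℝ × ℝ in unitSquare,
      ((‖f (p.1 + k)‖ ^ 2 : ℝ) : ℂ) * (fun _ : ℝ => (1 : ℂ)) p.2 =
        ((∫ x in Icc (0 : ℝ) 1, ‖f (x + k)‖ ^ 2 : ℝ) : ℂ) := by
    rw [restrict_unitSquare, integral_prod_mul (fun x : ℝ => ((‖f (x + k)‖ ^ 2 : ℝ) : ℂ))
      (fun _ : ℝ => (1 : ℂ)), integral_complex_ofReal]
    simp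
  rw [L2.inner_def, integral_congr_ae h, h1] at h0
  rw [intervalIntegral.integral_of_le zero_le_one, ← integral_Icc_eq_integral_Ioc]
  exact Complex.ofReal_injective h0

theorem hasSum_norm_sq_zakTerm (f : L2R) : HasSum (fun k => ‖zakTerm f k‖ ^ 2) (‖f‖ ^ 2) := by
  have h1 : Integrable (fun x : ℝ => ‖f x‖ ^ 2) volume := by
    simpa using (Lp.memLp f).integrable_norm_pow (p := 2) (by norm_num)
  have h2 : ‖f‖ ^ 2 = ∫ x : ℝ, ‖f x‖ ^ 2 := by
    have h0 : ((‖f‖ ^ 2 : ℝ) : ℂ) = inner ℂ f f := by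
      rw [inner_self_eq_norm_sq_to_K]; simp
    rw [L2.inner_def] at h0
    simp only [inner_self_eq_norm_sq_to_K] at h0
    have h3 : ∀ x : ℝ, ((RCLike.ofReal ‖f x‖ : ℂ)) ^ 2 = ((‖f x‖ ^ 2 : ℝ) : ℂ) := by
      intro x; simp
    simp only [h3] at h0
    rw [integral_complex_ofReal] at h0
    exact Complex.ofReal_injective h0
  simp only [norm_sq_zakTerm]
  rw [h2]
  exact h1.hasSum_intervalIntegral_comp_add_int

theorem orthogonalFamily_zakTerm (f : L2R) :
    OrthogonalFamily ℂ (fun k : ℤ => (Submodule.span ℂ {zakTerm f k}))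
      fun k => (Submodule.span ℂ {zakTerm f k}).subtypeₗᵢ := by
  refine OrthogonalFamily.of_pairwise fun j k hjk => ?_
  rw [Function.onFun, Submodule.isOrtho_span]
  rintro u rfl v rfl
  exact inner_zakTerm f hjk

/-- The Zak series converges in `L²([0,1]²)` for every `f ∈ L²(ℝ)`. -/
theorem hasSum_zakTerm (f : L2R) : HasSum (zakTerm f) (zakSquare f) := by
  refine Summable.hasSum ?_
  have h := (orthogonalFamily_zakTerm f).summable_iff_norm_sq_summable
    (fun k => ⟨zakTerm f k, Submodule.mem_span_singleton_self _⟩)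
  exact h.2 (hasSum_norm_sq_zakTerm f).summable

/-- `f ↦ Zf|_{[0,1]²}` is isometric on `L²(ℝ)`. -/
theorem norm_zakSquare (f : L2R) : ‖zakSquare f‖ = ‖f‖ := by
  have h1 : Tendsto (fun s : Finset ℤ => ‖∑ k ∈ s, zakTerm f k‖ ^ 2) atTop
      (𝓝 (‖zakSquare f‖ ^ 2)) := ((hasSum_zakTerm f).norm).pow 2
  have h2 : ∀ s : Finset ℤ, ‖∑ k ∈ s, zakTerm f k‖ ^ 2 = ∑ k ∈ s, ‖zakTerm f k‖ ^ 2 := fun s =>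
    (orthogonalFamily_zakTerm f).norm_sum
      (fun k => ⟨zakTerm f k, Submodule.mem_span_singleton_self _⟩) s
  simp only [h2] at h1
  have h3 := tendsto_nhds_unique h1 (hasSum_norm_sq_zakTerm f)
  exact (sq_eq_sq₀ (norm_nonneg _) (norm_nonneg _)).1 h3

/-- On `L¹(ℝ) ∩ L²(ℝ)` the Zak transform is given a.e. on `[0,1]²` by the pointwise series. -/
theorem zakSquare_ae_eq (f : L2R) (hf : Integrable f volume) :
    ∀ᵐ p : ℝ × ℝ ∂(volume.restrict unitSquare), HasSum
      (fun k : ℤ => f (p.1 + k) * Complex.exp (-2 * Real.pi * Complex.I * k * p.2))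
      (zakSquare f p) := by
  have hi : ∀ k : ℤ, ∀ᵐ p : ℝ × ℝ ∂(volume.restrict unitSquare), zakTerm f k p =
      f (p.1 + k) * Complex.exp (-2 * Real.pi * Complex.I * k * p.2) := fun k =>
    (memLp_zakTerm f k).coeFn_toLp
  have hs : ∀ᵐ p : ℝ × ℝ ∂(volume.restrict unitSquare), Summable fun k : ℤ => zakTerm f k p := by
    have hm : ∀ k : ℤ, AEMeasurable (fun p : ℝ × ℝ => ‖zakTerm f k p‖ₑ)
        (volume.restrict unitSquare) := fun k => (Lp.aestronglyMeasurable _).enorm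
    have h1 : ∀ k : ℤ, ∫⁻ p, ‖zakTerm f k p‖ₑ ∂(volume.restrict unitSquare) =
        ENNReal.ofReal (∫ x in (0 : ℝ)..1, ‖f (x + k)‖) := by
      intro k
      have hk : Integrable (fun x : ℝ => f (x + k)) volume := hf.comp_add_right (k : ℝ)
      have e : ∫⁻ p, ‖zakTerm f k p‖ₑ ∂(volume.restrict unitSquare) =
          ∫⁻ p : ℝ × ℝ, ‖f (p.1 + k)‖ₑ * (fun _ : ℝ => (1 : ℝ≥0∞)) p.2
            ∂(volume.restrict unitSquare) := by
        refine lintegral_congr_ae ?_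
        filter_upwards [hi k] with p hp
        rw [hp, enorm_mul, ← ofReal_norm (Complex.exp _), norm_zakPhase]
        simp
      rw [e, restrict_unitSquare, lintegral_prod_mul (f := fun x : ℝ => ‖f (x + k)‖ₑ)
        hk.1.enorm.restrict aemeasurable_const]
      rw [intervalIntegral.integral_of_le zero_le_one, ← integral_Icc_eq_integral_Ioc,
        ofReal_integral_norm_eq_lintegral_enorm hk.restrict]
      simp
    have h2 : ∫⁻ p, ∑' k : ℤ, ‖zakTerm f k p‖ₑ ∂(volume.restrict unitSquare) ≠ ∞ := by
      rw [lintegral_tsum hm]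
      simp only [h1]
      exact (hf.norm.hasSum_intervalIntegral_comp_add_int).summable.tsum_ofReal_ne_top
    filter_upwards [ae_lt_top' (AEMeasurable.tsum hm) h2] with p hp
    have h3 : Summable fun k : ℤ => ‖zakTerm f k p‖₊ := ENNReal.tsum_coe_ne_top_iff_summable.1 hp.ne
    exact Summable.of_nnnorm h3
  let F : Finset ℤ → Lp ℂ 2 ((volume : Measure (ℝ × ℝ)).restrict unitSquare) :=
    fun s => ∑ k ∈ s, zakTerm f k
  have hT : Tendsto (fun n : ℕ => F (Finset.Icc (-n : ℤ) n)) atTop (𝓝 (zakSquare f)) :=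
    (hasSum_zakTerm f).comp Finset.tendsto_Icc_neg
  obtain ⟨ns, hns, hae⟩ := (tendstoInMeasure_of_tendsto_Lp hT).exists_seq_tendsto_ae
  have hF : ∀ n : ℕ, ∀ᵐ p : ℝ × ℝ ∂(volume.restrict unitSquare),
      F (Finset.Icc (-n : ℤ) n) p = ∑ k ∈ Finset.Icc (-n : ℤ) n, zakTerm f k p := fun n => by
    filter_upwards [Lp.coeFn_finsetSum (Finset.Icc (-n : ℤ) n) (zakTerm f)] with p hp
    rw [Finset.sum_apply] at hp
    exact hp
  filter_upwards [hs, hae, ae_all_iff.2 hF, ae_all_iff.2 hi] with p h1 h2 h3 h4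
  have h5 : Tendsto (fun i => ∑ k ∈ Finset.Icc (-(ns i : ℕ) : ℤ) (ns i), zakTerm f k p) atTop
      (𝓝 (∑' k, zakTerm f k p)) :=
    (h1.hasSum.comp Finset.tendsto_Icc_neg).comp hns.tendsto_atTop
  simp only [h3] at h2
  have h6 := tendsto_nhds_unique h2 h5
  rw [h6]
  simpa only [h4] using h1.hasSum

/-! ## Functions of vanishing mean oscillation on `ℝ²` -/

/-- A cube in `ℝ²`: a product of two closed intervals of the same length `δ > 0`. -/
def IsCube (Q : Set (ℝ × ℝ)) : Prop :=
  ∃ a b δ : ℝ, 0 < δ ∧ Q = Icc a (a + δ) ×ˢ Icc b (b + δ)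

/-- The mean oscillation `M_Q(F)`, the mean of `|F - F_Q|` over `Q`, where `F_Q` is the mean of `F`
over `Q`. -/
noncomputable def meanOsc (F : ℝ × ℝ → ℂ) (Q : Set (ℝ × ℝ)) : ℝ :=
  ⨍ z in Q, ‖F z - ⨍ w in Q, F w‖

/-- `S_{ε,U}(F)`, the supremum of the mean oscillations of `F` over the cubes `Q ⊆ U` with
`|Q| < ε`, as an element of `[0, ∞]`. -/
noncomputable def smallOsc (F : ℝ × ℝ → ℂ) (U : Set (ℝ × ℝ)) (ε : ℝ) : ℝ≥0∞ :=
  ⨆ (Q : Set (ℝ × ℝ)) (_ : IsCube Q ∧ Q ⊆ U ∧ volume Q < ENNReal.ofReal ε),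
    ENNReal.ofReal (meanOsc F Q)

/-- `F` has bounded mean oscillation on `U`. -/
def IsBMO (F : ℝ × ℝ → ℂ) (U : Set (ℝ × ℝ)) : Prop :=
  LocallyIntegrable F volume ∧
    (⨆ (Q : Set (ℝ × ℝ)) (_ : IsCube Q ∧ Q ⊆ U), ENNReal.ofReal (meanOsc F Q)) < ∞

/-- `F` has vanishing mean oscillation on `U`. -/
def IsVMO (F : ℝ × ℝ → ℂ) (U : Set (ℝ × ℝ)) : Prop :=
  IsBMO F U ∧ Tendsto (smallOsc F U) (𝓝[>] 0) (𝓝 0)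

/-- `F ∈ VMO_loc(ℝ²)`: `F` has vanishing mean oscillation on every bounded open set. -/
def IsVMOLoc (F : ℝ × ℝ → ℂ) : Prop :=
  ∀ U : Set (ℝ × ℝ), IsOpen U → Bornology.IsBounded U → IsVMO F U

/-!
Let `F = Zg` and write `Λ = ℤ l₁ + ℤ l₂`. The Zak transform turns the time-frequency shift `π(a)`
into the operator `tau a`, a translation by `a` followed by multiplication by a character
(`zak_timeFreqShift`). Quasi-periodicity makes `tau a` a multiplication by a character for
`a ∈ ℤ²`. Choose `K` with `K Λ ⊆ ℤ²`. Then `K Λ` acts on `F` by characters, which are all periodic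
with respect to the dual lattice `ℤ d₁ + ℤ d₂`, so membership in the Gabor space and the Riesz
bounds can be read off from the samples of the `K²` functions `tau l F`, `l ∈ Λ / K Λ`, at the
points `ξ + d`, where `d` runs over the dual lattice modulo `R` times itself, `R dᵢ ∈ ℤ²`. The Riesz
bounds become two-sided bounds on these sample matrices for almost every `ξ`
(`LatticeData.exists_ae_bounds`); in particular `F` is bounded.

Summing along `l₁` with suitable phases (`LatticeData.fold`) gives smaller matrices
`Φ(ξ) = Φ_0(ξ)`, and `Φ_ν(ξ)` for the shifts `tau ν F`, with `K` columns (`LatticeData.fiber`).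
They satisfy `det Φᴴ Φ ≥ δ > 0`. A shift by `l₁` or by `K l₂` multiplies `Φ` by a scalar character.
If `π(ν) g` lies in the Gabor space, then the columns of `Φ_ν` lie in the range of `Φ`
(`LatticeData.PreservesRange`). Such `ν` form a semigroup containing `l₁` and `K l₂`, and on it the
functions `d_ν = det Φᴴ Φ_ν` (`LatticeData.fiberDet`) are multiplicative in `ν` up to translations,
constants and positive factors (`LatticeData.PreservesRange.fiberDet_add`), bounded, bounded away
from zero, and periodic under `d₂`.

Now suppose that `F` is in `VMO_loc`. Being bounded, such functions form an algebra, so the mean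
oscillation of `d_ν` over small squares tends to zero, uniformly for bounded `ν`. Hence the averages
of `d_ν` over squares of a small fixed size do not vanish and are multiplicative up to small errors.
They are continuous and periodic under `d₂`, so they have a winding number `ω(ν)` along `d₂`. It is
additive in `ν` and bounded for bounded `ν`, and `ω(l₁) = 0`, `ω(K l₂) = -K`
(`LatticeData.IsSymbol.exists_winding`). Let `ν = x l₁ + y l₂` be a shift with
`π(ν) g` in the Gabor space. Reducing the multiples `n ν` modulo `ℤ l₁ + ℤ K l₂` gives a bounded
sequence of range-preserving shifts, whose winding numbers `n ω(ν) + K ⌊n y / K⌋` (for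
`0 ≤ y < K`) can only be bounded if `ω(ν) = -y`. So `y` is an integer
(`LatticeData.exists_int_of_mem_gaborSpace`). Exchanging `l₁` and `l₂` shows that `x` is an integer
as well, that is, `ν ∈ Λ`.
-/

/-! ### Characters and the symplectic form -/

/-- The character `t ↦ e^{2πit}` of `ℝ`. -/
noncomputable def cis (t : ℝ) : ℂ := Complex.exp (2 * Real.pi * Complex.I * t)

theorem cis_add (s t : ℝ) : cis (s + t) = cis s * cis t := by
  rw [cis, cis, cis, ← Complex.exp_add]; congr 1; push_cast; ring

@[simp] theorem cis_zero : cis 0 = 1 := by simp [cis]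

theorem cis_eq_exp_mul_I (t : ℝ) : cis t = Complex.exp ((2 * Real.pi * t : ℝ) * Complex.I) := by
  rw [cis]; congr 1; push_cast; ring

@[simp] theorem norm_cis (t : ℝ) : ‖cis t‖ = 1 := by
  rw [cis_eq_exp_mul_I]; exact Complex.norm_exp_ofReal_mul_I _

theorem cis_ne_zero (t : ℝ) : cis t ≠ 0 := Complex.exp_ne_zero _

@[simp] theorem cis_intCast (n : ℤ) : cis n = 1 := by
  rw [cis, Complex.exp_eq_one_iff]; exact ⟨n, by push_cast; ring⟩

theorem cis_neg_mul_self (t : ℝ) : cis (-t) * cis t = 1 := by rw [← cis_add]; simp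

theorem conj_cis (t : ℝ) : (starRingEnd ℂ) (cis t) = cis (-t) := by
  rw [cis, cis, ← Complex.exp_conj]
  simp only [map_mul, Complex.conj_ofReal, Complex.conj_I, map_ofNat]
  congr 1; push_cast; ring

theorem cis_nat_mul (n : ℕ) (t : ℝ) : cis (n * t) = cis t ^ n := by
  rw [cis, cis, ← Complex.exp_nat_mul]; congr 1; push_cast; ring

theorem cis_add_intCast (t : ℝ) (n : ℤ) : cis (t + n) = cis t := by rw [cis_add]; simp

theorem cis_congr {s t : ℝ} (n : ℤ) (h : s = t + n) : cis s = cis t := by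
  rw [h, cis_add_intCast]

@[fun_prop] theorem continuous_cis : Continuous cis := by unfold cis; fun_prop

theorem norm_cis_sub_cis_le (s t : ℝ) : ‖cis s - cis t‖ ≤ 2 * Real.pi * |s - t| := by
  have h1 : cis s - cis t = cis t * (cis (s - t) - 1) := by
    rw [mul_sub, ← cis_add]; simp
  rw [h1, norm_mul, norm_cis, one_mul, cis_eq_exp_mul_I, mul_comm _ Complex.I]
  refine (Real.norm_exp_I_mul_ofReal_sub_one_le).trans ?_
  rw [Real.norm_eq_abs, abs_mul, abs_of_pos Real.two_pi_pos]

/-- The standard symplectic form on `ℝ²`. -/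
def symp (z w : ℝ × ℝ) : ℝ := z.1 * w.2 - z.2 * w.1

theorem symp_add_right (z w w' : ℝ × ℝ) : symp z (w + w') = symp z w + symp z w' := by
  simp [symp]; ring

theorem symp_add_left (z z' w : ℝ × ℝ) : symp (z + z') w = symp z w + symp z' w := by
  simp [symp]; ring

theorem symp_sub_right (z w w' : ℝ × ℝ) : symp z (w - w') = symp z w - symp z w' := by
  simp [symp]; ring

theorem symp_smul_left (c : ℝ) (z w : ℝ × ℝ) : symp (c • z) w = c * symp z w := by
  simp [symp]; ring

theorem symp_smul_right (c : ℝ) (z w : ℝ × ℝ) : symp z (c • w) = c * symp z w := by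
  simp [symp]; ring

@[simp] theorem symp_self (z : ℝ × ℝ) : symp z z = 0 := by simp [symp]; ring

theorem symp_comm (z w : ℝ × ℝ) : symp z w = -symp w z := by simp [symp]; ring

theorem continuous_symp (z : ℝ × ℝ) : Continuous (symp z) := by unfold symp; fun_prop

theorem abs_symp_le (l z : ℝ × ℝ) : |symp l z| ≤ (|l.1| + |l.2|) * ‖z‖ := by
  have h1 : |z.1| ≤ ‖z‖ := norm_fst_le z
  have h2 : |z.2| ≤ ‖z‖ := norm_snd_le z
  rw [symp]
  refine (abs_sub _ _).trans ?_
  rw [abs_mul, abs_mul, add_mul]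
  gcongr

/-- A point of `ℝ²` with integer coordinates. -/
def IsIntegerPoint (z : ℝ × ℝ) : Prop := ∃ m n : ℤ, z = ((m : ℝ), (n : ℝ))

theorem IsIntegerPoint.intCast_smul {z : ℝ × ℝ} (h : IsIntegerPoint z) (a : ℤ) :
    IsIntegerPoint ((a : ℝ) • z) := by
  obtain ⟨m, n, rfl⟩ := h; exact ⟨a * m, a * n, by simp⟩

theorem IsIntegerPoint.add {z w : ℝ × ℝ} (h : IsIntegerPoint z) (h' : IsIntegerPoint w) :
    IsIntegerPoint (z + w) := by
  obtain ⟨m, n, rfl⟩ := h; obtain ⟨m', n', rfl⟩ := h'; exact ⟨m + m', n + n', by simp⟩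

/-! ### Time-frequency shifts of functions on the time-frequency plane -/

/-- The action on Zak transforms of the time-frequency shift by `a`: modulation in the first
variable by `a.2` after translation by `a`. -/
noncomputable def tau (a : ℝ × ℝ) (H : ℝ × ℝ → ℂ) (z : ℝ × ℝ) : ℂ := cis (a.2 * z.1) * H (z - a)

theorem tau_zero (H : ℝ × ℝ → ℂ) : tau 0 H = H := by funext z; simp [tau]

theorem tau_tau (a b : ℝ × ℝ) (H : ℝ × ℝ → ℂ) (z : ℝ × ℝ) :
    tau a (tau b H) z = cis (-(a.1 * b.2)) * tau (a + b) H z := by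
  simp only [tau, ← mul_assoc, ← cis_add]
  rw [show z - a - b = z - (a + b) by abel]
  congr 2
  simp; ring

/-- Time-frequency shifts commute up to a phase given by the symplectic form. -/
theorem tau_comm (a b : ℝ × ℝ) (H : ℝ × ℝ → ℂ) (z : ℝ × ℝ) :
    tau a (tau b H) z = cis (-symp a b) * tau b (tau a H) z := by
  rw [tau_tau, tau_tau, add_comm b a, ← mul_assoc, ← cis_add]
  congr 2; simp [symp]; ring

theorem tau_const_mul (a : ℝ × ℝ) (c : ℂ) (H : ℝ × ℝ → ℂ) (z : ℝ × ℝ) :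
    tau a (fun w => c * H w) z = c * tau a H z := by simp only [tau]; ring

theorem measurable_tau {H : ℝ × ℝ → ℂ} (hH : Measurable H) (a : ℝ × ℝ) :
    Measurable (tau a H) := by
  unfold tau
  exact (by fun_prop : Continuous fun z : ℝ × ℝ => cis (a.2 * z.1)).measurable.mul
    (hH.comp (measurable_id.sub_const a))

/-- The quasi-periodicity of Zak transforms with respect to `ℤ²`, required at every point. -/
def QuasiPeriodic (H : ℝ × ℝ → ℂ) : Prop :=
  ∀ (z : ℝ × ℝ) (m n : ℤ), H (z + ((m : ℝ), (n : ℝ))) = cis (m * z.2) * H z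

/-- On quasi-periodic functions, shifts by integer points are multiplications by characters. -/
theorem QuasiPeriodic.tau_integral {H : ℝ × ℝ → ℂ} (hH : QuasiPeriodic H) {a : ℝ × ℝ}
    (ha : IsIntegerPoint a) (z : ℝ × ℝ) : tau a H z = cis (-symp a z) * H z := by
  obtain ⟨m, n, rfl⟩ := ha
  have := hH z (-m) (-n)
  simp only [tau]
  rw [show z - ((m : ℝ), (n : ℝ)) = z + (((-m : ℤ) : ℝ), ((-n : ℤ) : ℝ)) by
    ext <;> simp [sub_eq_add_neg],
    this, ← mul_assoc, ← cis_add]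
  congr 2; simp [symp]; ring

theorem quasiPeriodic_tau {H : ℝ × ℝ → ℂ} (hH : QuasiPeriodic H) (a : ℝ × ℝ) :
    QuasiPeriodic (tau a H) := by
  intro z m n
  simp only [tau]
  rw [show z + ((m : ℝ), (n : ℝ)) - a = (z - a) + ((m : ℝ), (n : ℝ)) by abel, hH]
  simp only [← mul_assoc, ← cis_add]
  congr 2; simp; ring

/-- Products `conj H₁ · H₂` of quasi-periodic functions are `ℤ²`-periodic. -/
theorem QuasiPeriodic.conj_mul {H H' : ℝ × ℝ → ℂ} (hH : QuasiPeriodic H)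
    (hH' : QuasiPeriodic H') {a : ℝ × ℝ} (ha : IsIntegerPoint a) (z : ℝ × ℝ) :
    (starRingEnd ℂ) (H (z + a)) * H' (z + a) = (starRingEnd ℂ) (H z) * H' z := by
  obtain ⟨m, n, rfl⟩ := ha
  rw [hH, hH', map_mul, conj_cis, mul_mul_mul_comm, cis_neg_mul_self, one_mul]

theorem QuasiPeriodic.norm_add {H : ℝ × ℝ → ℂ} (hH : QuasiPeriodic H) {a : ℝ × ℝ}
    (ha : IsIntegerPoint a) (z : ℝ × ℝ) : ‖H (z + a)‖ = ‖H z‖ := by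
  obtain ⟨m, n, rfl⟩ := ha; rw [hH, norm_mul, norm_cis, one_mul]

/-! ### The Zak transform on the plane -/

theorem zak_eq_cis (f : L2R) (p : ℝ × ℝ) :
    zak f p = cis (⌊p.1⌋ * p.2) * zakSquare f (Int.fract p.1, Int.fract p.2) := by
  rw [zak, cis]; congr 2; push_cast; ring

theorem quasiPeriodic_zak (f : L2R) : QuasiPeriodic (zak f) := by
  intro z m n
  rw [zak_eq_cis, zak_eq_cis]
  simp only [Prod.fst_add, Prod.snd_add, Int.floor_add_intCast, Int.fract_add_intCast]
  rw [← mul_assoc, ← cis_add]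
  congr 1
  exact cis_congr ((⌊z.1⌋ + m) * n) (by push_cast; ring)

theorem measurable_zak (f : L2R) : Measurable (zak f) := by
  have h1 : Measurable (zakSquare f : ℝ × ℝ → ℂ) := (Lp.stronglyMeasurable _).measurable
  have h2 : Measurable fun p : ℝ × ℝ => ((⌊p.1⌋ : ℝ)) * p.2 :=
    (measurable_from_top.comp (Int.measurable_floor.comp measurable_fst)).mul measurable_snd
  have : zak f = fun p => cis (⌊p.1⌋ * p.2) * zakSquare f (Int.fract p.1, Int.fract p.2) :=
    funext (zak_eq_cis f)
  rw [this]
  exact (continuous_cis.measurable.comp h2).mul (h1.comp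
    ((measurable_fract.comp measurable_fst).prodMk (measurable_fract.comp measurable_snd)))

theorem measurableSet_unitSquare : MeasurableSet unitSquare :=
  measurableSet_Icc.prod measurableSet_Icc

/-- Almost everywhere statements on the unit square transfer to the plane modulo `ℤ²`. -/
theorem ae_fract {P : ℝ × ℝ → Prop}
    (h : ∀ᵐ q ∂((volume : Measure (ℝ × ℝ)).restrict unitSquare), P q) :
    ∀ᵐ p : ℝ × ℝ, P (Int.fract p.1, Int.fract p.2) := by
  rw [ae_restrict_iff' measurableSet_unitSquare] at h
  have h1 : ∀ mn : ℤ × ℤ, ∀ᵐ p : ℝ × ℝ, p - ((mn.1 : ℝ), (mn.2 : ℝ)) ∈ unitSquare →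
      P (p - ((mn.1 : ℝ), (mn.2 : ℝ))) := fun mn =>
    (measurePreserving_sub_right (volume : Measure (ℝ × ℝ)) _).quasiMeasurePreserving.ae h
  filter_upwards [ae_all_iff.2 h1] with p hp
  refine hp (⌊p.1⌋, ⌊p.2⌋) ⟨?_, ?_⟩
  · exact ⟨Int.fract_nonneg _, (Int.fract_lt_one _).le⟩
  · exact ⟨Int.fract_nonneg _, (Int.fract_lt_one _).le⟩

theorem ae_restrict_unitSquare_lt : ∀ᵐ p ∂((volume : Measure (ℝ × ℝ)).restrict unitSquare),
    p.1 ∈ Ico (0 : ℝ) 1 ∧ p.2 ∈ Ico (0 : ℝ) 1 := by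
  have h1 : ∀ᵐ p : ℝ × ℝ, p.1 ≠ 1 :=
    Measure.quasiMeasurePreserving_fst.ae (Measure.ae_ne volume (1 : ℝ))
  have h2 : ∀ᵐ p : ℝ × ℝ, p.2 ≠ 1 :=
    Measure.quasiMeasurePreserving_snd.ae (Measure.ae_ne volume (1 : ℝ))
  filter_upwards [ae_restrict_mem measurableSet_unitSquare, ae_restrict_of_ae h1,
    ae_restrict_of_ae h2] with p hp h1 h2
  exact ⟨⟨hp.1.1, lt_of_le_of_ne hp.1.2 h1⟩, ⟨hp.2.1, lt_of_le_of_ne hp.2.2 h2⟩⟩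

theorem zak_ae_eq_zakSquare (f : L2R) :
    zak f =ᵐ[(volume : Measure (ℝ × ℝ)).restrict unitSquare] zakSquare f := by
  filter_upwards [ae_restrict_unitSquare_lt] with p hp
  rw [zak_eq_cis, Int.floor_eq_zero_iff.2 hp.1, Int.fract_eq_self.2 hp.1, Int.fract_eq_self.2 hp.2]
  simp

/-- The Zak transform is isometric from `L²(ℝ)` to `L²` of the unit square. -/
theorem eLpNorm_zak (f : L2R) :
    eLpNorm (zak f) 2 ((volume : Measure (ℝ × ℝ)).restrict unitSquare) = ‖f‖ₑ := by
  rw [eLpNorm_congr_ae (zak_ae_eq_zakSquare f), ← Lp.enorm_def, ← ofReal_norm, norm_zakSquare,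
    ofReal_norm]

theorem zakTerm_add (f f' : L2R) (k : ℤ) : zakTerm (f + f') k = zakTerm f k + zakTerm f' k := by
  rw [zakTerm, zakTerm, zakTerm, ← MemLp.toLp_add]
  refine MemLp.toLp_congr _ _ ?_
  have h : ∀ᵐ p : ℝ × ℝ, (f + f') (p.1 + k) = f (p.1 + k) + f' (p.1 + k) :=
    Measure.quasiMeasurePreserving_fst.ae
      ((measurePreserving_add_right volume (k : ℝ)).quasiMeasurePreserving.ae (Lp.coeFn_add f f'))
  filter_upwards [ae_restrict_of_ae h] with p hp
  simp only [hp, Pi.add_apply, add_mul]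

theorem zakTerm_smul (c : ℂ) (f : L2R) (k : ℤ) : zakTerm (c • f) k = c • zakTerm f k := by
  rw [zakTerm, zakTerm, ← MemLp.toLp_const_smul]
  refine MemLp.toLp_congr _ _ ?_
  have h : ∀ᵐ p : ℝ × ℝ, (c • f) (p.1 + k) = c * f (p.1 + k) :=
    Measure.quasiMeasurePreserving_fst.ae
      ((measurePreserving_add_right volume (k : ℝ)).quasiMeasurePreserving.ae (Lp.coeFn_smul c f))
  filter_upwards [ae_restrict_of_ae h] with p hp
  simp [hp, mul_assoc]

theorem zakSquare_add (f f' : L2R) : zakSquare (f + f') = zakSquare f + zakSquare f' :=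
  (hasSum_zakTerm _).unique (by
    rw [show zakTerm (f + f') = fun k => zakTerm f k + zakTerm f' k from
      funext (zakTerm_add f f')]
    exact (hasSum_zakTerm f).add (hasSum_zakTerm f'))

theorem zakSquare_smul (c : ℂ) (f : L2R) : zakSquare (c • f) = c • zakSquare f :=
  (hasSum_zakTerm _).unique (by
    rw [show zakTerm (c • f) = fun k => c • zakTerm f k from funext (zakTerm_smul c f)]
    exact (hasSum_zakTerm f).const_smul c)

theorem zak_add (f f' : L2R) : ∀ᵐ p, zak (f + f') p = zak f p + zak f' p := by
  have h := Lp.coeFn_add (zakSquare f) (zakSquare f')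
  rw [← zakSquare_add] at h
  filter_upwards [ae_fract h] with p hp
  simp only [Pi.add_apply] at hp
  rw [zak_eq_cis, zak_eq_cis, zak_eq_cis, hp, mul_add]

theorem zak_smul (c : ℂ) (f : L2R) : ∀ᵐ p, zak (c • f) p = c * zak f p := by
  have h := Lp.coeFn_smul c (zakSquare f)
  rw [← zakSquare_smul] at h
  filter_upwards [ae_fract h] with p hp
  simp only [Pi.smul_apply, smul_eq_mul] at hp
  rw [zak_eq_cis, zak_eq_cis, hp]; ring

theorem zak_zero : ∀ᵐ p, zak 0 p = 0 := by
  filter_upwards [zak_smul 0 0] with p hp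
  simpa using hp

/-- The Zak transform as an isometry on `L²(ℝ)`. -/
noncomputable def zakSquareLI :
    L2R →ₗᵢ[ℂ] Lp ℂ 2 ((volume : Measure (ℝ × ℝ)).restrict unitSquare) where
  toFun := zakSquare
  map_add' := zakSquare_add
  map_smul' := zakSquare_smul
  norm_map' := norm_zakSquare

/-- An `L²`-convergent sequence has a subsequence whose Zak transforms converge a.e. -/
theorem exists_subseq_zak_tendsto {f : ℕ → L2R} {f₀ : L2R} (h : Tendsto f atTop (𝓝 f₀)) :
    ∃ ns : ℕ → ℕ, StrictMono ns ∧
      ∀ᵐ p, Tendsto (fun i => zak (f (ns i)) p) atTop (𝓝 (zak f₀ p)) := by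
  have hT : Tendsto (fun n => zakSquare (f n)) atTop (𝓝 (zakSquare f₀)) :=
    (zakSquareLI.continuous.tendsto f₀).comp h
  obtain ⟨ns, hns, hae⟩ := (tendstoInMeasure_of_tendsto_Lp hT).exists_seq_tendsto_ae
  refine ⟨ns, hns, ?_⟩
  filter_upwards [ae_fract hae] with p hp
  simp only [zak_eq_cis]
  exact hp.const_mul _

/-! ### Time-frequency shifts and the Zak transform -/

theorem timeFreqShift_ae (z : ℝ × ℝ) (f : L2R) :
    ∀ᵐ x, timeFreqShift z f x = cis (z.2 * x) * f (x - z.1) := by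
  filter_upwards [(memLp_timeFreqShift z.1 z.2 f).coeFn_toLp] with x hx
  rw [timeFreqShift, hx, cis]; congr 2; push_cast; ring

theorem ae_comp_sub {P : ℝ → Prop} (h : ∀ᵐ x, P x) (a : ℝ) : ∀ᵐ x, P (x - a) :=
  (measurePreserving_sub_right volume a).quasiMeasurePreserving.ae h

theorem ae_comp_sub_prod {P : ℝ × ℝ → Prop} (h : ∀ᵐ x, P x) (a : ℝ × ℝ) : ∀ᵐ x, P (x - a) :=
  (measurePreserving_sub_right volume a).quasiMeasurePreserving.ae h

theorem ae_comp_add_prod {P : ℝ × ℝ → Prop} (h : ∀ᵐ x, P x) (a : ℝ × ℝ) : ∀ᵐ x, P (x + a) :=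
  (measurePreserving_add_right volume a).quasiMeasurePreserving.ae h

theorem timeFreqShift_add (z : ℝ × ℝ) (f f' : L2R) :
    timeFreqShift z (f + f') = timeFreqShift z f + timeFreqShift z f' := by
  refine Lp.ext ?_
  filter_upwards [timeFreqShift_ae z (f + f'), timeFreqShift_ae z f, timeFreqShift_ae z f',
    Lp.coeFn_add (timeFreqShift z f) (timeFreqShift z f'),
    ae_comp_sub (Lp.coeFn_add f f') z.1] with x h1 h2 h3 h4 h5
  rw [h4, Pi.add_apply, h1, h2, h3, h5, Pi.add_apply, mul_add]

theorem timeFreqShift_smul (z : ℝ × ℝ) (c : ℂ) (f : L2R) :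
    timeFreqShift z (c • f) = c • timeFreqShift z f := by
  refine Lp.ext ?_
  filter_upwards [timeFreqShift_ae z (c • f), timeFreqShift_ae z f,
    Lp.coeFn_smul c (timeFreqShift z f), ae_comp_sub (Lp.coeFn_smul c f) z.1] with x h1 h2 h3 h4
  rw [h3, Pi.smul_apply, h1, h2, h4, Pi.smul_apply, smul_eq_mul, smul_eq_mul]; ring

theorem norm_timeFreqShift (z : ℝ × ℝ) (f : L2R) : ‖timeFreqShift z f‖ = ‖f‖ := by
  rw [Lp.norm_def, Lp.norm_def]
  congr 1
  calc eLpNorm (timeFreqShift z f) 2 volume = eLpNorm (fun x => f (x - z.1)) 2 volume := by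
        refine eLpNorm_congr_norm_ae ?_
        filter_upwards [timeFreqShift_ae z f] with x hx
        rw [hx, norm_mul, norm_cis, one_mul]
    _ = eLpNorm f 2 volume :=
        eLpNorm_comp_measurePreserving (Lp.aestronglyMeasurable f)
          (measurePreserving_sub_right volume z.1)

/-- The time-frequency shift as a linear isometry. -/
noncomputable def timeFreqShiftLI (z : ℝ × ℝ) : L2R →ₗᵢ[ℂ] L2R where
  toFun := timeFreqShift z
  map_add' := timeFreqShift_add z
  map_smul' := timeFreqShift_smul z
  norm_map' := norm_timeFreqShift z

theorem continuous_timeFreqShift (z : ℝ × ℝ) : Continuous (timeFreqShift z) :=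
  (timeFreqShiftLI z).continuous

theorem HasSum.congr_terms {f f' : ℤ → ℂ} {a : ℂ} (h : HasSum f a) (hf : ∀ k, f' k = f k) :
    HasSum f' a := by rwa [funext hf]

/-- For integrable functions, the Zak transform is given a.e. on the plane by the Zak series. -/
theorem zak_ae_hasSum (f : L2R) (hf : Integrable f volume) :
    ∀ᵐ p : ℝ × ℝ, HasSum (fun k : ℤ => f (p.1 + k) * cis (-(k * p.2))) (zak f p) := by
  filter_upwards [ae_fract (zakSquare_ae_eq f hf)] with p hp
  rw [zak_eq_cis]
  have h := (hp.mul_left (cis (⌊p.1⌋ * p.2)))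
  rw [← (Equiv.subRight ⌊p.1⌋).hasSum_iff]
  refine h.congr_terms fun k => ?_
  simp only [Function.comp, Equiv.subRight_apply]
  rw [show -2 * Real.pi * Complex.I * (k : ℂ) * (Int.fract p.2 : ℝ) =
    2 * Real.pi * Complex.I * ((-(k * Int.fract p.2) : ℝ) : ℂ) by push_cast; ring, ← cis,
    mul_left_comm, ← cis_add, show p.1 + ((k - ⌊p.1⌋ : ℤ) : ℝ) = Int.fract p.1 + k by
      rw [Int.fract]; push_cast; ring]
  congr 1
  exact cis_congr (-(k * ⌊p.2⌋)) (by rw [Int.fract]; push_cast; ring)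

theorem zak_timeFreqShift_of_integrable (z : ℝ × ℝ) (f : L2R) (hf : Integrable f volume) :
    ∀ᵐ p, zak (timeFreqShift z f) p = tau z (zak f) p := by
  have hi : Integrable (timeFreqShift z f) volume := by
    have : Integrable (fun x => cis (z.2 * x) * f (x - z.1)) volume := by
      refine (hf.comp_sub_right z.1).bdd_mul (c := 1) ?_ ?_
      · exact (by fun_prop : Continuous fun x => cis (z.2 * x)).aestronglyMeasurable
      · exact Eventually.of_forall fun x => by simp
    exact this.congr ((timeFreqShift_ae z f).mono fun x hx => hx.symm)
  have h1 : ∀ᵐ p : ℝ × ℝ, ∀ k : ℤ, timeFreqShift z f (p.1 + k) =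
      cis (z.2 * (p.1 + k)) * f (p.1 + k - z.1) := by
    rw [ae_all_iff]
    intro k
    exact Measure.quasiMeasurePreserving_fst.ae
      ((measurePreserving_add_right volume (k : ℝ)).quasiMeasurePreserving.ae
        (timeFreqShift_ae z f))
  filter_upwards [zak_ae_hasSum _ hi, h1, ae_comp_sub_prod (zak_ae_hasSum f hf) z] with p h2 h3 h4
  refine h2.unique ?_
  simp only [h3]
  rw [tau]
  refine (h4.mul_left (cis (z.2 * p.1))).congr_terms fun k => ?_
  simp only [Prod.fst_sub, Prod.snd_sub]
  rw [show p.1 - z.1 + (k : ℝ) = p.1 + k - z.1 by ring, mul_right_comm, ← cis_add,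
    mul_left_comm, ← cis_add, mul_comm]
  congr 2; ring

theorem dense_integrable : Dense {f : L2R | Integrable f volume} := by
  intro f
  rw [Metric.mem_closure_iff]
  intro ε hε
  obtain ⟨h, hc, hle, hcont, hm⟩ := (Lp.memLp f).exists_hasCompactSupport_eLpNorm_sub_le
    (by norm_num) (ε := ENNReal.ofReal (ε / 2)) (by simpa using hε)
  refine ⟨hm.toLp, ?_, ?_⟩
  · exact (hcont.integrable_of_hasCompactSupport hc).congr hm.coeFn_toLp.symm
  · have h1 : eLpNorm ((f : ℝ → ℂ) - (hm.toLp h : ℝ → ℂ)) 2 volume ≤ ENNReal.ofReal (ε / 2) := by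
      refine (eLpNorm_congr_ae ?_).trans_le hle
      filter_upwards [hm.coeFn_toLp] with x hx
      simp [hx]
    rw [Lp.dist_def]
    refine (ENNReal.toReal_mono ENNReal.ofReal_ne_top h1).trans_lt ?_
    rw [ENNReal.toReal_ofReal (by positivity)]
    linarith

/-- The Zak transform intertwines time-frequency shifts with the operators `tau`. By density it
suffices to consider integrable functions, for which the Zak series converges pointwise. -/
theorem zak_timeFreqShift (z : ℝ × ℝ) (f : L2R) :
    ∀ᵐ p, zak (timeFreqShift z f) p = tau z (zak f) p := by
  obtain ⟨u, hu, hlim⟩ := mem_closure_iff_seq_limit.1 (dense_integrable f)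
  obtain ⟨ns, hns, h1⟩ := exists_subseq_zak_tendsto hlim
  obtain ⟨ms, hms, h2⟩ := exists_subseq_zak_tendsto
    (((continuous_timeFreqShift z).tendsto f).comp (hlim.comp hns.tendsto_atTop))
  have h3 : ∀ᵐ p, ∀ n, zak (timeFreqShift z (u n)) p = tau z (zak (u n)) p :=
    ae_all_iff.2 fun n => zak_timeFreqShift_of_integrable z (u n) (hu n)
  filter_upwards [h2, h3, ae_comp_sub_prod h1 z] with p h2 h3 h1
  refine tendsto_nhds_unique h2 ?_
  simp only [Function.comp, h3]
  exact (h1.comp hms.tendsto_atTop).const_mul _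

/-! ### Winding numbers -/

/-- The nonvanishing function `f` on the plane has a continuous logarithm that increases by
`2πi w` under translation by `κ`; that is, `f` is `κ`-periodic with winding number `w`. For `κ ≠ 0`
the number `w` counts the turns of `f` around the origin along a segment from `z` to `z + κ`. -/
def HasWinding (κ : ℝ × ℝ) (f : ℝ × ℝ → ℂ) (w : ℤ) : Prop :=
  ∃ φ : ℝ × ℝ → ℂ, Continuous φ ∧ (∀ z, f z = Complex.exp (φ z)) ∧
    ∀ z, φ (z + κ) = φ z + w * (2 * Real.pi * Complex.I)

theorem exists_int_of_continuous_of_exp_eq_one {X : Type*} [TopologicalSpace X]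
    [PreconnectedSpace X] [Nonempty X] {ψ : X → ℂ} (hψ : Continuous ψ)
    (h : ∀ x, Complex.exp (ψ x) = 1) : ∃ n : ℤ, ∀ x, ψ x = n * (2 * Real.pi * Complex.I) := by
  choose n hn using fun x => Complex.exp_eq_one_iff.1 (h x)
  have h1 : ∀ x, ((n x : ℤ) : ℝ) = (ψ x).im / (2 * Real.pi) := by
    intro x
    have : (ψ x).im = n x * (2 * Real.pi) := by rw [hn x]; simp
    rw [this]; field_simp
  have hc : Continuous n := by
    rw [Int.isClosedEmbedding_coe_real.isInducing.continuous_iff]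
    have : (fun x => (ψ x).im / (2 * Real.pi)) = (Int.cast : ℤ → ℝ) ∘ n :=
      funext fun x => (h1 x).symm
    rw [← this]; fun_prop
  obtain ⟨x₀⟩ := ‹Nonempty X›
  exact ⟨n x₀, fun x => by rw [hn x, PreconnectedSpace.constant ‹_› hc (x := x) (y := x₀)]⟩

namespace HasWinding

variable {κ : ℝ × ℝ} {f g : ℝ × ℝ → ℂ} {w w' : ℤ}

theorem continuous (h : HasWinding κ f w) : Continuous f := by
  obtain ⟨φ, h1, h2, -⟩ := h
  rw [funext h2]; fun_prop

theorem ne_zero (h : HasWinding κ f w) (z : ℝ × ℝ) : f z ≠ 0 := by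
  obtain ⟨φ, -, h2, -⟩ := h
  rw [h2]; exact Complex.exp_ne_zero _

theorem periodic (h : HasWinding κ f w) (z : ℝ × ℝ) : f (z + κ) = f z := by
  obtain ⟨φ, -, h2, h3⟩ := h
  rw [h2, h2, h3, Complex.exp_add, Complex.exp_int_mul_two_pi_mul_I, mul_one]

theorem unique (h : HasWinding κ f w) (h' : HasWinding κ f w') : w = w' := by
  obtain ⟨φ, h1, h2, h3⟩ := h
  obtain ⟨φ', h1', h2', h3'⟩ := h'
  obtain ⟨n, hn⟩ := exists_int_of_continuous_of_exp_eq_one (h1.sub h1') fun z => by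
    rw [Pi.sub_apply, Complex.exp_sub, ← h2, ← h2', div_self]
    rw [h2]; exact Complex.exp_ne_zero _
  have e1 := hn 0
  have e2 := hn (0 + κ)
  simp only [Pi.sub_apply] at e1 e2
  rw [h3, h3'] at e2
  have : ((w : ℂ) - w') * (2 * Real.pi * Complex.I) = 0 := by linear_combination e2 - e1
  have h0 : (w : ℂ) - w' = 0 := by
    simpa [Real.pi_ne_zero] using this
  exact_mod_cast sub_eq_zero.1 h0

theorem mul (h : HasWinding κ f w) (h' : HasWinding κ g w') :
    HasWinding κ (fun z => f z * g z) (w + w') := by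
  obtain ⟨φ, h1, h2, h3⟩ := h
  obtain ⟨φ', h1', h2', h3'⟩ := h'
  refine ⟨fun z => φ z + φ' z, by fun_prop, fun z => ?_, fun z => ?_⟩
  · dsimp only; rw [h2, h2', Complex.exp_add]
  dsimp only
  rw [h3, h3']; push_cast; ring

theorem comp_sub (h : HasWinding κ f w) (a : ℝ × ℝ) : HasWinding κ (fun z => f (z - a)) w := by
  obtain ⟨φ, h1, h2, h3⟩ := h
  refine ⟨fun z => φ (z - a), by fun_prop, fun z => h2 _, fun z => ?_⟩
  dsimp only
  rw [show z + κ - a = z - a + κ by abel, h3]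

theorem const {c : ℂ} (hc : c ≠ 0) : HasWinding κ (fun _ => c) 0 :=
  ⟨fun _ => Complex.log c, continuous_const, fun _ => (Complex.exp_log hc).symm, by simp⟩

theorem of_re_pos (hg : Continuous g) (hper : ∀ z, g (z + κ) = g z) (hre : ∀ z, 0 < (g z).re) :
    HasWinding κ g 0 := by
  refine ⟨fun z => Complex.log (g z), ?_, fun z => ?_, fun z => by simp [hper z]⟩
  · exact hg.clog fun z => Or.inl (hre z)
  · rw [Complex.exp_log]
    intro h0
    have := hre z
    simp [h0] at this

/-- Rouché-type stability of the winding number. -/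
theorem of_close (h : HasWinding κ f w) (hg : Continuous g) (hper : ∀ z, g (z + κ) = g z)
    (hfg : ∀ z, ‖g z - f z‖ < ‖f z‖) : HasWinding κ g w := by
  have h1 : HasWinding κ (fun z => g z / f z) 0 := by
    refine of_re_pos (hg.div h.continuous h.ne_zero) (fun z => by rw [hper, h.periodic]) fun z => ?_
    have h2 : ‖g z / f z - 1‖ < 1 := by
      rw [div_sub_one (h.ne_zero z), norm_div, div_lt_one (norm_pos_iff.2 (h.ne_zero z))]
      exact hfg z
    have h3 := (abs_le.1 (Complex.abs_re_le_norm (g z / f z - 1))).1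
    simp only [Complex.sub_re, Complex.one_re] at h3
    linarith
  have h2 := h.mul h1
  rw [add_zero] at h2
  convert h2 using 1
  funext z
  rw [mul_div_cancel₀ _ (h.ne_zero z)]

theorem of_cis {l : ℝ × ℝ → ℝ} (hl : Continuous l) (hl' : ∀ z, l (z + κ) = l z + w) :
    HasWinding κ (fun z => cis (l z)) w := by
  refine ⟨fun z => 2 * Real.pi * Complex.I * l z, by fun_prop, fun z => rfl, fun z => ?_⟩
  dsimp only
  rw [hl']; push_cast; ring

/-- A nonvanishing continuous periodic function has a winding number. -/
theorem exists_of_continuous (hf : Continuous f) (h0 : ∀ z, f z ≠ 0)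
    (hper : ∀ z, f (z + κ) = f z) : ∃ w, HasWinding κ f w := by
  have hs : IsSimplyConnected (univ : Set (ℝ × ℝ)) := by
    have := (convex_univ (𝕜 := ℝ) (E := ℝ × ℝ)).contractibleSpace univ_nonempty
    exact SimplyConnectedSpace.ofContractible _
  obtain ⟨φ, h1, h2⟩ := Complex.exists_continuousOn_eqOn_exp_comp hs isOpen_univ hf.continuousOn
    (by rintro ⟨z, -, hz⟩; exact h0 z hz)
  rw [continuousOn_univ] at h1
  have h3 : ∀ z, Complex.exp (φ z) = f z := fun z => h2 (mem_univ z)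
  obtain ⟨w, hw⟩ := exists_int_of_continuous_of_exp_eq_one
    (ψ := fun z => φ (z + κ) - φ z) (by fun_prop) fun z => by
      rw [Complex.exp_sub, h3, h3, hper, div_self (h0 z)]
  exact ⟨w, φ, h1, fun z => (h3 z).symm, fun z => by rw [← hw z]; ring⟩

/-- If `exp ψ` stays within distance `1` of `1`, then the argument `Im ψ` cannot reach `±π`. -/
theorem abs_im_lt_pi_of_close {ψ : ℝ → ℂ} (hψ : Continuous ψ) (h0 : ψ 0 = 0)
    (h : ∀ t ∈ Icc (0 : ℝ) 1, ‖Complex.exp (ψ t) - 1‖ < 1) : |(ψ 1).im| < Real.pi := by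
  by_contra! hcon
  have hc : ContinuousOn (fun t => |(ψ t).im|) (Icc 0 1) := by fun_prop
  obtain ⟨t, ht, ht'⟩ := intermediate_value_Icc zero_le_one hc
    (show Real.pi ∈ Icc |(ψ 0).im| |(ψ 1).im| from ⟨by simpa [h0] using Real.pi_pos.le, hcon⟩)
  have h1 : (Complex.exp (ψ t)).re < 0 := by
    rw [Complex.exp_re, ← Real.cos_abs]
    dsimp only at ht'
    rw [ht', Real.cos_pi]
    have := Real.exp_pos (ψ t).re
    linarith
  have h2 := h t ht
  have h3 := (abs_le.1 (Complex.abs_re_le_norm (Complex.exp (ψ t) - 1))).1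
  simp only [Complex.sub_re, Complex.one_re] at h3
  linarith

/-- The winding number of a Lipschitz function bounded away from zero is bounded. Along each of the
`N` steps `κ / N` the function changes by less than its modulus, hence its argument by less
than `π`. -/
theorem abs_le_of_lipschitz (h : HasWinding κ f w) {δ L : ℝ} (hδ : 0 < δ) (hL : 0 ≤ L)
    (h1 : ∀ z, δ ≤ ‖f z‖) (h2 : ∀ z z', ‖f z - f z'‖ ≤ L * ‖z - z'‖) {N : ℕ}
    (hN : L * ‖κ‖ < N * δ) : |(w : ℝ)| ≤ N := by
  obtain ⟨φ, hφ, hf, hper⟩ := h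
  have hN0 : 0 < (N : ℝ) := by
    by_contra! h0
    have : (N : ℝ) = 0 := le_antisymm h0 (Nat.cast_nonneg _)
    rw [this, zero_mul] at hN
    exact absurd hN (not_lt.2 (by positivity))
  have hstep : ∀ z, |(φ (z + (1 / N : ℝ) • κ) - φ z).im| < Real.pi := by
    intro z
    have := abs_im_lt_pi_of_close (ψ := fun t => φ (z + (t / N : ℝ) • κ) - φ z) (by fun_prop)
      (by simp) (fun t ht => ?_)
    · exact this
    · rw [Complex.exp_sub, ← hf, ← hf, div_sub_one (norm_pos_iff.1 (hδ.trans_le (h1 z))), norm_div,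
        div_lt_one (hδ.trans_le (h1 z))]
      refine lt_of_le_of_lt (h2 _ _) (lt_of_lt_of_le ?_ (h1 z))
      rw [add_sub_cancel_left, norm_smul, Real.norm_of_nonneg (div_nonneg ht.1 hN0.le)]
      have h3 : t / N * (L * ‖κ‖) ≤ 1 / N * (L * ‖κ‖) := by
        gcongr; exact ht.2
      calc L * (t / N * ‖κ‖) = t / N * (L * ‖κ‖) := by ring
        _ ≤ 1 / N * (L * ‖κ‖) := h3
        _ < 1 / N * (N * δ) := by gcongr
        _ = δ := by field_simp
  have hsum : ∀ i : ℕ, |(φ ((i / N : ℝ) • κ) - φ 0).im| ≤ i * Real.pi := by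
    intro i
    induction i with
    | zero => simp
    | succ i ih =>
      have h3 := hstep ((i / N : ℝ) • κ)
      rw [← add_smul, ← add_div] at h3
      push_cast
      calc |(φ (((i + 1 : ℝ) / N) • κ) - φ 0).im|
          = |(φ (((i + 1 : ℝ) / N) • κ) - φ ((i / N : ℝ) • κ)).im +
              (φ ((i / N : ℝ) • κ) - φ 0).im| := by
            congr 1; simp
        _ ≤ Real.pi + i * Real.pi := (abs_add_le _ _).trans (add_le_add h3.le ih)
        _ = (i + 1) * Real.pi := by ring
  have h4 := hsum N
  rw [div_self hN0.ne', one_smul] at h4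
  have h5 := hper 0
  rw [zero_add] at h5
  rw [h5] at h4
  have h6 : (φ 0 + w * (2 * Real.pi * Complex.I) - φ 0).im = w * (2 * Real.pi) := by simp
  rw [h6, abs_mul, abs_of_pos Real.two_pi_pos] at h4
  have := Real.pi_pos
  have h7 : 0 ≤ |(w : ℝ)| := abs_nonneg _
  nlinarith

end HasWinding

/-! ### Mean oscillation of bounded functions -/

/-- The mean oscillation of `f` with respect to a probability measure. -/
noncomputable def oscOf {X : Type*} [MeasurableSpace X] (P : Measure X) (f : X → ℂ) : ℝ :=
  ∫ x, ‖f x - ∫ y, f y ∂P‖ ∂P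

theorem oscOf_conj {X : Type*} [MeasurableSpace X] {P : Measure X} (f : X → ℂ) :
    oscOf P (fun x => (starRingEnd ℂ) (f x)) = oscOf P f := by
  rw [oscOf, oscOf, integral_conj]
  simp only [← map_sub, RCLike.norm_conj]

section ProbabilityMeasure

variable {X : Type*} [MeasurableSpace X] {P : Measure X} [IsProbabilityMeasure P]
  {f g : X → ℂ} {A B : ℝ}

theorem integrable_of_bdd (hf : Measurable f) (hA : ∀ x, ‖f x‖ ≤ A) : Integrable f P :=
  Integrable.of_bound hf.aestronglyMeasurable A (Eventually.of_forall hA)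

theorem norm_integral_le_of_bdd (hA : ∀ x, ‖f x‖ ≤ A) : ‖∫ x, f x ∂P‖ ≤ A := by
  simpa using norm_integral_le_of_norm_le_const (μ := P) (Eventually.of_forall hA)

/-- The mean oscillation is controlled by the mean distance to any constant. -/
theorem oscOf_le_two_mul (hf : Integrable f P) (c : ℂ) :
    oscOf P f ≤ 2 * ∫ x, ‖f x - c‖ ∂P := by
  have hc : Integrable (fun x => f x - c) P := hf.sub (integrable_const c)
  have h1 : ‖c - ∫ y, f y ∂P‖ ≤ ∫ x, ‖f x - c‖ ∂P := by
    rw [norm_sub_rev, show (∫ y, f y ∂P) - c = ∫ x, (f x - c) ∂P by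
      rw [integral_sub hf (integrable_const c)]; simp]
    exact norm_integral_le_integral_norm _
  calc oscOf P f ≤ ∫ x, (‖f x - c‖ + ‖c - ∫ y, f y ∂P‖) ∂P := by
        refine integral_mono (hf.sub (integrable_const _)).norm
          (hc.norm.add (integrable_const _)) fun x => ?_
        simpa using norm_add_le (f x - c) (c - ∫ y, f y ∂P)
    _ = ∫ x, ‖f x - c‖ ∂P + ‖c - ∫ y, f y ∂P‖ := by
        rw [integral_add hc.norm (integrable_const _)]; simp
    _ ≤ _ := by linarith

theorem oscOf_add_le (hf : Integrable f P) (hg : Integrable g P) :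
    oscOf P (fun x => f x + g x) ≤ oscOf P f + oscOf P g := by
  have h1 : Integrable (fun x => ‖f x - ∫ y, f y ∂P‖) P := (hf.sub (integrable_const _)).norm
  have h2 : Integrable (fun x => ‖g x - ∫ y, g y ∂P‖) P := (hg.sub (integrable_const _)).norm
  rw [oscOf, oscOf, oscOf, ← integral_add h1 h2]
  refine integral_mono (((hf.add hg).sub (integrable_const _)).norm) (h1.add h2) fun x => ?_
  dsimp only
  rw [integral_add hf hg, add_sub_add_comm]
  exact norm_add_le _ _

/-- The mean is multiplicative up to the mean oscillation. -/
theorem norm_integral_mul_sub_le (hf : Measurable f) (hg : Measurable g) (hA : ∀ x, ‖f x‖ ≤ A)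
    (hB : ∀ x, ‖g x‖ ≤ B) :
    ‖∫ x, f x * g x ∂P - (∫ x, f x ∂P) * ∫ x, g x ∂P‖ ≤ A * oscOf P g := by
  have hfi : Integrable f P := integrable_of_bdd hf hA
  have hgi : Integrable g P := integrable_of_bdd hg hB
  have h1 : ∫ x, f x * g x ∂P - (∫ x, f x ∂P) * ∫ x, g x ∂P =
      ∫ x, f x * (g x - ∫ y, g y ∂P) ∂P := by
    simp only [mul_sub]
    rw [integral_sub (hgi.bdd_mul hf.aestronglyMeasurable (Eventually.of_forall hA))
      (hfi.mul_const _), integral_mul_const]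
  rw [h1, oscOf, ← integral_const_mul]
  refine norm_integral_le_of_norm_le ((hgi.sub (integrable_const _)).norm.const_mul _)
    (Eventually.of_forall fun x => ?_)
  rw [norm_mul]
  exact mul_le_mul_of_nonneg_right (hA x) (norm_nonneg _)

theorem oscOf_mul_le (hf : Measurable f) (hg : Measurable g) (hA : ∀ x, ‖f x‖ ≤ A)
    (hB : ∀ x, ‖g x‖ ≤ B) :
    oscOf P (fun x => f x * g x) ≤ 2 * (A * oscOf P g + B * oscOf P f) := by
  have hfi : Integrable f P := integrable_of_bdd hf hA
  have hgi : Integrable g P := integrable_of_bdd hg hB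
  have hfg : Integrable (fun x => f x * g x) P :=
    hgi.bdd_mul hf.aestronglyMeasurable (Eventually.of_forall hA)
  have h1 : Integrable (fun x => ‖f x - ∫ y, f y ∂P‖) P := (hfi.sub (integrable_const _)).norm
  have h2 : Integrable (fun x => ‖g x - ∫ y, g y ∂P‖) P := (hgi.sub (integrable_const _)).norm
  refine (oscOf_le_two_mul hfg ((∫ y, f y ∂P) * ∫ y, g y ∂P)).trans
    (mul_le_mul_of_nonneg_left ?_ zero_le_two)
  rw [oscOf, oscOf, ← integral_const_mul A, ← integral_const_mul B,
    ← integral_add (h2.const_mul _) (h1.const_mul _)]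
  refine integral_mono (hfg.sub (integrable_const _)).norm
    ((h2.const_mul _).add (h1.const_mul _)) fun x => ?_
  dsimp only
  rw [show f x * g x - (∫ y, f y ∂P) * ∫ y, g y ∂P =
    f x * (g x - ∫ y, g y ∂P) + (∫ y, g y ∂P) * (f x - ∫ y, f y ∂P) by ring]
  refine (norm_add_le _ _).trans ?_
  rw [norm_mul, norm_mul]
  exact add_le_add (mul_le_mul_of_nonneg_right (hA x) (norm_nonneg _))
    (mul_le_mul_of_nonneg_right (norm_integral_le_of_bdd hB) (norm_nonneg _))

/-- A function that is bounded below and oscillates little has a mean that is bounded below. -/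
theorem le_norm_integral_add_oscOf (hf : Integrable f P) {δ : ℝ} (hδ : ∀ᵐ x ∂P, δ ≤ ‖f x‖) :
    δ ≤ ‖∫ x, f x ∂P‖ + oscOf P f := by
  have h1 : Integrable (fun x => ‖f x - ∫ y, f y ∂P‖) P := (hf.sub (integrable_const _)).norm
  have h2 : ∫ _x, δ ∂P ≤ ∫ x, (‖∫ y, f y ∂P‖ + ‖f x - ∫ y, f y ∂P‖) ∂P := by
    refine integral_mono_ae (integrable_const _) ((integrable_const _).add h1) ?_
    filter_upwards [hδ] with x hx
    refine hx.trans ?_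
    simpa using norm_add_le (∫ y, f y ∂P) (f x - ∫ y, f y ∂P)
  rw [integral_add (integrable_const _) h1] at h2
  simpa [oscOf] using h2

end ProbabilityMeasure

/-! ### Averages over small squares -/

/-- The closed square of side length `ε` with lower left corner `ξ`. -/
def squareAt (ξ : ℝ × ℝ) (ε : ℝ) : Set (ℝ × ℝ) := Icc ξ.1 (ξ.1 + ε) ×ˢ Icc ξ.2 (ξ.2 + ε)

theorem measurableSet_squareAt (ξ : ℝ × ℝ) (ε : ℝ) : MeasurableSet (squareAt ξ ε) :=
  measurableSet_Icc.prod measurableSet_Icc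

theorem volume_squareAt (ξ : ℝ × ℝ) {ε : ℝ} (hε : 0 ≤ ε) :
    volume (squareAt ξ ε) = ENNReal.ofReal (ε ^ 2) := by
  rw [squareAt, Measure.volume_eq_prod, Measure.prod_prod, Real.volume_Icc, Real.volume_Icc,
    ← ENNReal.ofReal_mul (by linarith)]
  congr 1; ring

theorem volume_real_squareAt (ξ : ℝ × ℝ) {ε : ℝ} (hε : 0 ≤ ε) :
    volume.real (squareAt ξ ε) = ε ^ 2 := by
  rw [Measure.real, volume_squareAt ξ hε, ENNReal.toReal_ofReal (by positivity)]

/-- The uniform probability measure on a square. -/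
noncomputable def unifSq (ξ : ℝ × ℝ) (ε : ℝ) : Measure (ℝ × ℝ) :=
  (volume.restrict (squareAt ξ ε) univ)⁻¹ • volume.restrict (squareAt ξ ε)

theorem isProbabilityMeasure_unifSq (ξ : ℝ × ℝ) {ε : ℝ} (hε : 0 < ε) :
    IsProbabilityMeasure (unifSq ξ ε) := by
  have h0 : volume (squareAt ξ ε) ≠ 0 := by
    rw [volume_squareAt ξ hε.le]; simpa using by positivity
  have h1 : volume (squareAt ξ ε) ≠ ∞ := by
    rw [volume_squareAt ξ hε.le]; exact ENNReal.ofReal_ne_top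
  refine ⟨?_⟩
  rw [unifSq, Measure.smul_apply, smul_eq_mul, Measure.restrict_apply_univ,
    ENNReal.inv_mul_cancel h0 h1]

theorem ae_unifSq {p : ℝ × ℝ → Prop} (h : ∀ᵐ z, p z) (ξ : ℝ × ℝ) (ε : ℝ) :
    ∀ᵐ z ∂(unifSq ξ ε), p z :=
  Measure.ae_smul_measure (ae_restrict_of_ae h) _

theorem ae_unifSq_norm_sub_le (ξ : ℝ × ℝ) (ε : ℝ) : ∀ᵐ z ∂(unifSq ξ ε), ‖z - ξ‖ ≤ ε := by
  refine Measure.ae_smul_measure ?_ _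
  filter_upwards [ae_restrict_mem (measurableSet_squareAt ξ ε)] with z hz
  simp only [squareAt, mem_prod, mem_Icc] at hz
  rw [Prod.norm_def, max_le_iff, Prod.fst_sub, Prod.snd_sub, Real.norm_eq_abs, Real.norm_eq_abs,
    abs_of_nonneg (by linarith), abs_of_nonneg (by linarith)]
  constructor <;> linarith

theorem meanOsc_squareAt (f : ℝ × ℝ → ℂ) (ξ : ℝ × ℝ) (ε : ℝ) :
    meanOsc f (squareAt ξ ε) = oscOf (unifSq ξ ε) f := rfl

/-- The average of `f` over the square of side length `ε` with lower left corner `ξ`. -/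
noncomputable def avg (ε : ℝ) (f : ℝ × ℝ → ℂ) (ξ : ℝ × ℝ) : ℂ := ∫ z, f z ∂(unifSq ξ ε)

theorem unifSq_map_sub (ξ a : ℝ × ℝ) (ε : ℝ) :
    (unifSq ξ ε).map (fun z => z - a) = unifSq (ξ - a) ε := by
  have hpre : (fun z => z - a) ⁻¹' (squareAt (ξ - a) ε) = squareAt ξ ε := by
    ext z
    simp only [squareAt, mem_preimage, mem_prod, mem_Icc, Prod.fst_sub, Prod.snd_sub]
    constructor <;> rintro ⟨⟨h1, h2⟩, h3, h4⟩ <;> refine ⟨⟨?_, ?_⟩, ?_, ?_⟩ <;> linarith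
  have hmp := (measurePreserving_sub_right (volume : Measure (ℝ × ℝ)) a).restrict_preimage
    (measurableSet_squareAt (ξ - a) ε)
  rw [hpre] at hmp
  rw [unifSq, unifSq, Measure.map_smul, hmp.map_eq]
  congr 2
  rw [← hmp.map_eq, Measure.map_apply (by fun_prop) MeasurableSet.univ, preimage_univ]

theorem integral_unifSq_comp_sub {E : Type*} [NormedAddCommGroup E] [NormedSpace ℝ E]
    (f : ℝ × ℝ → E) (ξ a : ℝ × ℝ) (ε : ℝ) :
    ∫ z, f (z - a) ∂(unifSq ξ ε) = ∫ z, f z ∂(unifSq (ξ - a) ε) := by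
  rw [← unifSq_map_sub]
  exact ((Homeomorph.subRight a).measurableEmbedding.integral_map f).symm

theorem avg_comp_sub (f : ℝ × ℝ → ℂ) (a ξ : ℝ × ℝ) (ε : ℝ) :
    avg ε (fun z => f (z - a)) ξ = avg ε f (ξ - a) := integral_unifSq_comp_sub f ξ a ε

theorem oscOf_unifSq_comp_sub (f : ℝ × ℝ → ℂ) (a ξ : ℝ × ℝ) (ε : ℝ) :
    oscOf (unifSq ξ ε) (fun z => f (z - a)) = oscOf (unifSq (ξ - a) ε) f := by
  rw [oscOf, integral_unifSq_comp_sub f, integral_unifSq_comp_sub (fun z => ‖f z - _‖)]; rfl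

theorem avg_periodic {f : ℝ × ℝ → ℂ} {κ : ℝ × ℝ} (h : ∀ z, f (z + κ) = f z) (ε : ℝ)
    (ξ : ℝ × ℝ) : avg ε f (ξ + κ) = avg ε f ξ := by
  have := avg_comp_sub f κ (ξ + κ) ε
  rw [add_sub_cancel_right] at this
  rw [← this]
  congr 1
  funext z
  rw [← h (z - κ), sub_add_cancel]

theorem oscOf_periodic {f : ℝ × ℝ → ℂ} {κ : ℝ × ℝ} (h : ∀ z, f (z + κ) = f z) (ε : ℝ)
    (ξ : ℝ × ℝ) : oscOf (unifSq (ξ + κ) ε) f = oscOf (unifSq ξ ε) f := by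
  have := oscOf_unifSq_comp_sub f κ (ξ + κ) ε
  rw [add_sub_cancel_right] at this
  rw [← this]
  congr 1
  funext z
  rw [← h (z - κ), sub_add_cancel]

theorem avg_eq (f : ℝ × ℝ → ℂ) (ξ : ℝ × ℝ) {ε : ℝ} (hε : 0 < ε) :
    avg ε f ξ = ((ε ^ 2)⁻¹ : ℝ) • ∫ z in squareAt ξ ε, f z := by
  rw [← volume_real_squareAt ξ hε.le]
  exact setAverage_eq _ _ _

/-- Averages of a bounded function over squares of a fixed size are Lipschitz in the position. -/
theorem norm_avg_sub_avg_le {f : ℝ × ℝ → ℂ} {A : ℝ} (hf : Measurable f) (hA : ∀ z, ‖f z‖ ≤ A)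
    {ε : ℝ} (hε : 0 < ε) (ξ ξ' : ℝ × ℝ) :
    ‖avg ε f ξ - avg ε f ξ'‖ ≤ 4 * A / ε * ‖ξ - ξ'‖ := by
  have hA0 : 0 ≤ A := (norm_nonneg _).trans (hA 0)
  have hbd : ∀ ζ, ‖avg ε f ζ‖ ≤ A := fun ζ => by
    have := isProbabilityMeasure_unifSq ζ hε
    exact norm_integral_le_of_bdd hA
  set d := ‖ξ - ξ'‖ with hd
  rcases lt_or_ge ε d with hlt | hle
  · have h1 : 2 * A ≤ 4 * A / ε * d := by
      rw [div_mul_eq_mul_div, le_div_iff₀ hε]; nlinarith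
    calc _ ≤ A + A := (norm_sub_le _ _).trans (add_le_add (hbd _) (hbd _))
      _ ≤ _ := by linarith
  have hd1 : |ξ.1 - ξ'.1| ≤ d := norm_fst_le (ξ - ξ')
  have hd2 : |ξ.2 - ξ'.2| ≤ d := norm_snd_le (ξ - ξ')
  have hfi : ∀ ζ, IntegrableOn f (squareAt ζ ε) := fun ζ =>
    Measure.integrableOn_of_bounded (by rw [volume_squareAt ζ hε.le]; exact ENNReal.ofReal_ne_top)
      hf.aestronglyMeasurable (Eventually.of_forall hA)
  -- both squares contain a common square of side length `ε - d`
  have hsub : ∀ ζ, (ζ = ξ ∨ ζ = ξ') →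
      squareAt (max ξ.1 ξ'.1, max ξ.2 ξ'.2) (ε - d) ⊆ squareAt ζ ε := by
    rintro ζ hζ z ⟨⟨h1, h2⟩, h3, h4⟩
    rw [abs_le] at hd1 hd2
    dsimp only at h1 h2 h3 h4
    rcases hζ with h | h <;> rw [h] <;> refine ⟨⟨?_, ?_⟩, ?_, ?_⟩ <;>
    rcases max_cases ξ.1 ξ'.1 with ⟨e1, _⟩ | ⟨e1, _⟩ <;>
    rcases max_cases ξ.2 ξ'.2 with ⟨e2, _⟩ | ⟨e2, _⟩ <;>
    rw [e1] at h1 h2 <;> rw [e2] at h3 h4 <;> linarith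
  have hdiff : ∀ ζ, (ζ = ξ ∨ ζ = ξ') →
      ‖(∫ z in squareAt ζ ε, f z) - ∫ z in squareAt (max ξ.1 ξ'.1, max ξ.2 ξ'.2) (ε - d), f z‖ ≤
        A * (2 * ε * d) := by
    intro ζ hζ
    rw [← setIntegral_sdiff (measurableSet_squareAt _ _) (hfi ζ) (hsub ζ hζ)]
    refine (norm_setIntegral_le_of_norm_le_const (C := A) ?_ fun z _ => hA z).trans ?_
    · refine (measure_mono sdiff_subset).trans_lt ?_
      rw [volume_squareAt ζ hε.le]; exact ENNReal.ofReal_lt_top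
    · refine mul_le_mul_of_nonneg_left ?_ hA0
      rw [measureReal_sdiff (hsub ζ hζ) (measurableSet_squareAt _ _)
        (by rw [volume_squareAt ζ hε.le]; exact ENNReal.ofReal_ne_top),
        volume_real_squareAt _ hε.le, volume_real_squareAt _ (by linarith)]
      nlinarith [norm_nonneg (ξ - ξ')]
  rw [avg_eq f ξ hε, avg_eq f ξ' hε, ← smul_sub, norm_smul, Real.norm_of_nonneg (by positivity)]
  have h3 := norm_sub_le_norm_sub_add_norm_sub (∫ z in squareAt ξ ε, f z)
    (∫ z in squareAt (max ξ.1 ξ'.1, max ξ.2 ξ'.2) (ε - d), f z) (∫ z in squareAt ξ' ε, f z)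
  rw [norm_sub_rev _ (∫ z in squareAt ξ' ε, f z),
    norm_sub_rev _ (∫ z in squareAt ξ' ε, f z)] at h3
  calc (ε ^ 2)⁻¹ * _ ≤ (ε ^ 2)⁻¹ * (A * (2 * ε * d) + A * (2 * ε * d)) := by
        refine mul_le_mul_of_nonneg_left ?_ (by positivity)
        exact (norm_sub_rev _ _).trans_le <|
          h3.trans (add_le_add (hdiff ξ (Or.inl rfl)) (hdiff ξ' (Or.inr rfl)))
    _ = 4 * A / ε * d := by field_simp; ring

theorem continuous_avg {f : ℝ × ℝ → ℂ} {A : ℝ} (hf : Measurable f) (hA : ∀ z, ‖f z‖ ≤ A)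
    {ε : ℝ} (hε : 0 < ε) : Continuous (avg ε f) := by
  have hA0 : 0 ≤ A := (norm_nonneg _).trans (hA 0)
  refine (LipschitzWith.of_dist_le_mul (K := ⟨4 * A / ε, by positivity⟩) fun z z' => ?_).continuous
  rw [dist_eq_norm, dist_eq_norm]
  exact norm_avg_sub_avg_le hf hA hε z z'

/-! ### Families with uniformly vanishing mean oscillation -/

/-- A family of functions that are uniformly bounded and whose mean oscillation over small squares
tends to zero uniformly over the family, locally uniformly in the position of the square. -/
structure UnifVMO {ι : Type*} (f : ι → ℝ × ℝ → ℂ) : Prop where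
  meas : ∀ i, Measurable (f i)
  bdd : ∃ A, ∀ i z, ‖f i z‖ ≤ A
  vmo : ∀ ρ η : ℝ, 0 < η → ∃ ε₀ > 0, ∀ i ξ, ‖ξ‖ ≤ ρ → ∀ ε, 0 < ε → ε < ε₀ →
    oscOf (unifSq ξ ε) (f i) ≤ η

namespace UnifVMO

variable {ι : Type*} {f g : ι → ℝ × ℝ → ℂ}

theorem add (hf : UnifVMO f) (hg : UnifVMO g) : UnifVMO fun i z => f i z + g i z := by
  obtain ⟨A, hA⟩ := hf.bdd
  obtain ⟨B, hB⟩ := hg.bdd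
  refine ⟨fun i => (hf.meas i).add (hg.meas i), ⟨A + B, fun i z =>
    (norm_add_le _ _).trans (add_le_add (hA i z) (hB i z))⟩, fun ρ η hη => ?_⟩
  obtain ⟨ε₁, h1, h1'⟩ := hf.vmo ρ (η / 2) (by positivity)
  obtain ⟨ε₂, h2, h2'⟩ := hg.vmo ρ (η / 2) (by positivity)
  refine ⟨min ε₁ ε₂, lt_min h1 h2, fun i ξ hξ ε hε hε' => ?_⟩
  have := isProbabilityMeasure_unifSq ξ hε
  have h3 := oscOf_add_le (P := unifSq ξ ε) (integrable_of_bdd (hf.meas i) (hA i))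
    (integrable_of_bdd (hg.meas i) (hB i))
  have h4 := h1' i ξ hξ ε hε (hε'.trans_le (min_le_left _ _))
  have h5 := h2' i ξ hξ ε hε (hε'.trans_le (min_le_right _ _))
  linarith

theorem mul (hf : UnifVMO f) (hg : UnifVMO g) : UnifVMO fun i z => f i z * g i z := by
  obtain ⟨A, hA⟩ := hf.bdd
  obtain ⟨B, hB⟩ := hg.bdd
  refine ⟨fun i => (hf.meas i).mul (hg.meas i), ⟨|A| * |B|, fun i z => ?_⟩, fun ρ η hη => ?_⟩
  · rw [norm_mul]
    exact mul_le_mul ((hA i z).trans (le_abs_self A)) ((hB i z).trans (le_abs_self B))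
      (norm_nonneg _) (abs_nonneg _)
  have hC : 0 < |A| + |B| + 1 := by positivity
  obtain ⟨ε₁, h1, h1'⟩ := hf.vmo ρ (η / (2 * (|A| + |B| + 1))) (by positivity)
  obtain ⟨ε₂, h2, h2'⟩ := hg.vmo ρ (η / (2 * (|A| + |B| + 1))) (by positivity)
  refine ⟨min ε₁ ε₂, lt_min h1 h2, fun i ξ hξ ε hε hε' => ?_⟩
  have := isProbabilityMeasure_unifSq ξ hε
  have h3 := oscOf_mul_le (P := unifSq ξ ε) (hf.meas i) (hg.meas i)
    (fun z => (hA i z).trans (le_abs_self A)) (fun z => (hB i z).trans (le_abs_self B))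
  have h4 := h1' i ξ hξ ε hε (hε'.trans_le (min_le_left _ _))
  have h5 := h2' i ξ hξ ε hε (hε'.trans_le (min_le_right _ _))
  refine h3.trans ?_
  calc 2 * (|A| * oscOf (unifSq ξ ε) (g i) + |B| * oscOf (unifSq ξ ε) (f i))
      ≤ 2 * (|A| * (η / (2 * (|A| + |B| + 1))) + |B| * (η / (2 * (|A| + |B| + 1)))) := by gcongr
    _ = η * ((|A| + |B|) / (|A| + |B| + 1)) := by field_simp
    _ ≤ η * 1 := by
      gcongr
      rw [div_le_one hC]; linarith
    _ = η := mul_one η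

theorem conj (hf : UnifVMO f) : UnifVMO fun i z => (starRingEnd ℂ) (f i z) := by
  obtain ⟨A, hA⟩ := hf.bdd
  refine ⟨fun i => Complex.continuous_conj.measurable.comp (hf.meas i),
    ⟨A, fun i z => by simpa using hA i z⟩, fun ρ η hη => ?_⟩
  obtain ⟨ε₀, h1, h2⟩ := hf.vmo ρ η hη
  exact ⟨ε₀, h1, fun i ξ hξ ε hε hε' => (oscOf_conj _).trans_le (h2 i ξ hξ ε hε hε')⟩

/-- Equi-Lipschitz bounded families have uniformly vanishing mean oscillation. -/
theorem of_lipschitz {A L : ℝ} (hA : ∀ i z, ‖f i z‖ ≤ A)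
    (hL : ∀ i z z', ‖f i z - f i z'‖ ≤ L * ‖z - z'‖) : UnifVMO f := by
  have hL' : ∀ i z z', ‖f i z - f i z'‖ ≤ |L| * ‖z - z'‖ := fun i z z' =>
    (hL i z z').trans (mul_le_mul_of_nonneg_right (le_abs_self L) (norm_nonneg _))
  have hm : ∀ i, Measurable (f i) := fun i =>
    (LipschitzWith.of_dist_le_mul (K := ⟨|L|, abs_nonneg L⟩) fun z z' => by
      rw [dist_eq_norm, dist_eq_norm]; exact hL' i z z').continuous.measurable
  refine ⟨hm, ⟨A, hA⟩, fun ρ η hη => ⟨η / (2 * (|L| + 1)), by positivity, ?_⟩⟩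
  intro i ξ _ ε hε hε'
  have := isProbabilityMeasure_unifSq ξ hε
  have hfi : Integrable (f i) (unifSq ξ ε) := integrable_of_bdd (hm i) (hA i)
  refine (oscOf_le_two_mul hfi (f i ξ)).trans ?_
  have h1 : ∫ z, ‖f i z - f i ξ‖ ∂(unifSq ξ ε) ≤ ∫ _z, |L| * ε ∂(unifSq ξ ε) := by
    refine integral_mono_ae (hfi.sub (integrable_const _)).norm (integrable_const _) ?_
    filter_upwards [ae_unifSq_norm_sub_le ξ ε] with z hz
    exact (hL' i z ξ).trans (mul_le_mul_of_nonneg_left hz (abs_nonneg _))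
  simp only [integral_const, probReal_univ, one_smul] at h1
  calc 2 * ∫ z, ‖f i z - f i ξ‖ ∂(unifSq ξ ε) ≤ 2 * ((|L| + 1) * ε) := by
        nlinarith [abs_nonneg L]
    _ ≤ 2 * ((|L| + 1) * (η / (2 * (|L| + 1)))) := by gcongr
    _ = η := by field_simp

theorem const {c : ι → ℂ} {A : ℝ} (hA : ∀ i, ‖c i‖ ≤ A) : UnifVMO fun i (_ : ℝ × ℝ) => c i :=
  of_lipschitz (A := A) (L := 0) (fun i _ => hA i) (by simp)

theorem comp_sub (hf : UnifVMO f) {a : ι → ℝ × ℝ} {r : ℝ} (ha : ∀ i, ‖a i‖ ≤ r) :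
    UnifVMO fun i z => f i (z - a i) := by
  obtain ⟨A, hA⟩ := hf.bdd
  refine ⟨fun i => (hf.meas i).comp (by fun_prop), ⟨A, fun i z => hA i _⟩, fun ρ η hη => ?_⟩
  obtain ⟨ε₁, h1, h1'⟩ := hf.vmo (ρ + r) η hη
  refine ⟨ε₁, h1, fun i ξ hξ ε hε hε' => ?_⟩
  rw [oscOf_unifSq_comp_sub]
  exact h1' i _ ((norm_sub_le _ _).trans (add_le_add hξ (ha i))) ε hε hε'

theorem comp_index {κ : Type*} (hf : UnifVMO f) (j : κ → ι) : UnifVMO fun i => f (j i) := by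
  obtain ⟨A, hA⟩ := hf.bdd
  refine ⟨fun i => hf.meas _, ⟨A, fun i => hA _⟩, fun ρ η hη => ?_⟩
  obtain ⟨ε₁, h1, h1'⟩ := hf.vmo ρ η hη
  exact ⟨ε₁, h1, fun i => h1' _⟩

theorem sum {J : Type*} (s : Finset J) {f : J → ι → ℝ × ℝ → ℂ} (hf : ∀ j ∈ s, UnifVMO (f j)) :
    UnifVMO fun i z => ∑ j ∈ s, f j i z := by
  classical
  induction s using Finset.induction_on with
  | empty => simpa using UnifVMO.const (ι := ι) (c := fun _ => 0) (A := 0) (by simp)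
  | insert a s ha ih =>
    simp only [Finset.sum_insert ha]
    exact (hf a (Finset.mem_insert_self _ _)).add
      (ih fun j hj => hf j (Finset.mem_insert_of_mem hj))

theorem prod {J : Type*} (s : Finset J) {f : J → ι → ℝ × ℝ → ℂ} (hf : ∀ j ∈ s, UnifVMO (f j)) :
    UnifVMO fun i z => ∏ j ∈ s, f j i z := by
  classical
  induction s using Finset.induction_on with
  | empty => simpa using UnifVMO.const (ι := ι) (c := fun _ => 1) (A := 1) (by simp)
  | insert a s ha ih =>
    simp only [Finset.prod_insert ha]
    exact (hf a (Finset.mem_insert_self _ _)).mul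
      (ih fun j hj => hf j (Finset.mem_insert_of_mem hj))

theorem det {n : Type*} [Fintype n] [DecidableEq n] {M : ι → ℝ × ℝ → Matrix n n ℂ}
    (hM : ∀ a b, UnifVMO fun i z => M i z a b) : UnifVMO fun i z => (M i z).det := by
  simp only [Matrix.det_apply']
  exact sum _ fun σ _ => (const (ι := ι) (c := fun _ => ((Equiv.Perm.sign σ : ℤ) : ℂ))
    (A := ‖((Equiv.Perm.sign σ : ℤ) : ℂ)‖) fun _ => le_rfl).mul (prod _ fun a _ => hM _ _)

theorem cis {l : ι → ℝ × ℝ → ℝ} {L : ℝ} (hl : ∀ i z z', |l i z - l i z'| ≤ L * ‖z - z'‖) :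
    UnifVMO fun i z => cis (l i z) := by
  refine of_lipschitz (A := 1) (L := 2 * Real.pi * L) (fun i z => by simp) fun i z z' => ?_
  refine (norm_cis_sub_cis_le _ _).trans ?_
  rw [mul_assoc (2 * Real.pi)]
  exact mul_le_mul_of_nonneg_left (hl i z z') Real.two_pi_pos.le

end UnifVMO

/-- A bounded representative of a function in `VMO_loc`, as a one-element family. -/
theorem unifVMO_of_isVMOLoc {F G : ℝ × ℝ → ℂ} (hF : IsVMOLoc F) (hG : Measurable G) {A : ℝ}
    (hA : ∀ z, ‖G z‖ ≤ A) (hFG : ∀ᵐ z, F z = G z) : UnifVMO fun (_ : Unit) => G := by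
  refine ⟨fun _ => hG, ⟨A, fun _ => hA⟩, fun ρ η hη => ?_⟩
  have hV := (hF (Metric.ball 0 (ρ + 2)) Metric.isOpen_ball Metric.isBounded_ball).2
  have h1 : ∀ᶠ ε in 𝓝[>] (0 : ℝ), smallOsc F (Metric.ball 0 (ρ + 2)) ε < ENNReal.ofReal η :=
    hV (Iio_mem_nhds (by simpa using hη))
  obtain ⟨ε₁, h2, h3⟩ := (h1.and self_mem_nhdsWithin).exists
  replace h3 : 0 < ε₁ := h3
  refine ⟨min 1 ε₁, lt_min one_pos h3, fun _ ξ hξ ε hε hε' => ?_⟩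
  have hε1 : ε < 1 := hε'.trans_le (min_le_left _ _)
  have hsub : squareAt ξ ε ⊆ Metric.ball 0 (ρ + 2) := by
    rintro z ⟨⟨h4, h5⟩, h6, h7⟩
    rw [mem_ball_zero_iff]
    have h8 := norm_fst_le ξ
    have h9 := norm_snd_le ξ
    rw [Real.norm_eq_abs, abs_le] at h8 h9
    rw [Prod.norm_def, Real.norm_eq_abs, Real.norm_eq_abs]
    exact max_lt (abs_lt.2 ⟨by linarith, by linarith⟩) (abs_lt.2 ⟨by linarith, by linarith⟩)
  have hvol : volume (squareAt ξ ε) < ENNReal.ofReal ε₁ := by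
    rw [volume_squareAt ξ hε.le]
    refine (ENNReal.ofReal_lt_ofReal_iff h3).2 ?_
    have : ε < ε₁ := hε'.trans_le (min_le_right _ _)
    nlinarith
  have h4 : ENNReal.ofReal (meanOsc F (squareAt ξ ε)) ≤ smallOsc F (Metric.ball 0 (ρ + 2)) ε₁ :=
    le_iSup₂ (f := fun (Q : Set (ℝ × ℝ)) (_ : IsCube Q ∧ Q ⊆ Metric.ball 0 (ρ + 2) ∧
      volume Q < ENNReal.ofReal ε₁) => ENNReal.ofReal (meanOsc F Q)) (squareAt ξ ε)
      ⟨⟨ξ.1, ξ.2, ε, hε, rfl⟩, hsub, hvol⟩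
  have h5 := (ENNReal.ofReal_lt_ofReal_iff hη).1 (h4.trans_lt h2)
  have h6 : meanOsc F (squareAt ξ ε) = oscOf (unifSq ξ ε) G := by
    rw [meanOsc_squareAt, oscOf, oscOf, integral_congr_ae (ae_unifSq hFG ξ ε)]
    refine integral_congr_ae ?_
    filter_upwards [ae_unifSq hFG ξ ε] with z hz
    rw [hz]
  rw [← h6]
  exact h5.le

/-! ### Lattice data -/

/-- A basis `l₁, l₂` of a rational lattice together with a multiple `K` for which `K Λ ⊆ ℤ²` and the
relevant phases are trivial, and the basis `d₁, d₂` of the lattice symplectically dual to `K Λ`,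
which lies in `R⁻¹ ℤ²`. The conditions `symp_int` and `phase_int` ensure that the shifts by `K l₂`
and `l₁` commute, and that the phases by which the shifts by `m l₁` are made into a cyclic sum close
up at `m = K`. -/
structure LatticeData where
  l₁ : ℝ × ℝ
  l₂ : ℝ × ℝ
  d₁ : ℝ × ℝ
  d₂ : ℝ × ℝ
  K : ℕ
  R : ℕ
  K_pos : 0 < K
  R_pos : 0 < R
  int₁ : IsIntegerPoint ((K : ℝ) • l₁)
  int₂ : IsIntegerPoint ((K : ℝ) • l₂)
  symp_ne : symp l₁ l₂ ≠ 0
  symp_int : ∃ n : ℤ, K * symp l₁ l₂ = n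
  phase_int : ∃ n : ℤ, (K * (K - 1) / 2 : ℝ) * (l₁.1 * l₁.2) = n
  symp₁₁ : K * symp l₁ d₁ = 1
  symp₁₂ : symp l₁ d₂ = 0
  symp₂₁ : symp l₂ d₁ = 0
  symp₂₂ : K * symp l₂ d₂ = 1
  intd₁ : IsIntegerPoint ((R : ℝ) • d₁)
  intd₂ : IsIntegerPoint ((R : ℝ) • d₂)

namespace LatticeData

variable (G : LatticeData)

instance : NeZero G.R := ⟨G.R_pos.ne'⟩

/-- Representatives of the dual lattice modulo `R` times itself. -/
noncomputable def pt (j : ZMod G.R × ZMod G.R) : ℝ × ℝ :=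
  (j.1.val : ℝ) • G.d₁ + (j.2.val : ℝ) • G.d₂

theorem exists_val_add (x : ZMod G.R) (a : ℤ) :
    ∃ l : ℤ, (((x + a : ZMod G.R).val : ℤ)) = x.val + a + G.R * l := by
  have h : (((x + a : ZMod G.R).val : ℤ) : ZMod G.R) = ((x.val + a : ℤ) : ZMod G.R) := by simp
  rw [ZMod.intCast_eq_intCast_iff_dvd_sub] at h
  obtain ⟨l, hl⟩ := h
  exact ⟨-l, by linarith⟩

/-- A sum over the grid points is invariant under translation by the dual lattice. -/
theorem sum_pt_add {M : Type*} [AddCommMonoid M] {H : ℝ × ℝ → M}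
    (hH : ∀ z a, IsIntegerPoint a → H (z + a) = H z) (z : ℝ × ℝ) (a b : ℤ) :
    ∑ j, H (z + ((a : ℝ) • G.d₁ + (b : ℝ) • G.d₂) + G.pt j) = ∑ j, H (z + G.pt j) := by
  refine Fintype.sum_equiv (Equiv.addRight ((a : ZMod G.R), (b : ZMod G.R))) _ _ fun j => ?_
  obtain ⟨k, hk⟩ := G.exists_val_add j.1 a
  obtain ⟨l, hl⟩ := G.exists_val_add j.2 b
  have hk' : ((j.1 + a : ZMod G.R).val : ℝ) = j.1.val + a + G.R * k := by exact_mod_cast hk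
  have hl' : ((j.2 + b : ZMod G.R).val : ℝ) = j.2.val + b + G.R * l := by exact_mod_cast hl
  rw [show z + G.pt (Equiv.addRight ((a : ZMod G.R), (b : ZMod G.R)) j) =
    z + ((a : ℝ) • G.d₁ + (b : ℝ) • G.d₂) + G.pt j +
      ((k : ℝ) • ((G.R : ℝ) • G.d₁) + (l : ℝ) • ((G.R : ℝ) • G.d₂)) by
    simp only [pt, Equiv.coe_addRight, Prod.fst_add, Prod.snd_add, hk', hl']
    module]
  rw [hH _ _ ((G.intd₁.intCast_smul k).add (G.intd₂.intCast_smul l))]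

/-- The first coordinate with respect to the basis `d₁, d₂`. -/
noncomputable def θ₁ (z : ℝ × ℝ) : ℝ := G.K * symp G.l₁ z

/-- The second coordinate with respect to the basis `d₁, d₂`. -/
noncomputable def θ₂ (z : ℝ × ℝ) : ℝ := G.K * symp G.l₂ z

theorem continuous_θ₁ : Continuous G.θ₁ := continuous_const.mul (continuous_symp _)

theorem continuous_θ₂ : Continuous G.θ₂ := continuous_const.mul (continuous_symp _)

theorem K_ne : (G.K : ℝ) ≠ 0 := Nat.cast_ne_zero.2 G.K_pos.ne'

theorem eq_θ_smul (z : ℝ × ℝ) : z = G.θ₁ z • G.d₁ + G.θ₂ z • G.d₂ := by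
  have h : ∀ w, symp G.l₁ w = 0 → symp G.l₂ w = 0 → w = 0 := by
    intro w h1 h2
    have h0 := G.symp_ne
    simp only [symp] at h0 h1 h2
    have e1 : w.1 * (G.l₁.1 * G.l₂.2 - G.l₁.2 * G.l₂.1) = 0 := by
      linear_combination G.l₂.1 * h1 - G.l₁.1 * h2
    have e2 : w.2 * (G.l₁.1 * G.l₂.2 - G.l₁.2 * G.l₂.1) = 0 := by
      linear_combination G.l₂.2 * h1 - G.l₁.2 * h2
    exact Prod.ext ((mul_eq_zero.1 e1).resolve_right h0) ((mul_eq_zero.1 e2).resolve_right h0)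
  rw [← sub_eq_zero]
  have k1 := G.symp₁₁
  have k2 := G.symp₂₂
  refine h _ ?_ ?_
  · rw [symp_sub_right, symp_add_right, symp_smul_right, symp_smul_right, G.symp₁₂, θ₁]
    linear_combination (-symp G.l₁ z) * k1
  · rw [symp_sub_right, symp_add_right, symp_smul_right, symp_smul_right, G.symp₂₁, θ₂]
    linear_combination (-symp G.l₂ z) * k2

end LatticeData

/-! ### Periodic functions and trigonometric polynomials -/

theorem lintegral_Icc_comp_add {h : ℝ → ℝ≥0∞} (hp : ∀ x (n : ℤ), h (x + n) = h x) (a : ℝ) :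
    ∫⁻ x in Icc (0 : ℝ) 1, h (x + a) = ∫⁻ x in Icc (0 : ℝ) 1, h x := by
  have h1 : ∫⁻ x in Ioc (0 : ℝ) 1, h (x + a) = ∫⁻ x in Ioc a (a + 1), h x := by
    have := (measurePreserving_add_right (volume : Measure ℝ) a).setLIntegral_comp_preimage_emb
      (measurableEmbedding_addRight a) h (Ioc a (a + 1))
    rw [← this]
    congr 2
    ext x; simp [add_comm]
  have h2 : ∀ t : ℝ, ∫⁻ x in Ioc t (t + 1), h x = ∫⁻ x in Ioc (0 : ℝ) (0 + 1), h x := fun t => by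
    refine (isAddFundamentalDomain_Ioc one_pos t).setLIntegral_eq
      (isAddFundamentalDomain_Ioc one_pos 0) h ?_
    rintro ⟨g, hg⟩ x
    obtain ⟨n, rfl⟩ := AddSubgroup.mem_zmultiples_iff.1 hg
    have := hp x n
    rw [add_comm] at this
    simpa [AddSubgroup.vadd_def] using this
  rw [← restrict_Ioc_eq_restrict_Icc, h1, h2, zero_add]

theorem lintegral_unitSquare_comp_add {H : ℝ × ℝ → ℝ≥0∞} (hm : Measurable H)
    (hp : ∀ z a, IsIntegerPoint a → H (z + a) = H z) (a : ℝ × ℝ) :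
    ∫⁻ z in unitSquare, H (z + a) = ∫⁻ z in unitSquare, H z := by
  rw [restrict_unitSquare, lintegral_prod _ (by fun_prop), lintegral_prod _ (by fun_prop)]
  have h1 : ∀ x : ℝ, ∫⁻ y in Icc (0 : ℝ) 1, H ((x, y) + a) =
      ∫⁻ y in Icc (0 : ℝ) 1, H (x + a.1, y) := by
    intro x
    exact lintegral_Icc_comp_add (h := fun y => H (x + a.1, y)) (fun y n => by
      have := hp (x + a.1, y) (0, n) ⟨0, n, by simp⟩
      simpa using this) a.2
  simp only [h1]
  exact lintegral_Icc_comp_add (h := fun x => ∫⁻ y in Icc (0 : ℝ) 1, H (x, y)) (fun x n => by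
    refine lintegral_congr fun y => ?_
    have := hp (x, y) (n, 0) ⟨n, 0, by simp⟩
    simpa using this) a.1

/-- The Lebesgue measure of the unit square. -/
noncomputable abbrev unitMeasure : Measure (ℝ × ℝ) := volume.restrict unitSquare

instance : IsFiniteMeasure unitMeasure := by
  rw [unitMeasure, restrict_unitSquare]; infer_instance

theorem ENNReal.le_of_forall_le_add_mul {a b : ℝ≥0∞} (C : NNReal)
    (h : ∀ ε : NNReal, 0 < ε → a ≤ b + C * ε) : a ≤ b := by
  refine ENNReal.le_of_forall_pos_le_add fun ε hε _ => ?_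
  refine (h (ε / (C + 1)) (by positivity)).trans ?_
  gcongr
  rw [← ENNReal.coe_mul, ENNReal.coe_le_coe]
  calc C * (ε / (C + 1)) ≤ (C + 1) * (ε / (C + 1)) := by gcongr; exact le_self_add
    _ = ε := by field_simp

theorem eLpNorm_two_sq {X : Type*} [MeasurableSpace X] (μ : Measure X) (f : X → ℂ) :
    eLpNorm f 2 μ ^ 2 = ∫⁻ x, ‖f x‖ₑ ^ 2 ∂μ := by
  have := eLpNorm_nnreal_pow_eq_lintegral (f := f) (μ := μ) (p := 2) two_ne_zero
  have h2 : ((2 : NNReal) : ℝ) = ((2 : ℕ) : ℝ) := by norm_num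
  rw [h2] at this
  simpa only [ENNReal.rpow_natCast, ENNReal.coe_ofNat] using this

/-- Trigonometric polynomials are dense in `L²` of any finite measure on a torus. -/
theorem exists_span_mFourier_eLpNorm_sub_le {d : Type*} [Fintype d]
    (ν : Measure (UnitAddTorus d)) [IsFiniteMeasure ν] {b : UnitAddTorus d → ℂ} (hb : MemLp b 2 ν)
    {ε : ℝ≥0∞} (hε : ε ≠ 0) :
    ∃ P ∈ Submodule.span ℂ (range (UnitAddTorus.mFourier (d := d))),
      eLpNorm (b - (P : UnitAddTorus d → ℂ)) 2 ν ≤ ε := by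
  wlog hε' : ε ≠ ∞ generalizing ε
  · obtain ⟨P, hP, h⟩ := this one_ne_zero ENNReal.one_ne_top
    exact ⟨P, hP, by rw [not_not.1 hε']; exact le_top⟩
  obtain ⟨g, hg, -⟩ := hb.exists_boundedContinuous_eLpNorm_sub_le (by norm_num)
    (ENNReal.half_pos hε).ne'
  have hdense : (g : C(UnitAddTorus d, ℂ)) ∈
      (Submodule.span ℂ (range (UnitAddTorus.mFourier (d := d)))).topologicalClosure := by
    rw [UnitAddTorus.span_mFourier_closure_eq_top]; trivial
  have hpos : 0 < ε.toReal := ENNReal.toReal_pos hε hε'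
  set m : ℝ≥0∞ := ν univ ^ ((2 : ℝ≥0∞).toReal)⁻¹ with hm
  have hmt : m ≠ ∞ := ENNReal.rpow_ne_top_of_nonneg (by positivity) (measure_ne_top _ _)
  obtain ⟨P, hP, hdist⟩ := Metric.mem_closure_iff.1 hdense (ε.toReal / 2 / (m.toReal + 1))
    (by positivity)
  refine ⟨P, hP, ?_⟩
  obtain ⟨g', hg'⟩ : ∃ g' : UnitAddTorus d → ℂ, g' = g := ⟨_, rfl⟩
  obtain ⟨P', hP'⟩ : ∃ P' : UnitAddTorus d → ℂ, P' = P := ⟨_, rfl⟩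
  have hgm : AEStronglyMeasurable g' ν := hg' ▸ g.continuous.aestronglyMeasurable
  have hPm : AEStronglyMeasurable P' ν := hP' ▸ P.continuous.aestronglyMeasurable
  have h1 : eLpNorm (g' - P') 2 ν ≤ ε / 2 := by
    refine (eLpNorm_le_of_ae_bound (C := ε.toReal / 2 / (m.toReal + 1))
      (Eventually.of_forall fun x => ?_)).trans ?_
    · rw [dist_eq_norm] at hdist
      rw [hg', hP']
      exact ((ContinuousMap.norm_coe_le_norm ((g : C(UnitAddTorus d, ℂ)) - P) x)).trans hdist.le
    · rw [← hm, ← ENNReal.ofReal_toReal hmt, ← ENNReal.ofReal_mul ENNReal.toReal_nonneg,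
        ← ENNReal.ofReal_toReal (ENNReal.div_lt_top hε' two_ne_zero).ne]
      refine ENNReal.ofReal_le_ofReal ?_
      rw [ENNReal.toReal_div, ENNReal.toReal_ofNat, ENNReal.toReal_ofReal ENNReal.toReal_nonneg,
        mul_div_assoc', div_le_iff₀ (by positivity)]
      nlinarith
  rw [← hP']
  rw [← hg'] at hg
  calc eLpNorm (b - P') 2 ν = eLpNorm ((b - g') + (g' - P')) 2 ν := by
        rw [sub_add_sub_cancel]
    _ ≤ eLpNorm (b - g') 2 ν + eLpNorm (g' - P') 2 ν :=
        eLpNorm_add_le (hb.1.sub hgm) (hgm.sub hPm) (by norm_num)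
    _ ≤ ε / 2 + ε / 2 := add_le_add hg h1
    _ = ε := ENNReal.add_halves ε

namespace LatticeData

variable (G : LatticeData)

/-- The trigonometric polynomial with frequencies in `K Λ` and coefficients `c`. -/
noncomputable def trigPoly (c : (ℤ × ℤ) →₀ ℂ) (z : ℝ × ℝ) : ℂ :=
  c.sum fun n a => a * cis (n.1 * G.θ₁ z + n.2 * G.θ₂ z)

theorem continuous_trigPoly (c : (ℤ × ℤ) →₀ ℂ) : Continuous (G.trigPoly c) := by
  have h1 := G.continuous_θ₁
  have h2 := G.continuous_θ₂
  unfold trigPoly Finsupp.sum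
  fun_prop

/-- The projection of the plane onto the torus of characters of `K Λ`, that is, onto the quotient by
the dual lattice. -/
noncomputable def toTorus (z : ℝ × ℝ) : UnitAddTorus (Fin 2) :=
  ![(G.θ₁ z : UnitAddCircle), (G.θ₂ z : UnitAddCircle)]

theorem continuous_toTorus : Continuous G.toTorus := by
  have h1 := G.continuous_θ₁
  have h2 := G.continuous_θ₂
  refine continuous_pi fun i => ?_
  fin_cases i
  · exact (AddCircle.continuous_mk' 1).comp h1
  · exact (AddCircle.continuous_mk' 1).comp h2

theorem mFourier_toTorus (n : Fin 2 → ℤ) (z : ℝ × ℝ) :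
    UnitAddTorus.mFourier n (G.toTorus z) = cis (n 0 * G.θ₁ z + n 1 * G.θ₂ z) := by
  simp only [UnitAddTorus.mFourier, ContinuousMap.coe_mk, Fin.prod_univ_two, toTorus,
    Matrix.cons_val_zero, Matrix.cons_val_one, cis_add]
  rw [fourier_coe_apply, fourier_coe_apply, cis, cis]
  congr 2 <;> push_cast <;> ring

theorem exists_trigPoly_of_mem_span {P : C(UnitAddTorus (Fin 2), ℂ)}
    (hP : P ∈ Submodule.span ℂ (range (UnitAddTorus.mFourier (d := Fin 2)))) :
    ∃ c, ∀ z, P (G.toTorus z) = G.trigPoly c z := by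
  obtain ⟨c, rfl⟩ := Finsupp.mem_span_range_iff_exists_finsupp.1 hP
  refine ⟨c.equivMapDomain (finTwoArrowEquiv ℤ), fun z => ?_⟩
  rw [trigPoly, Finsupp.sum_equivMapDomain, Finsupp.sum, Finsupp.sum, ContinuousMap.sum_apply]
  refine Finset.sum_congr rfl fun n _ => ?_
  rw [ContinuousMap.smul_apply, mFourier_toTorus, smul_eq_mul]
  rfl

/-- A measurable section of the projection onto the torus. -/
noncomputable def torusSection (t : UnitAddTorus (Fin 2)) : ℝ × ℝ :=
  (AddCircle.equivIco 1 0 (t 0) : ℝ) • G.d₁ + (AddCircle.equivIco 1 0 (t 1) : ℝ) • G.d₂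

theorem measurable_torusSection : Measurable G.torusSection := by
  have h : Measurable fun x : UnitAddCircle => (AddCircle.equivIco 1 0 x : ℝ) :=
    measurable_subtype_coe.comp (AddCircle.measurableEquivIco 1 0).measurable
  have h' : ∀ i : Fin 2, Measurable fun t : UnitAddTorus (Fin 2) =>
      (AddCircle.equivIco 1 0 (t i) : ℝ) := fun i => h.comp (measurable_pi_apply i)
  exact ((h' 0).smul_const _).add ((h' 1).smul_const _)

theorem torusSection_toTorus (z : ℝ × ℝ) : G.torusSection (G.toTorus z) =
    z + (((-⌊G.θ₁ z⌋ : ℤ) : ℝ) • G.d₁ + ((-⌊G.θ₂ z⌋ : ℤ) : ℝ) • G.d₂) := by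
  have h : ∀ x : ℝ, (AddCircle.equivIco 1 0 (x : UnitAddCircle) : ℝ) = x - ⌊x⌋ := fun x => by
    rw [AddCircle.coe_equivIco_mk_apply, div_one, mul_one, Int.fract]
  have e : ∀ w, z + w = G.θ₁ z • G.d₁ + G.θ₂ z • G.d₂ + w := fun w => by rw [← G.eq_θ_smul z]
  rw [e]
  simp only [torusSection, toTorus, Matrix.cons_val_zero, Matrix.cons_val_one, h]
  push_cast
  module

/-- A set that is invariant under the dual lattice `ℤ d₁ + ℤ d₂`. -/
def IsInvariant (E : Set (ℝ × ℝ)) : Prop :=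
  ∀ z (a b : ℤ), z + ((a : ℝ) • G.d₁ + (b : ℝ) • G.d₂) ∈ E ↔ z ∈ E

/-- Norm inequalities for multiplication by trigonometric polynomials pass to indicator functions of
invariant sets. The indicator function is approximated by trigonometric polynomials simultaneously
in `L²` of Lebesgue measure and in `L²` of the measure with density `|f|²`. -/
theorem eLpNorm_indicator_bounds {f : ℝ × ℝ → ℂ} (hf : Measurable f)
    (hfin : eLpNorm f 2 unitMeasure ≠ ∞) {α β : NNReal}
    (hα : ∀ c, α * eLpNorm (G.trigPoly c) 2 unitMeasure ≤
      eLpNorm (fun z => G.trigPoly c z * f z) 2 unitMeasure)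
    (hβ : ∀ c, eLpNorm (fun z => G.trigPoly c z * f z) 2 unitMeasure ≤
      β * eLpNorm (G.trigPoly c) 2 unitMeasure)
    {E : Set (ℝ × ℝ)} (hE : MeasurableSet E) (hinv : G.IsInvariant E) :
    α * eLpNorm (E.indicator fun _ => (1 : ℂ)) 2 unitMeasure ≤
        eLpNorm (E.indicator f) 2 unitMeasure ∧
      eLpNorm (E.indicator f) 2 unitMeasure ≤
        β * eLpNorm (E.indicator fun _ => (1 : ℂ)) 2 unitMeasure := by
  set ρ : Measure (ℝ × ℝ) := unitMeasure + unitMeasure.withDensity (fun z => ‖f z‖ₑ ^ 2) with hρ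
  have hdens : IsFiniteMeasure (unitMeasure.withDensity (fun z => ‖f z‖ₑ ^ 2)) := by
    refine isFiniteMeasure_withDensity ?_
    rw [← eLpNorm_two_sq]
    exact ENNReal.pow_ne_top hfin
  set E' : Set (UnitAddTorus (Fin 2)) := G.torusSection ⁻¹' E with hE'
  have hEm : MeasurableSet E' := G.measurable_torusSection hE
  have hEE : ∀ z, G.toTorus z ∈ E' ↔ z ∈ E := fun z => by
    rw [hE', mem_preimage, torusSection_toTorus, hinv]
  have htm : Measurable G.toTorus := G.continuous_toTorus.measurable
  set ind : ℝ × ℝ → ℂ := E.indicator fun _ => (1 : ℂ) with hind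
  have hindm : Measurable ind := measurable_const.indicator hE
  have hEf : E.indicator f = fun z => ind z * f z := by
    funext z
    by_cases hz : z ∈ E <;> simp [hind, hz]
  have key : ∀ ε : NNReal, 0 < ε → ∃ c, eLpNorm (ind - G.trigPoly c) 2 unitMeasure ≤ ε ∧
      eLpNorm (fun z => (ind z - G.trigPoly c z) * f z) 2 unitMeasure ≤ ε := by
    intro ε hε
    have hb : MemLp (E'.indicator fun _ => (1 : ℂ)) 2 (ρ.map G.toTorus) :=
      (memLp_const (1 : ℂ)).indicator hEm
    obtain ⟨P, hP, hPε⟩ := exists_span_mFourier_eLpNorm_sub_le (ρ.map G.toTorus) hb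
      (ε := ε) (by exact_mod_cast hε.ne')
    obtain ⟨c, hc⟩ := G.exists_trigPoly_of_mem_span hP
    have h1 : eLpNorm (ind - G.trigPoly c) 2 ρ ≤ ε := by
      rw [eLpNorm_map_measure (hb.1.sub P.continuous.aestronglyMeasurable) htm.aemeasurable] at hPε
      refine le_of_eq_of_le ?_ hPε
      congr 1
      funext z
      simp only [Function.comp, Pi.sub_apply, hc, hind]
      congr 1
      by_cases hz : z ∈ E
      · rw [indicator_of_mem hz, indicator_of_mem ((hEE z).2 hz)]
      · rw [indicator_of_notMem hz, indicator_of_notMem fun h => hz ((hEE z).1 h)]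
    refine ⟨c, (eLpNorm_mono_measure _ (Measure.le_add_right le_rfl)).trans h1, ?_⟩
    have hm : Measurable fun z => ‖(ind - G.trigPoly c) z‖ₑ ^ 2 :=
      (hindm.sub (G.continuous_trigPoly c).measurable).enorm.pow_const 2
    have h2 : eLpNorm (fun z => (ind z - G.trigPoly c z) * f z) 2 unitMeasure ^ 2 ≤
        eLpNorm (ind - G.trigPoly c) 2 ρ ^ 2 := by
      rw [eLpNorm_two_sq, eLpNorm_two_sq, hρ, lintegral_add_measure,
        lintegral_withDensity_eq_lintegral_mul _ (hf.enorm.pow_const 2) hm]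
      refine le_trans (le_of_eq ?_) le_add_self
      refine lintegral_congr fun z => ?_
      simp only [Pi.mul_apply, Pi.sub_apply, enorm_mul, mul_pow]
      rw [mul_comm]
    exact ((ENNReal.pow_le_pow_left_iff two_ne_zero).1 h2).trans h1
  have hpm : ∀ c, AEStronglyMeasurable (G.trigPoly c) unitMeasure := fun c =>
    (G.continuous_trigPoly c).aestronglyMeasurable
  have hdm : ∀ c, AEStronglyMeasurable (ind - G.trigPoly c) unitMeasure := fun c =>
    hindm.aestronglyMeasurable.sub (hpm c)
  have hfm := hf.aestronglyMeasurable (μ := unitMeasure)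
  have t1 : ∀ c, eLpNorm ind 2 unitMeasure ≤ eLpNorm (G.trigPoly c) 2 unitMeasure +
      eLpNorm (ind - G.trigPoly c) 2 unitMeasure := fun c => by
    have := eLpNorm_add_le (hpm c) (hdm c) (p := 2) (by norm_num)
    simpa using this
  have t2 : ∀ c, eLpNorm (G.trigPoly c) 2 unitMeasure ≤ eLpNorm ind 2 unitMeasure +
      eLpNorm (ind - G.trigPoly c) 2 unitMeasure := fun c => by
    have := eLpNorm_sub_le hindm.aestronglyMeasurable (hdm c) (p := 2) (by norm_num)
    simpa using this
  have t3 : ∀ c, eLpNorm (fun z => ind z * f z) 2 unitMeasure ≤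
      eLpNorm (fun z => G.trigPoly c z * f z) 2 unitMeasure +
      eLpNorm (fun z => (ind z - G.trigPoly c z) * f z) 2 unitMeasure := fun c => by
    refine le_of_eq_of_le ?_ (eLpNorm_add_le ((hpm c).mul hfm) ((hdm c).mul hfm) (by norm_num))
    congr 1; funext z; simp only [Pi.add_apply]; ring
  have t4 : ∀ c, eLpNorm (fun z => G.trigPoly c z * f z) 2 unitMeasure ≤
      eLpNorm (fun z => ind z * f z) 2 unitMeasure +
      eLpNorm (fun z => (ind z - G.trigPoly c z) * f z) 2 unitMeasure := fun c => by
    refine le_of_eq_of_le ?_ (eLpNorm_sub_le (hindm.aestronglyMeasurable.mul hfm)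
      ((hdm c).mul hfm) (by norm_num))
    congr 1; funext z; simp only [Pi.sub_apply]; ring
  rw [hEf]
  constructor
  · refine ENNReal.le_of_forall_le_add_mul (α + 1) fun ε hε => ?_
    obtain ⟨c, h1, h2⟩ := key ε hε
    calc α * eLpNorm ind 2 unitMeasure ≤ α * (eLpNorm (G.trigPoly c) 2 unitMeasure + ε) := by
          gcongr; exact (t1 c).trans (by gcongr)
      _ ≤ (eLpNorm (fun z => ind z * f z) 2 unitMeasure + ε) + α * ε := by
          rw [mul_add]; gcongr; exact (hα c).trans ((t4 c).trans (by gcongr))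
      _ = _ := by push_cast; ring
  · refine ENNReal.le_of_forall_le_add_mul (β + 1) fun ε hε => ?_
    obtain ⟨c, h1, h2⟩ := key ε hε
    calc eLpNorm (fun z => ind z * f z) 2 unitMeasure
        ≤ β * eLpNorm (G.trigPoly c) 2 unitMeasure + ε :=
          (t3 c).trans (add_le_add (hβ c) h2)
      _ ≤ β * (eLpNorm ind 2 unitMeasure + ε) + ε := by
          gcongr; exact (t2 c).trans (by gcongr)
      _ = _ := by push_cast; ring

theorem pt_eq (j : ZMod G.R × ZMod G.R) : G.pt j =
    (((j.1.val : ℕ) : ℤ) : ℝ) • G.d₁ + (((j.2.val : ℕ) : ℤ) : ℝ) • G.d₂ := by simp [pt]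

/-- Integrating over an invariant set, the sum over the grid translates amounts to multiplication by
the number of grid points. -/
theorem setLIntegral_sum_pt {H : ℝ × ℝ → ℝ≥0∞} (hm : Measurable H)
    (hp : ∀ z a, IsIntegerPoint a → H (z + a) = H z) {E : Set (ℝ × ℝ)} (hE : MeasurableSet E)
    (hinv : G.IsInvariant E) (hEp : ∀ z a, IsIntegerPoint a → (z + a ∈ E ↔ z ∈ E)) :
    ∫⁻ z in E, ∑ j, H (z + G.pt j) ∂unitMeasure =
      (G.R ^ 2 : ℕ) * ∫⁻ z in E, H z ∂unitMeasure := by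
  have h1 : ∀ j, ∫⁻ z in E, H (z + G.pt j) ∂unitMeasure = ∫⁻ z in E, H z ∂unitMeasure := by
    intro j
    rw [← lintegral_indicator hE, ← lintegral_indicator hE,
      ← lintegral_unitSquare_comp_add (hm.indicator hE) _ (G.pt j)]
    · refine lintegral_congr fun z => ?_
      have : z + G.pt j ∈ E ↔ z ∈ E := by rw [pt_eq]; exact hinv z _ _
      by_cases hz : z ∈ E
      · rw [indicator_of_mem hz, indicator_of_mem (this.2 hz)]
      · rw [indicator_of_notMem hz, indicator_of_notMem fun h => hz (this.1 h)]
    · intro z a ha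
      by_cases hz : z ∈ E
      · rw [indicator_of_mem hz, indicator_of_mem ((hEp z a ha).2 hz), hp z a ha]
      · rw [indicator_of_notMem hz, indicator_of_notMem fun h => hz ((hEp z a ha).1 h)]
  rw [lintegral_finsetSum _ fun j _ => by fun_prop]
  simp only [h1]
  rw [Finset.sum_const, Finset.card_univ, Fintype.card_prod, ZMod.card, nsmul_eq_mul, sq]

/-- If multiplication of `f` by trigonometric polynomials satisfies two-sided norm bounds, then the
square sums of `f` over the translates by the grid satisfy the corresponding pointwise bounds. To
see this, the inequalities are tested on the sets where the square sum violates a bound. -/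
theorem ae_sum_pt_bounds {f : ℝ × ℝ → ℂ} (hf : Measurable f)
    (hper : ∀ z a, IsIntegerPoint a → ‖f (z + a)‖ = ‖f z‖)
    (hfin : eLpNorm f 2 unitMeasure ≠ ∞) {α β : NNReal}
    (hα : ∀ c, α * eLpNorm (G.trigPoly c) 2 unitMeasure ≤
      eLpNorm (fun z => G.trigPoly c z * f z) 2 unitMeasure)
    (hβ : ∀ c, eLpNorm (fun z => G.trigPoly c z * f z) 2 unitMeasure ≤
      β * eLpNorm (G.trigPoly c) 2 unitMeasure) :
    ∀ᵐ z, (α : ℝ) ^ 2 * G.R ^ 2 ≤ ∑ j, ‖f (z + G.pt j)‖ ^ 2 ∧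
      ∑ j, ‖f (z + G.pt j)‖ ^ 2 ≤ (β : ℝ) ^ 2 * G.R ^ 2 := by
  have hper' : ∀ z a, IsIntegerPoint a → ‖f (z + a)‖ₑ ^ 2 = ‖f z‖ₑ ^ 2 := fun z a ha => by
    rw [← ofReal_norm, ← ofReal_norm, hper z a ha]
  set φ : ℝ × ℝ → ℝ≥0∞ := fun z => ∑ j, ‖f (z + G.pt j)‖ₑ ^ 2 with hφ
  have hφm : Measurable φ := Finset.measurable_fun_sum _ fun j _ =>
    (hf.comp (by fun_prop)).enorm.pow_const 2
  have hφinv : ∀ z (a b : ℤ), φ (z + ((a : ℝ) • G.d₁ + (b : ℝ) • G.d₂)) = φ z := fun z a b =>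
    G.sum_pt_add (H := fun z => ‖f z‖ₑ ^ 2) hper' z a b
  have hφper : ∀ z a, IsIntegerPoint a → φ (z + a) = φ z := fun z a ha => by
    simp only [hφ]
    refine Finset.sum_congr rfl fun j _ => ?_
    rw [add_right_comm, hper' _ _ ha]
  have main : ∀ S : Set ℝ≥0∞, MeasurableSet S →
      α ^ 2 * (unitMeasure (φ ⁻¹' S)) * (G.R ^ 2 : ℕ) ≤ ∫⁻ z in φ ⁻¹' S, φ z ∂unitMeasure ∧
      ∫⁻ z in φ ⁻¹' S, φ z ∂unitMeasure ≤ β ^ 2 * (unitMeasure (φ ⁻¹' S)) * (G.R ^ 2 : ℕ) := by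
    intro S hS
    have hE : MeasurableSet (φ ⁻¹' S) := hφm hS
    have hinv : G.IsInvariant (φ ⁻¹' S) := fun z a b => by
      rw [mem_preimage, hφinv, mem_preimage]
    have h1 := G.setLIntegral_sum_pt (hf.enorm.pow_const 2) hper' hE hinv
      fun z a ha => by rw [mem_preimage, hφper z a ha, mem_preimage]
    obtain ⟨h2, h3⟩ := G.eLpNorm_indicator_bounds hf hfin hα hβ hE hinv
    have e1 : eLpNorm ((φ ⁻¹' S).indicator fun _ => (1 : ℂ)) 2 unitMeasure ^ 2 =
        unitMeasure (φ ⁻¹' S) := by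
      rw [eLpNorm_two_sq, ← lintegral_indicator_one hE]
      refine lintegral_congr fun z => ?_
      by_cases hz : z ∈ φ ⁻¹' S <;> simp [hz]
    have e2 : eLpNorm ((φ ⁻¹' S).indicator f) 2 unitMeasure ^ 2 =
        ∫⁻ z in φ ⁻¹' S, ‖f z‖ₑ ^ 2 ∂unitMeasure := by
      rw [eLpNorm_two_sq, ← lintegral_indicator hE]
      refine lintegral_congr fun z => ?_
      by_cases hz : z ∈ φ ⁻¹' S <;> simp [hz]
    have h2' := pow_le_pow_left₀ bot_le h2 2
    have h3' := pow_le_pow_left₀ bot_le h3 2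
    rw [mul_pow, e1, e2] at h2' h3'
    rw [show ∫⁻ z in φ ⁻¹' S, φ z ∂unitMeasure = _ from h1, mul_comm ((G.R ^ 2 : ℕ) : ℝ≥0∞)]
    exact ⟨by gcongr, by gcongr⟩
  have hlow : unitMeasure (φ ⁻¹' Iio (α ^ 2 * (G.R ^ 2 : ℕ))) = 0 := by
    by_contra h0
    have h1 := (main (Iio (α ^ 2 * (G.R ^ 2 : ℕ))) measurableSet_Iio).1
    refine absurd h1 (not_le.2 ?_)
    calc ∫⁻ z in φ ⁻¹' Iio (α ^ 2 * (G.R ^ 2 : ℕ)), φ z ∂unitMeasure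
        < ∫⁻ _z in φ ⁻¹' Iio (α ^ 2 * (G.R ^ 2 : ℕ)),
            (α ^ 2 * (G.R ^ 2 : ℕ) : ℝ≥0∞) ∂unitMeasure := by
          refine setLIntegral_strict_mono (hφm measurableSet_Iio) h0 (by fun_prop) ?_ ?_
          · refine ne_top_of_le_ne_top ?_ (main _ measurableSet_Iio).2
            finiteness
          · exact Eventually.of_forall fun z hz => hz
      _ = _ := by rw [setLIntegral_const]; ring
  have hupp : unitMeasure (φ ⁻¹' Ioi (β ^ 2 * (G.R ^ 2 : ℕ))) = 0 := by
    by_contra h0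
    have h1 := (main (Ioi (β ^ 2 * (G.R ^ 2 : ℕ))) measurableSet_Ioi).2
    refine absurd h1 (not_le.2 ?_)
    calc _ = ∫⁻ _z in φ ⁻¹' Ioi (β ^ 2 * (G.R ^ 2 : ℕ)),
            (β ^ 2 * (G.R ^ 2 : ℕ) : ℝ≥0∞) ∂unitMeasure := by
          rw [setLIntegral_const]; ring
      _ < ∫⁻ z in φ ⁻¹' Ioi (β ^ 2 * (G.R ^ 2 : ℕ)), φ z ∂unitMeasure := by
          refine setLIntegral_strict_mono (hφm measurableSet_Ioi) h0 hφm ?_ ?_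
          · rw [setLIntegral_const]; finiteness
          · exact Eventually.of_forall fun z hz => hz
  have hae : ∀ᵐ z ∂unitMeasure, α ^ 2 * (G.R ^ 2 : ℕ) ≤ φ z ∧ φ z ≤ β ^ 2 * (G.R ^ 2 : ℕ) := by
    rw [eventually_and]
    simp only [ae_iff, not_le]
    exact ⟨hlow, hupp⟩
  filter_upwards [ae_fract hae] with z hz
  have e1 : φ (Int.fract z.1, Int.fract z.2) = φ z := by
    rw [← hφper _ ((⌊z.1⌋ : ℝ), (⌊z.2⌋ : ℝ)) ⟨_, _, rfl⟩]
    congr 1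
    ext <;> simp
  rw [e1] at hz
  have e2 : φ z = ENNReal.ofReal (∑ j, ‖f (z + G.pt j)‖ ^ 2) := by
    rw [ENNReal.ofReal_sum_of_nonneg fun j _ => by positivity]
    simp only [hφ, ENNReal.ofReal_pow (norm_nonneg _), ofReal_norm]
  have e3 : ∀ a : NNReal, (a : ℝ≥0∞) ^ 2 * (G.R ^ 2 : ℕ) =
      ENNReal.ofReal ((a : ℝ) ^ 2 * G.R ^ 2) := by
    intro a
    rw [ENNReal.ofReal_mul (by positivity), ENNReal.ofReal_pow a.coe_nonneg,
      ENNReal.ofReal_coe_nnreal, ← Nat.cast_pow, ENNReal.ofReal_natCast]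
  rw [e2, e3, e3, ENNReal.ofReal_le_ofReal_iff (by positivity),
    ENNReal.ofReal_le_ofReal_iff (by positivity)] at hz
  exact hz

end LatticeData

/-! ### Riesz bounds -/

/-- The two-sided norm inequality for finite linear combinations of a Riesz basis. -/
theorem IsRieszBasis.exists_bounds {ι E : Type*} [NormedAddCommGroup E]
    [InnerProductSpace ℂ E] {v : ι → E} (h : IsRieszBasis v) :
    ∃ α β : NNReal, 0 < α ∧ ∀ {κ : Type} (s : Finset κ) (i : κ → ι) (_ : Function.Injective i)
      (c : κ → ℂ), α * √(∑ k ∈ s, ‖c k‖ ^ 2) ≤ ‖∑ k ∈ s, c k • v (i k)‖ ∧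
        ‖∑ k ∈ s, c k • v (i k)‖ ≤ β * √(∑ k ∈ s, ‖c k‖ ^ 2) := by
  classical
  obtain ⟨T, hT⟩ := h
  have hx : ∀ {κ : Type} (s : Finset κ) (i : κ → ι) (_ : Function.Injective i) (c : κ → ℂ),
      ∃ x : lp (fun _ : ι => ℂ) 2, T x = ∑ k ∈ s, c k • v (i k) ∧
        ‖x‖ = √(∑ k ∈ s, ‖c k‖ ^ 2) := by
    intro κ s i hi c
    refine ⟨∑ l ∈ s.map ⟨i, hi⟩, lp.single 2 l (Function.extend i c 0 l), ?_, ?_⟩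
    · rw [map_sum, Finset.sum_map]
      refine Finset.sum_congr rfl fun k _ => ?_
      rw [Function.Embedding.coeFn_mk, hi.extend_apply, ← hT (i k), ← map_smul]
      congr 1
      rw [← lp.single_smul]
      simp
    · have := lp.norm_sum_single (E := fun _ : ι => ℂ) (p := 2) (by norm_num)
        (Function.extend i c 0) (s.map ⟨i, hi⟩)
      have h2 : (2 : ℝ≥0∞).toReal = ((2 : ℕ) : ℝ) := by norm_num
      have h3 : ∑ l ∈ s.map ⟨i, hi⟩, ‖Function.extend i c 0 l‖ ^ 2 = ∑ k ∈ s, ‖c k‖ ^ 2 := by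
        simp [Finset.sum_map, hi.extend_apply]
      rw [h2] at this
      simp only [Real.rpow_natCast] at this
      rw [← h3, ← this, Real.sqrt_sq (norm_nonneg _)]
  have hpos : 0 < ‖(T.symm : E →L[ℂ] lp (fun _ : ι => ℂ) 2)‖₊ + 1 := by positivity
  refine ⟨(‖(T.symm : E →L[ℂ] lp (fun _ : ι => ℂ) 2)‖₊ + 1)⁻¹,
    ‖(T : lp (fun _ : ι => ℂ) 2 →L[ℂ] E)‖₊, by positivity, fun s i hi c => ?_⟩
  obtain ⟨x, hTx, hxn⟩ := hx s i hi c
  rw [← hTx, ← hxn]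
  refine ⟨?_, ?_⟩
  · have h1 := (T.symm : E →L[ℂ] lp (fun _ : ι => ℂ) 2).le_opNorm (T x)
    simp only [ContinuousLinearEquiv.coe_coe, ContinuousLinearEquiv.symm_apply_apply] at h1
    rw [NNReal.coe_inv, inv_mul_le_iff₀ (by exact_mod_cast hpos)]
    refine h1.trans ?_
    push_cast
    gcongr
    linarith
  · exact (T : lp (fun _ : ι => ℂ) 2 →L[ℂ] E).le_opNorm x

/-! ### Orthogonality of characters -/

theorem integral_unitSquare_cis {γ : ℝ × ℝ} (hγ : IsIntegerPoint γ) (h0 : γ ≠ 0) :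
    ∫ z, cis (symp γ z) ∂unitMeasure = 0 := by
  obtain ⟨m, n, rfl⟩ := hγ
  have h1 : ∀ k : ℤ, k ≠ 0 → ∫ x in Icc (0 : ℝ) 1, cis (k * x) = 0 := fun k hk => by
    rw [← integral_zakPhase hk]
    refine integral_congr_ae (Eventually.of_forall fun x => ?_)
    simp only [cis]; congr 1; push_cast; ring
  have h2 : ∀ z : ℝ × ℝ, cis (symp ((m : ℝ), (n : ℝ)) z) =
      cis ((-n : ℤ) * z.1) * cis (m * z.2) := by
    intro z; rw [← cis_add]; congr 1; simp [symp]; ring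
  simp only [h2]
  rw [unitMeasure, restrict_unitSquare,
    integral_prod_mul (fun x : ℝ => cis ((-n : ℤ) * x)) (fun y : ℝ => cis (m * y))]
  by_cases hm : m = 0
  · have hn : -n ≠ 0 := by rintro hn; apply h0; simp [hm, neg_eq_zero.1 hn]
    rw [h1 _ hn, zero_mul]
  · rw [h1 _ hm, mul_zero]

theorem unitMeasure_univ : unitMeasure univ = 1 := by
  rw [Measure.restrict_apply_univ, unitSquare, Measure.volume_eq_prod, Measure.prod_prod]
  simp

instance : IsProbabilityMeasure unitMeasure := ⟨unitMeasure_univ⟩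

namespace LatticeData

variable (G : LatticeData)

theorem symp_eq_θ (z : ℝ × ℝ) (a b : ℤ) :
    symp ((a : ℝ) • ((G.K : ℝ) • G.l₁) + (b : ℝ) • ((G.K : ℝ) • G.l₂)) z =
      a * G.θ₁ z + b * G.θ₂ z := by
  rw [symp_add_left, symp_smul_left, symp_smul_left, symp_smul_left, symp_smul_left, θ₁, θ₂]

theorem smul_add_smul_inj {a b a' b' : ℝ}
    (h : a • G.l₁ + b • G.l₂ = a' • G.l₁ + b' • G.l₂) : a = a' ∧ b = b' := by
  have h1 := congrArg (symp G.l₁) h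
  have h2 := congrArg (symp G.l₂) h
  have h3 := G.symp_ne
  simp only [symp_add_right, symp_smul_right, symp_self, mul_zero, zero_add, add_zero] at h1 h2
  rw [symp_comm G.l₂ G.l₁] at h2
  exact ⟨mul_right_cancel₀ (neg_ne_zero.2 h3) h2, mul_right_cancel₀ h3 h1⟩

/-- Parseval's identity for trigonometric polynomials. -/
theorem eLpNorm_trigPoly (c : (ℤ × ℤ) →₀ ℂ) : eLpNorm (G.trigPoly c) 2 unitMeasure =
    ENNReal.ofReal √(∑ n ∈ c.support, ‖c n‖ ^ 2) := by
  have hint : ∀ f : ℝ × ℝ → ℂ, Continuous f → Integrable f unitMeasure := fun f hf =>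
    hf.continuousOn.integrableOn_compact (isCompact_Icc.prod isCompact_Icc)
  have horth : ∀ n m : ℤ × ℤ, ∫ z, (starRingEnd ℂ) (cis (n.1 * G.θ₁ z + n.2 * G.θ₂ z)) *
      cis (m.1 * G.θ₁ z + m.2 * G.θ₂ z) ∂unitMeasure = if n = m then 1 else 0 := by
    intro n m
    have h1 : ∀ z, (starRingEnd ℂ) (cis (n.1 * G.θ₁ z + n.2 * G.θ₂ z)) *
        cis (m.1 * G.θ₁ z + m.2 * G.θ₂ z) = cis (symp (((m.1 - n.1 : ℤ) : ℝ) • ((G.K : ℝ) • G.l₁) +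
          ((m.2 - n.2 : ℤ) : ℝ) • ((G.K : ℝ) • G.l₂)) z) := fun z => by
      rw [symp_eq_θ, conj_cis, ← cis_add]; congr 1; push_cast; ring
    simp only [h1]
    split_ifs with hnm
    · subst hnm
      simp [symp]
    · refine integral_unitSquare_cis ((G.int₁.intCast_smul _).add (G.int₂.intCast_smul _)) ?_
      intro h0
      have h2 := G.smul_add_smul_inj (a := ((m.1 - n.1 : ℤ) : ℝ) * G.K)
        (b := ((m.2 - n.2 : ℤ) : ℝ) * G.K) (a' := 0) (b' := 0) (by
          rw [mul_smul, mul_smul, h0]; simp)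
      have h3 := (mul_eq_zero.1 h2.1).resolve_right G.K_ne
      have h4 := (mul_eq_zero.1 h2.2).resolve_right G.K_ne
      rw [Int.cast_eq_zero, sub_eq_zero] at h3 h4
      exact hnm (Prod.ext h3.symm h4.symm)
  have h1 := G.continuous_θ₁
  have h2 := G.continuous_θ₂
  have hsq : ∫ z, (starRingEnd ℂ) (G.trigPoly c z) * G.trigPoly c z ∂unitMeasure =
      ((∑ n ∈ c.support, ‖c n‖ ^ 2 : ℝ) : ℂ) := by
    have e1 : ∀ z, (starRingEnd ℂ) (G.trigPoly c z) * G.trigPoly c z =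
        ∑ n ∈ c.support, ∑ m ∈ c.support, ((starRingEnd ℂ) (c n) * c m) *
          ((starRingEnd ℂ) (cis (n.1 * G.θ₁ z + n.2 * G.θ₂ z)) *
            cis (m.1 * G.θ₁ z + m.2 * G.θ₂ z)) := fun z => by
      rw [trigPoly, Finsupp.sum, map_sum, Finset.sum_mul_sum]
      refine Finset.sum_congr rfl fun n _ => Finset.sum_congr rfl fun m _ => ?_
      rw [map_mul]; ring
    simp only [e1]
    rw [integral_finsetSum _ fun n _ => hint _ (by fun_prop)]
    push_cast
    refine Finset.sum_congr rfl fun n hn => ?_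
    rw [integral_finsetSum _ fun m _ => hint _ (by fun_prop)]
    simp only [integral_const_mul, horth]
    simp only [mul_ite, mul_one, mul_zero, Finset.sum_ite_eq, if_pos hn]
    rw [← Complex.conj_mul']
  have hre : ∫⁻ z, ‖G.trigPoly c z‖ₑ ^ 2 ∂unitMeasure =
      ENNReal.ofReal (∑ n ∈ c.support, ‖c n‖ ^ 2) := by
    have e2 : ∫ z, ‖G.trigPoly c z‖ ^ 2 ∂unitMeasure = ∑ n ∈ c.support, ‖c n‖ ^ 2 := by
      apply Complex.ofReal_injective
      rw [← hsq, ← integral_complex_ofReal]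
      refine integral_congr_ae (Eventually.of_forall fun z => ?_)
      simp only [Complex.conj_mul']; push_cast; rfl
    have hc := G.continuous_trigPoly c
    have hi : Integrable (fun z => ‖G.trigPoly c z‖ ^ 2) unitMeasure :=
      (hc.norm.pow 2).continuousOn.integrableOn_compact (isCompact_Icc.prod isCompact_Icc)
    rw [← e2, ofReal_integral_eq_lintegral_ofReal hi
      (Eventually.of_forall fun z => sq_nonneg _)]
    refine lintegral_congr fun z => ?_
    rw [ENNReal.ofReal_pow (norm_nonneg _), ofReal_norm]
  rw [← eLpNorm_two_sq] at hre
  refine (ENNReal.pow_right_strictMono two_ne_zero).injective ?_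
  rw [hre, ← ENNReal.ofReal_pow (Real.sqrt_nonneg _), Real.sq_sqrt (by positivity)]

end LatticeData

theorem zak_sum {ι : Type*} (s : Finset ι) (c : ι → ℂ) (f : ι → L2R) :
    ∀ᵐ p, zak (∑ i ∈ s, c i • f i) p = ∑ i ∈ s, c i * zak (f i) p := by
  classical
  induction s using Finset.induction_on with
  | empty => simpa using zak_zero
  | insert i s hi ih =>
    filter_upwards [ih, zak_add (c i • f i) (∑ i ∈ s, c i • f i), zak_smul (c i) (f i)]
      with p h1 h2 h3
    rw [Finset.sum_insert hi, Finset.sum_insert hi, h2, h3, h1]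

theorem sqrt_sum_norm_sq_mul {ι κ : Type*} (s : Finset ι) (t : Finset κ) (a : ι → ℂ) (b : κ → ℂ)
    (φ : ι × κ → ℂ) (hφ : ∀ q, ‖φ q‖ = 1) :
    √(∑ q ∈ s ×ˢ t, ‖a q.1 * b q.2 * φ q‖ ^ 2) =
      √(∑ k ∈ t, ‖b k‖ ^ 2) * √(∑ i ∈ s, ‖a i‖ ^ 2) := by
  rw [← Real.sqrt_mul (by positivity), mul_comm, Finset.sum_mul_sum, Finset.sum_product]
  congr 1
  refine Finset.sum_congr rfl fun i _ => Finset.sum_congr rfl fun k _ => ?_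
  rw [norm_mul, hφ, mul_one, norm_mul, mul_pow]

theorem norm_sum_gaborFamily {κ : Type*} (g : L2R) (Λ : Set (ℝ × ℝ)) (s : Finset κ) (c : κ → ℂ)
    (i : κ → Λ) : ‖∑ k ∈ s, c k • gaborFamily g Λ (i k)‖ =
      ‖∑ k ∈ s, c k • timeFreqShift (i k) g‖ := by
  have h : ((∑ k ∈ s, c k • gaborFamily g Λ (i k) : gaborSpace g Λ) : L2R) =
      ∑ k ∈ s, c k • timeFreqShift (i k) g := by
    rw [Submodule.coe_sum]
    exact Finset.sum_congr rfl fun k _ => rfl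
  rw [← h]
  rfl

namespace LatticeData

variable (G : LatticeData)

/-- The lattice spanned by `l₁` and `l₂`. -/
def lattice : Set (ℝ × ℝ) := {z | ∃ a b : ℤ, z = (a : ℝ) • G.l₁ + (b : ℝ) • G.l₂}

/-- The time-frequency shifts of `H` by the representatives of `Λ` modulo `K Λ`. -/
noncomputable def shifts (H : ℝ × ℝ → ℂ) (p : Fin G.K × Fin G.K) : ℝ × ℝ → ℂ :=
  tau ((p.1 : ℝ) • G.l₁) (tau ((p.2 : ℝ) • G.l₂) H)

theorem quasiPeriodic_shifts {H : ℝ × ℝ → ℂ} (hH : QuasiPeriodic H) (p : Fin G.K × Fin G.K) :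
    QuasiPeriodic (G.shifts H p) := quasiPeriodic_tau (quasiPeriodic_tau hH _) _

/-- The point of the lattice with coordinates `p - K n`. -/
noncomputable def latticePt (q : (ℤ × ℤ) × (Fin G.K × Fin G.K)) : ℝ × ℝ :=
  ((q.2.1 : ℝ) - G.K * q.1.1) • G.l₁ + ((q.2.2 : ℝ) - G.K * q.1.2) • G.l₂

theorem latticePt_mem (q : (ℤ × ℤ) × (Fin G.K × Fin G.K)) : G.latticePt q ∈ G.lattice :=
  ⟨q.2.1 - G.K * q.1.1, q.2.2 - G.K * q.1.2, by simp [latticePt]⟩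

theorem latticePt_injective : Function.Injective G.latticePt := by
  have hcoord : ∀ (a b : Fin G.K) (m n : ℤ), (a : ℝ) - G.K * m = (b : ℝ) - G.K * n →
      a = b ∧ m = n := by
    intro a b m n h
    have h' : ((a : ℕ) : ℤ) - G.K * m = ((b : ℕ) : ℤ) - G.K * n := by exact_mod_cast h
    have ha : ((a : ℕ) : ℤ) < G.K := by exact_mod_cast a.2
    have hb : ((b : ℕ) : ℤ) < G.K := by exact_mod_cast b.2
    have e : ((a : ℕ) : ℤ) - b = G.K * (m - n) := by linarith
    have hd : ((G.K : ℕ) : ℤ) ∣ ((a : ℕ) : ℤ) - b := ⟨_, e⟩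
    have h0 : ((a : ℕ) : ℤ) - b = 0 := Int.eq_zero_of_abs_lt_dvd hd (by
      rw [abs_lt]
      constructor <;> linarith [Int.natCast_nonneg (a : ℕ), Int.natCast_nonneg (b : ℕ)])
    refine ⟨Fin.ext (by omega), ?_⟩
    rw [h0, eq_comm, mul_eq_zero] at e
    have := G.K_pos
    rcases e with e | e <;> omega
  rintro ⟨⟨m, n⟩, a, b⟩ ⟨⟨m', n'⟩, a', b'⟩ h
  obtain ⟨h1, h2⟩ := G.smul_add_smul_inj h
  obtain ⟨r1, r2⟩ := hcoord _ _ _ _ h1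
  obtain ⟨r3, r4⟩ := hcoord _ _ _ _ h2
  simp_all

/-- Multiplying a shifted Zak transform by a character of `K Λ` amounts to a further
time-frequency shift. -/
theorem exists_phase_zak (g : L2R) (q : (ℤ × ℤ) × (Fin G.K × Fin G.K)) :
    ∃ φ : ℂ, ‖φ‖ = 1 ∧ ∀ᵐ z, cis (q.1.1 * G.θ₁ z + q.1.2 * G.θ₂ z) * G.shifts (zak g) q.2 z =
      φ * zak (timeFreqShift (G.latticePt q) g) z := by
  set γ := ((-q.1.1 : ℤ) : ℝ) • ((G.K : ℝ) • G.l₁) + ((-q.1.2 : ℤ) : ℝ) • ((G.K : ℝ) • G.l₂) with hγ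
  have hi : IsIntegerPoint γ := (G.int₁.intCast_smul _).add (G.int₂.intCast_smul _)
  refine ⟨cis (-(γ.1 * ((q.2.1 : ℝ) • G.l₁).2)) *
    cis (-((γ + (q.2.1 : ℝ) • G.l₁).1 * ((q.2.2 : ℝ) • G.l₂).2)), by simp, ?_⟩
  filter_upwards [zak_timeFreqShift (G.latticePt q) g] with z hz
  have h1 := (G.quasiPeriodic_shifts (quasiPeriodic_zak g) q.2).tau_integral hi z
  rw [hγ, symp_eq_θ, ← hγ] at h1
  rw [hz, show cis (q.1.1 * G.θ₁ z + q.1.2 * G.θ₂ z) =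
    cis (-(((-q.1.1 : ℤ) : ℝ) * G.θ₁ z + ((-q.1.2 : ℤ) : ℝ) * G.θ₂ z)) by
      congr 1; push_cast; ring, ← h1]
  unfold shifts
  rw [tau_tau, tau_tau, ← mul_assoc]
  congr 2
  rw [hγ, latticePt]
  push_cast
  module

/-- The Riesz bounds in terms of the Zak transform: the rectangular matrices of the shifts at the
grid points are bounded above and below almost everywhere. -/
theorem exists_ae_bounds (g : L2R) (hR : IsRieszBasis (gaborFamily g G.lattice)) :
    ∃ α β : ℝ, 0 < α ∧ ∀ᵐ z, ∀ v : Fin G.K × Fin G.K → ℂ,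
      α * ∑ p, ‖v p‖ ^ 2 ≤ ∑ j, ‖∑ p, v p * G.shifts (zak g) p (z + G.pt j)‖ ^ 2 ∧
      ∑ j, ‖∑ p, v p * G.shifts (zak g) p (z + G.pt j)‖ ^ 2 ≤ β * ∑ p, ‖v p‖ ^ 2 := by
  obtain ⟨α, β, hα, hb⟩ := hR.exists_bounds
  choose φ hφ hz using G.exists_phase_zak g
  have hR0 : (0 : ℝ) < G.R := Nat.cast_pos.2 G.R_pos
  have hα' : (0 : ℝ) < α := NNReal.coe_pos.2 hα
  refine ⟨(α : ℝ) ^ 2 * G.R ^ 2, (β : ℝ) ^ 2 * G.R ^ 2, by positivity, ?_⟩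
  have hmeas : ∀ v : Fin G.K × Fin G.K → ℂ, Measurable fun z => ∑ p, v p * G.shifts (zak g) p z :=
    fun v => Finset.measurable_fun_sum _ fun p _ =>
      (measurable_tau (measurable_tau (measurable_zak g) _) _).const_mul _
  have hsingle : ∀ v : Fin G.K × Fin G.K → ℂ, ∀ᵐ z,
      α ^ 2 * G.R ^ 2 * ∑ p, ‖v p‖ ^ 2 ≤
        ∑ j, ‖∑ p, v p * G.shifts (zak g) p (z + G.pt j)‖ ^ 2 ∧
      ∑ j, ‖∑ p, v p * G.shifts (zak g) p (z + G.pt j)‖ ^ 2 ≤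
        β ^ 2 * G.R ^ 2 * ∑ p, ‖v p‖ ^ 2 := by
    intro v
    set N : NNReal := NNReal.sqrt (∑ p, ‖v p‖₊ ^ 2) with hN
    have hN' : (N : ℝ) = √(∑ p, ‖v p‖ ^ 2) := by rw [hN, Real.coe_sqrt]; push_cast; rfl
    -- the norm of `P f` for a trigonometric polynomial `P`, as that of an element of `L²(ℝ)`
    have hnorm : ∀ c : (ℤ × ℤ) →₀ ℂ,
        eLpNorm (fun z => G.trigPoly c z * ∑ p, v p * G.shifts (zak g) p z) 2 unitMeasure =
          ENNReal.ofReal ‖∑ q ∈ c.support ×ˢ Finset.univ, (c q.1 * v q.2 * φ q) •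
            gaborFamily g G.lattice ⟨G.latticePt q, G.latticePt_mem q⟩‖ := by
      intro c
      have e1 : ‖∑ q ∈ c.support ×ˢ Finset.univ, (c q.1 * v q.2 * φ q) •
            gaborFamily g G.lattice ⟨G.latticePt q, G.latticePt_mem q⟩‖ =
          ‖∑ q ∈ c.support ×ˢ (Finset.univ : Finset (Fin G.K × Fin G.K)),
            (c q.1 * v q.2 * φ q) • timeFreqShift (G.latticePt q) g‖ :=
        norm_sum_gaborFamily g _ _ _ fun q => ⟨G.latticePt q, G.latticePt_mem q⟩
      rw [e1, ofReal_norm, ← eLpNorm_zak]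
      refine eLpNorm_congr_ae (ae_restrict_of_ae ?_)
      filter_upwards [zak_sum (c.support ×ˢ (Finset.univ : Finset (Fin G.K × Fin G.K)))
        (fun q => c q.1 * v q.2 * φ q) (fun q => timeFreqShift (G.latticePt q) g),
        ae_all_iff.2 hz] with z h1 h2
      rw [h1, trigPoly, Finsupp.sum, Finset.sum_mul_sum, Finset.sum_product]
      refine Finset.sum_congr rfl fun n _ => Finset.sum_congr rfl fun p _ => ?_
      linear_combination (c n * v p) * h2 (n, p)
    have hB := fun c : (ℤ × ℤ) →₀ ℂ => hb (c.support ×ˢ (Finset.univ : Finset (Fin G.K × Fin G.K)))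
      (fun q => (⟨G.latticePt q, G.latticePt_mem q⟩ : G.lattice))
      (fun q q' h => G.latticePt_injective (congrArg Subtype.val h))
      (fun q => c q.1 * v q.2 * φ q)
    simp only [sqrt_sum_norm_sq_mul _ _ _ _ _ hφ] at hB
    have key := G.ae_sum_pt_bounds (hmeas v) (fun z a ha => ?_) ?_ (α := α * N) (β := β * N)
      (fun c => ?_) (fun c => ?_)
    · filter_upwards [key] with z hz
      have hs : (N : ℝ) ^ 2 = ∑ p, ‖v p‖ ^ 2 := by
        rw [hN', Real.sq_sqrt (by positivity)]
      rw [← hs]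
      push_cast at hz
      constructor <;> nlinarith [hz.1, hz.2]
    · obtain ⟨m, n, rfl⟩ := ha
      rw [show ∑ p, v p * G.shifts (zak g) p (z + ((m : ℝ), (n : ℝ))) =
        cis (m * z.2) * ∑ p, v p * G.shifts (zak g) p z by
          rw [Finset.mul_sum]
          refine Finset.sum_congr rfl fun p _ => ?_
          rw [G.quasiPeriodic_shifts (quasiPeriodic_zak g) p z m n]; ring,
        norm_mul, norm_cis, one_mul]
    · have := hnorm (Finsupp.single 0 1)
      have e : ∀ z, G.trigPoly (Finsupp.single 0 1) z = 1 := fun z => by simp [trigPoly]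
      simp only [e, one_mul] at this
      rw [this]
      exact ENNReal.ofReal_ne_top
    · rw [hnorm, eLpNorm_trigPoly, ← ENNReal.ofReal_coe_nnreal,
        ← ENNReal.ofReal_mul (NNReal.coe_nonneg _)]
      refine ENNReal.ofReal_le_ofReal ?_
      rw [NNReal.coe_mul, hN', mul_assoc]
      exact (hB c).1
    · rw [hnorm, eLpNorm_trigPoly, ← ENNReal.ofReal_coe_nnreal,
        ← ENNReal.ofReal_mul (NNReal.coe_nonneg _)]
      refine ENNReal.ofReal_le_ofReal ?_
      rw [NNReal.coe_mul, hN', mul_assoc]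
      exact (hB c).2
  -- a common null set for all `v`: the inequalities are closed conditions, so a countable dense set
  -- of vectors suffices
  obtain ⟨D, hDc, hDd⟩ := TopologicalSpace.exists_countable_dense (Fin G.K × Fin G.K → ℂ)
  filter_upwards [(ae_ball_iff hDc).2 fun v _ => hsingle v] with z hz v
  have hcl : IsClosed {v : Fin G.K × Fin G.K → ℂ |
      (α : ℝ) ^ 2 * G.R ^ 2 * ∑ p, ‖v p‖ ^ 2 ≤
        ∑ j, ‖∑ p, v p * G.shifts (zak g) p (z + G.pt j)‖ ^ 2 ∧
      ∑ j, ‖∑ p, v p * G.shifts (zak g) p (z + G.pt j)‖ ^ 2 ≤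
        (β : ℝ) ^ 2 * G.R ^ 2 * ∑ p, ‖v p‖ ^ 2} := by
    rw [ofPred_and]
    exact (isClosed_le (by fun_prop) (by fun_prop)).inter (isClosed_le (by fun_prop) (by fun_prop))
  exact hcl.closure_subset_iff.2 hz (hDd v)

/-! ### Averaging along the first basis vector -/

/-- The twisted sum of the shifts of `H` by `0, l₁, …, (K - 1) l₁`, evaluated at `ξ + k`. The phases
make it an eigenvector of the shift by `l₁`. -/
noncomputable def fold (H : ℝ × ℝ → ℂ) (k ξ : ℝ × ℝ) : ℂ :=
  ∑ m ∈ Finset.range G.K, cis (m * symp G.l₁ ξ - (m * (m - 1) / 2 : ℝ) * (G.l₁.1 * G.l₁.2)) *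
    tau ((m : ℝ) • G.l₁) H (ξ + k)

theorem fold_const_mul (c : ℂ) (H : ℝ × ℝ → ℂ) (k ξ : ℝ × ℝ) :
    G.fold (fun z => c * H z) k ξ = c * G.fold H k ξ := by
  rw [fold, fold, Finset.mul_sum]
  exact Finset.sum_congr rfl fun m _ => by rw [tau_const_mul]; ring

theorem fold_tau (ν : ℝ × ℝ) (H : ℝ × ℝ → ℂ) (k ξ : ℝ × ℝ) :
    G.fold (tau ν H) k ξ = cis (ν.2 * (ξ + k).1) * G.fold H k (ξ - ν) := by
  rw [fold, fold, Finset.mul_sum]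
  refine Finset.sum_congr rfl fun m _ => ?_
  rw [tau_comm, symp_smul_left, tau, symp_sub_right]
  simp only [← mul_assoc, ← cis_add]
  rw [show ξ + k - ν = ξ - ν + k by abel]
  congr 2
  ring

theorem fold_tau_tau (a b : ℝ × ℝ) (H : ℝ × ℝ → ℂ) (k ξ : ℝ × ℝ) :
    G.fold (tau a (tau b H)) k ξ = cis (-(a.1 * b.2)) * G.fold (tau (a + b) H) k ξ := by
  rw [← fold_const_mul]
  congr 1
  funext z
  exact tau_tau a b H z

theorem fold_tau_comm (a b : ℝ × ℝ) (H : ℝ × ℝ → ℂ) (k ξ : ℝ × ℝ) :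
    G.fold (tau a (tau b H)) k ξ = cis (-symp a b) * G.fold (tau b (tau a H)) k ξ := by
  rw [← fold_const_mul]
  congr 1
  funext z
  exact tau_comm a b H z

theorem symp_pt₁ (j : ZMod G.R × ZMod G.R) : G.K * symp G.l₁ (G.pt j) = (j.1.val : ℤ) := by
  rw [pt, symp_add_right, symp_smul_right, symp_smul_right, G.symp₁₂]
  have := G.symp₁₁
  push_cast
  linear_combination (j.1.val : ℝ) * this

theorem symp_pt₂ (j : ZMod G.R × ZMod G.R) : G.K * symp G.l₂ (G.pt j) = (j.2.val : ℤ) := by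
  rw [pt, symp_add_right, symp_smul_right, symp_smul_right, G.symp₂₁]
  have := G.symp₂₂
  push_cast
  linear_combination (j.2.val : ℝ) * this

/-- The phases in `fold` are chosen such that the shift by `l₁` permutes its terms cyclically, up
to a common factor. The last term returns to the first by quasi-periodicity, as `K l₁ ∈ ℤ²`. -/
theorem fold_tau_l₁ {H : ℝ × ℝ → ℂ} (hH : QuasiPeriodic H) (j : ZMod G.R × ZMod G.R)
    (ξ : ℝ × ℝ) : G.fold (tau G.l₁ H) (G.pt j) ξ =
      cis (-symp G.l₁ ξ) * G.fold H (G.pt j) ξ := by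
  set T : ℕ → ℂ := fun m =>
    cis (m * symp G.l₁ ξ - (m * (m - 1) / 2 : ℝ) * (G.l₁.1 * G.l₁.2)) *
      tau ((m : ℝ) • G.l₁) H (ξ + G.pt j) with hT
  have hstep : G.fold (tau G.l₁ H) (G.pt j) ξ =
      cis (-symp G.l₁ ξ) * ∑ m ∈ Finset.range G.K, T (m + 1) := by
    rw [fold, Finset.mul_sum]
    refine Finset.sum_congr rfl fun m _ => ?_
    rw [hT, tau_tau]
    simp only [← mul_assoc, ← cis_add]
    rw [show (m : ℝ) • G.l₁ + G.l₁ = ((m + 1 : ℕ) : ℝ) • G.l₁ by push_cast; module]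
    congr 2
    simp only [Prod.smul_fst, smul_eq_mul]
    push_cast
    ring
  -- here `phase_int` enters
  have hends : T G.K = T 0 := by
    obtain ⟨n, hn⟩ := G.phase_int
    have h1 := hH.tau_integral G.int₁ (ξ + G.pt j)
    have h2 := G.symp_pt₁ j
    simp only [hT, h1, ← mul_assoc, ← cis_add]
    rw [symp_smul_left, symp_add_right, Nat.cast_zero, zero_smul, tau_zero]
    congr 1
    rw [cis_congr (t := 0) (-n - (j.1.val : ℤ))]
    · simp
    · push_cast at h2 ⊢
      linear_combination -h2 - hn
  have hsum : ∑ m ∈ Finset.range G.K, T (m + 1) = ∑ m ∈ Finset.range G.K, T m := by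
    have h1 := Finset.sum_range_succ T G.K
    rw [Finset.sum_range_succ', hends] at h1
    exact add_right_cancel h1
  rw [hstep, hsum]
  rfl

/-- The shift by a multiple of `K l₂ ∈ ℤ²` acts on `fold` by a character; it commutes with the
shifts by `m l₁` because `K symp l₁ l₂` is an integer. -/
theorem fold_tau_K_l₂ {H : ℝ × ℝ → ℂ} (hH : QuasiPeriodic H) (j : ZMod G.R × ZMod G.R) (q : ℤ)
    (ξ : ℝ × ℝ) : G.fold (tau ((q : ℝ) • ((G.K : ℝ) • G.l₂)) H) (G.pt j) ξ =
      cis (-(q * (G.K * symp G.l₂ ξ))) * G.fold H (G.pt j) ξ := by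
  obtain ⟨n, hn⟩ := G.symp_int
  have h2 := G.symp_pt₂ j
  rw [fold, fold, Finset.mul_sum]
  refine Finset.sum_congr rfl fun m _ => ?_
  rw [tau_comm, (quasiPeriodic_tau hH _).tau_integral (G.int₂.intCast_smul q)]
  simp only [← mul_assoc, ← cis_add]
  congr 1
  refine cis_congr (-(m * q * n) - q * (j.2.val : ℤ)) ?_
  simp only [symp_smul_left, symp_smul_right, symp_add_right]
  push_cast at h2 ⊢
  linear_combination (-(m : ℝ) * q) * hn - (q : ℝ) * h2

/-- Shifting by a multiple of `l₁` only multiplies `fold` by a factor independent of the grid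
point. -/
theorem exists_fold_tau_smul_l₁ {H : ℝ × ℝ → ℂ} (hH : QuasiPeriodic H) (a : ℤ) (ξ : ℝ × ℝ) :
    ∃ c : ℂ, ∀ j, G.fold (tau ((a : ℝ) • G.l₁) H) (G.pt j) ξ = c * G.fold H (G.pt j) ξ := by
  have hstep : ∀ a : ℝ, ∃ c : ℂ, c ≠ 0 ∧ ∀ j, G.fold (tau ((a + 1) • G.l₁) H) (G.pt j) ξ =
      c * G.fold (tau (a • G.l₁) H) (G.pt j) ξ := by
    intro a
    refine ⟨cis (G.l₁.1 * (a • G.l₁).2) * cis (-symp G.l₁ ξ),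
      mul_ne_zero (cis_ne_zero _) (cis_ne_zero _), fun j => ?_⟩
    have h1 := G.fold_tau_l₁ (quasiPeriodic_tau hH (a • G.l₁)) j ξ
    rw [mul_assoc, ← h1, fold_tau_tau, ← mul_assoc, ← cis_add,
      show (a + 1) • G.l₁ = G.l₁ + a • G.l₁ by module]
    simp
  induction a using Int.induction_on with
  | zero => exact ⟨1, fun j => by simp [tau_zero]⟩
  | succ i ih =>
    obtain ⟨c, hc⟩ := ih
    obtain ⟨c', -, hc'⟩ := hstep i
    refine ⟨c' * c, fun j => ?_⟩
    have := hc' j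
    push_cast at hc ⊢
    rw [this, hc, mul_assoc]
  | pred i ih =>
    obtain ⟨c, hc⟩ := ih
    obtain ⟨c', h0, hc'⟩ := hstep (-i - 1)
    refine ⟨c'⁻¹ * c, fun j => ?_⟩
    have h1 := hc' j
    rw [sub_add_cancel] at h1
    have h2 := hc j
    push_cast at h2 ⊢
    rw [h1] at h2
    rw [mul_assoc, ← h2, inv_mul_cancel_left₀ h0]

/-! ### The fiber matrices -/

/-- The matrix whose `n`-th column samples `fold` of the shift of `F` by `ν` and `n l₂` at the grid
points. -/
noncomputable def fiber (F : ℝ × ℝ → ℂ) (ν ξ : ℝ × ℝ) :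
    Matrix (ZMod G.R × ZMod G.R) (Fin G.K) ℂ :=
  Matrix.of fun j n => G.fold (tau ν (tau ((n : ℝ) • G.l₂) F)) (G.pt j) ξ

variable {G} {F : ℝ × ℝ → ℂ}

theorem fiber_apply (ν ξ : ℝ × ℝ) (j n) :
    G.fiber F ν ξ j n = G.fold (tau ν (tau ((n : ℝ) • G.l₂) F)) (G.pt j) ξ := rfl

theorem fiber_zero_apply (ξ : ℝ × ℝ) (j n) :
    G.fiber F 0 ξ j n = G.fold (tau ((n : ℝ) • G.l₂) F) (G.pt j) ξ := by
  rw [fiber_apply, tau_zero]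

/-- The fiber matrix of a shift is a translate of the unshifted one, up to unimodular factors in the
rows. -/
theorem fiber_add (ν ν' ξ : ℝ × ℝ) : G.fiber F (ν + ν') ξ = cis (ν.1 * ν'.2) •
    (Matrix.diagonal (fun j => cis (ν.2 * (ξ + G.pt j).1)) * G.fiber F ν' (ξ - ν)) := by
  ext j n
  rw [Matrix.smul_apply, Matrix.diagonal_mul, fiber_apply, fiber_apply, ← fold_tau,
    G.fold_tau_tau ν ν', smul_eq_mul, ← mul_assoc, ← cis_add]
  simp

theorem fiber_eq (ν ξ : ℝ × ℝ) : G.fiber F ν ξ =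
    Matrix.diagonal (fun j => cis (ν.2 * (ξ + G.pt j).1)) * G.fiber F 0 (ξ - ν) := by
  have := fiber_add (G := G) (F := F) ν 0 ξ
  simpa using this

/-- For lattice points the columns of the fiber matrix are multiples of the unshifted ones. -/
theorem exists_fold_tau_lattice (hF : QuasiPeriodic F) {z : ℝ × ℝ} (hz : z ∈ G.lattice) (m : ℕ)
    (ξ : ℝ × ℝ) : ∃ (c : ℂ) (n : Fin G.K), ∀ j,
      G.fold (tau ((m : ℝ) • G.l₂) (tau z F)) (G.pt j) ξ = c * G.fiber F 0 ξ j n := by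
  obtain ⟨a, b, rfl⟩ := hz
  have hK : (0 : ℤ) < G.K := by exact_mod_cast G.K_pos
  set r : ℤ := (m + b) % G.K with hr
  have hr0 : 0 ≤ r := Int.emod_nonneg _ hK.ne'
  have hrK : r < G.K := Int.emod_lt_of_pos _ hK
  set q : ℤ := (m + b) / G.K with hq
  have hrq : (m : ℤ) + b = r + G.K * q := (Int.emod_add_mul_ediv _ _).symm
  have hrq' : (m : ℝ) + b = r + G.K * q := by exact_mod_cast hrq
  set n : Fin G.K := ⟨r.toNat, by omega⟩ with hn
  have hn' : ((n : ℕ) : ℝ) = r := by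
    have : ((n : ℕ) : ℤ) = r := Int.toNat_of_nonneg hr0
    exact_mod_cast this
  have hQ := quasiPeriodic_tau hF ((n : ℝ) • G.l₂)
  obtain ⟨c, hc⟩ := G.exists_fold_tau_smul_l₁
    (quasiPeriodic_tau hQ ((q : ℝ) • ((G.K : ℝ) • G.l₂))) a ξ
  refine ⟨cis (-(((m : ℝ) • G.l₂).1 * ((a : ℝ) • G.l₁ + (b : ℝ) • G.l₂).2)) *
    (cis (((a : ℝ) • G.l₁).1 * ((q : ℝ) • ((G.K : ℝ) • G.l₂)).2) *
    cis (((a : ℝ) • G.l₁ + (q : ℝ) • ((G.K : ℝ) • G.l₂)).1 * ((n : ℝ) • G.l₂).2)) *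
    (c * cis (-(q * (G.K * symp G.l₂ ξ)))), n, fun j => ?_⟩
  rw [fiber_zero_apply, mul_assoc, mul_assoc c, ← G.fold_tau_K_l₂ hQ j q ξ, ← hc j, fold_tau_tau,
    fold_tau_tau, fold_tau_tau,
    show (m : ℝ) • G.l₂ + ((a : ℝ) • G.l₁ + (b : ℝ) • G.l₂) =
      (a : ℝ) • G.l₁ + (q : ℝ) • ((G.K : ℝ) • G.l₂) + (n : ℝ) • G.l₂ by
      rw [hn', show (b : ℝ) = r + G.K * q - m by linarith]; module]
  simp only [← mul_assoc, ← cis_add]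
  congr 2
  ring

end LatticeData

namespace LatticeData

variable (G : LatticeData)

/-! ### Shifts that preserve the range of the fiber matrix -/

/-- Almost everywhere, the columns of the fiber matrix shifted by `ν` lie in the range of the
unshifted fiber matrix. For the Zak transform of `g` this is a consequence of the membership of
`π(ν) g` in the Gabor space. -/
def PreservesRange (F : ℝ × ℝ → ℂ) (ν : ℝ × ℝ) : Prop :=
  ∀ᵐ ξ, ∃ C : Matrix (Fin G.K) (Fin G.K) ℂ, G.fiber F ν ξ = G.fiber F 0 ξ * C

theorem ae_grid {P : ℝ × ℝ → Prop} (h : ∀ᵐ z, P z) :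
    ∀ᵐ ξ, ∀ j, ∀ m n : ℕ, P (ξ + G.pt j - (m : ℝ) • G.l₁ - (n : ℝ) • G.l₂) := by
  rw [ae_all_iff]; intro j
  rw [ae_all_iff]; intro m
  rw [ae_all_iff]; intro n
  exact ae_comp_add_prod (ae_comp_sub_prod (ae_comp_sub_prod h _) _) _

/-- `fold` of a shift by a multiple of `l₂` is a linear combination of point values, with
coefficients independent of the function. -/
theorem exists_fold_tau_l₂_eq (n : ℕ) (k ξ : ℝ × ℝ) : ∃ c : ℕ → ℂ, ∀ H : ℝ × ℝ → ℂ,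
    G.fold (tau ((n : ℝ) • G.l₂) H) k ξ =
      ∑ m ∈ Finset.range G.K, c m * H (ξ + k - (m : ℝ) • G.l₁ - (n : ℝ) • G.l₂) := by
  refine ⟨fun m => cis (m * symp G.l₁ ξ - (m * (m - 1) / 2 : ℝ) * (G.l₁.1 * G.l₁.2)) *
    cis (((m : ℝ) • G.l₁).2 * (ξ + k).1) *
    cis (((n : ℝ) • G.l₂).2 * (ξ + k - (m : ℝ) • G.l₁).1), fun H => ?_⟩
  rw [fold]
  simp only [tau, ← mul_assoc]

/-- The functions all of whose samples lie in the range of the fiber matrix of `F`. -/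
noncomputable def rangeSubmodule (F : ℝ × ℝ → ℂ) : Submodule ℂ L2R where
  carrier := {f | ∀ᵐ ξ, ∀ n : Fin G.K,
    (fun j => G.fold (tau ((n : ℝ) • G.l₂) (zak f)) (G.pt j) ξ) ∈
      LinearMap.range (G.fiber F 0 ξ).mulVecLin}
  add_mem' := by
    intro f f' hf hf'
    filter_upwards [hf, hf', G.ae_grid (zak_add f f')] with ξ h1 h2 h3 n
    convert add_mem (h1 n) (h2 n) using 1
    funext j
    obtain ⟨c, hc⟩ := G.exists_fold_tau_l₂_eq n (G.pt j) ξ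
    rw [Pi.add_apply, hc, hc, hc, ← Finset.sum_add_distrib]
    exact Finset.sum_congr rfl fun m _ => by rw [h3]; ring
  zero_mem' := by
    filter_upwards [G.ae_grid zak_zero] with ξ h3 n
    convert zero_mem (LinearMap.range (G.fiber F 0 ξ).mulVecLin) using 1
    funext j
    obtain ⟨c, hc⟩ := G.exists_fold_tau_l₂_eq n (G.pt j) ξ
    rw [hc]
    exact Finset.sum_eq_zero fun m _ => by rw [h3, mul_zero]
  smul_mem' := by
    intro a f hf
    filter_upwards [hf, G.ae_grid (zak_smul a f)] with ξ h1 h3 n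
    convert Submodule.smul_mem _ a (h1 n) using 1
    funext j
    obtain ⟨c, hc⟩ := G.exists_fold_tau_l₂_eq n (G.pt j) ξ
    rw [Pi.smul_apply, hc, hc, smul_eq_mul, Finset.mul_sum]
    exact Finset.sum_congr rfl fun m _ => by rw [h3]; ring

theorem mem_rangeSubmodule {F : ℝ × ℝ → ℂ} {f : L2R} : f ∈ G.rangeSubmodule F ↔
    ∀ᵐ ξ, ∀ n : Fin G.K, (fun j => G.fold (tau ((n : ℝ) • G.l₂) (zak f)) (G.pt j) ξ) ∈
      LinearMap.range (G.fiber F 0 ξ).mulVecLin := Iff.rfl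

theorem isClosed_rangeSubmodule (F : ℝ × ℝ → ℂ) : IsClosed (G.rangeSubmodule F : Set L2R) := by
  refine isClosed_of_closure_subset fun f hf => ?_
  obtain ⟨u, hu, hlim⟩ := mem_closure_iff_seq_limit.1 hf
  obtain ⟨ns, -, h1⟩ := exists_subseq_zak_tendsto hlim
  rw [SetLike.mem_coe, mem_rangeSubmodule]
  have h2 := ae_all_iff.2 fun i => (G.mem_rangeSubmodule.1 (hu (ns i)))
  filter_upwards [h2, G.ae_grid h1] with ξ h2 h3 n
  refine (Submodule.closed_of_finiteDimensional _).mem_of_tendsto (b := atTop)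
    (f := fun i j => G.fold (tau ((n : ℝ) • G.l₂) (zak (u (ns i)))) (G.pt j) ξ) ?_
    (Eventually.of_forall fun i => h2 i n)
  refine tendsto_pi_nhds.2 fun j => ?_
  obtain ⟨c, hc⟩ := G.exists_fold_tau_l₂_eq n (G.pt j) ξ
  simp only [hc]
  exact tendsto_finsetSum _ fun m _ => (h3 j m n).const_mul _

variable {F : ℝ × ℝ → ℂ} {g : L2R}

theorem gaborSpace_le (hF : QuasiPeriodic F) (hFg : ∀ᵐ z, F z = zak g z) :
    gaborSpace g G.lattice ≤ G.rangeSubmodule F := by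
  refine Submodule.topologicalClosure_minimal _ (Submodule.span_le.2 ?_)
    (G.isClosed_rangeSubmodule F)
  rintro _ ⟨⟨l, hl⟩, rfl⟩
  rw [SetLike.mem_coe, mem_rangeSubmodule]
  have h : ∀ᵐ z, zak (timeFreqShift l g) z = tau l F z := by
    filter_upwards [zak_timeFreqShift l g, ae_comp_sub_prod hFg l] with z h1 h2
    rw [h1, tau, tau, h2]
  filter_upwards [G.ae_grid h] with ξ hξ n
  obtain ⟨c, n', hc⟩ := exists_fold_tau_lattice (G := G) hF hl n ξ
  refine ⟨Pi.single n' c, ?_⟩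
  funext j
  rw [Matrix.mulVecLin_apply, Matrix.mulVec_single]
  have e : G.fold (tau ((n : ℝ) • G.l₂) (zak (timeFreqShift l g))) (G.pt j) ξ =
      G.fold (tau ((n : ℝ) • G.l₂) (tau l F)) (G.pt j) ξ := by
    obtain ⟨c, hc⟩ := G.exists_fold_tau_l₂_eq n (G.pt j) ξ
    rw [hc, hc]
    exact Finset.sum_congr rfl fun m _ => by rw [hξ]
  rw [e, hc]
  simp [mul_comm]

theorem preservesRange_of_mem (hF : QuasiPeriodic F) (hFg : ∀ᵐ z, F z = zak g z) {ν : ℝ × ℝ}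
    (h : timeFreqShift ν g ∈ gaborSpace g G.lattice) : G.PreservesRange F ν := by
  have h0 : ∀ᵐ z, zak (timeFreqShift ν g) z = tau ν F z := by
    filter_upwards [zak_timeFreqShift ν g, ae_comp_sub_prod hFg ν] with z h1 h2
    rw [h1, tau, tau, h2]
  filter_upwards [G.mem_rangeSubmodule.1 (G.gaborSpace_le hF hFg h), G.ae_grid h0] with ξ h1 h2
  choose w hw using h1
  refine ⟨Matrix.of fun m n => cis (-symp ν ((n : ℝ) • G.l₂)) * w n m, ?_⟩
  ext j n
  have h3 := congrFun (hw n) j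
  have e : G.fold (tau ((n : ℝ) • G.l₂) (zak (timeFreqShift ν g))) (G.pt j) ξ =
      G.fold (tau ((n : ℝ) • G.l₂) (tau ν F)) (G.pt j) ξ := by
    obtain ⟨c, hc⟩ := G.exists_fold_tau_l₂_eq n (G.pt j) ξ
    rw [hc, hc]
    exact Finset.sum_congr rfl fun m _ => by rw [h2]
  rw [Matrix.mulVecLin_apply, e] at h3
  rw [fiber_apply, fold_tau_comm, ← h3, Matrix.mulVec, dotProduct, Finset.mul_sum, Matrix.mul_apply]
  refine Finset.sum_congr rfl fun m _ => ?_
  rw [Matrix.of_apply]; ring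

theorem fiber_l₁ (hF : QuasiPeriodic F) (ξ : ℝ × ℝ) :
    G.fiber F G.l₁ ξ = cis (-symp G.l₁ ξ) • G.fiber F 0 ξ := by
  ext j n
  rw [fiber_apply, fold_tau_l₁ _ (quasiPeriodic_tau hF _), Matrix.smul_apply, fiber_zero_apply,
    smul_eq_mul]

theorem fiber_K_l₂ (hF : QuasiPeriodic F) (ξ : ℝ × ℝ) :
    G.fiber F ((G.K : ℝ) • G.l₂) ξ = cis (-(G.K * symp G.l₂ ξ)) • G.fiber F 0 ξ := by
  ext j n
  have := G.fold_tau_K_l₂ (quasiPeriodic_tau hF ((n : ℝ) • G.l₂)) j 1 ξ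
  simp only [Int.cast_one, one_smul, one_mul] at this
  rw [fiber_apply, this, Matrix.smul_apply, fiber_zero_apply, smul_eq_mul]

theorem preservesRange_smul_l₁ (hF : QuasiPeriodic F) (a : ℤ) :
    G.PreservesRange F ((a : ℝ) • G.l₁) := by
  refine Eventually.of_forall fun ξ => ?_
  choose c hc using fun n : Fin G.K =>
    G.exists_fold_tau_smul_l₁ (quasiPeriodic_tau hF ((n : ℝ) • G.l₂)) a ξ
  refine ⟨Matrix.diagonal c, ?_⟩
  ext j n
  rw [Matrix.mul_diagonal, fiber_apply, hc, fiber_zero_apply, mul_comm]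

theorem preservesRange_smul_K_l₂ (hF : QuasiPeriodic F) (q : ℤ) :
    G.PreservesRange F ((q : ℝ) • ((G.K : ℝ) • G.l₂)) := by
  refine Eventually.of_forall fun ξ =>
    ⟨Matrix.diagonal fun _ => cis (-(q * (G.K * symp G.l₂ ξ))), ?_⟩
  ext j n
  rw [Matrix.mul_diagonal, fiber_apply, G.fold_tau_K_l₂ (quasiPeriodic_tau hF _),
    fiber_zero_apply, mul_comm]

/-! ### Determinants -/

/-- The determinant of `Φᴴ Φ_ν`, where `Φ_ν` is the fiber matrix shifted by `ν` and `Φ = Φ_0`. -/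
noncomputable def fiberDet (F : ℝ × ℝ → ℂ) (ν ξ : ℝ × ℝ) : ℂ :=
  ((G.fiber F 0 ξ).conjTranspose * G.fiber F ν ξ).det

theorem fiberDet_eq {ν ξ : ℝ × ℝ} {C : Matrix (Fin G.K) (Fin G.K) ℂ}
    (h : G.fiber F ν ξ = G.fiber F 0 ξ * C) :
    G.fiberDet F ν ξ = G.fiberDet F 0 ξ * C.det := by
  rw [fiberDet, fiberDet, h, ← Matrix.mul_assoc, Matrix.det_mul]

/-- The determinants are multiplicative along sums of range-preserving shifts, up to the
nonvanishing factor `det Φᴴ Φ` and a constant. -/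
theorem PreservesRange.fiberDet_add {ν ν' : ℝ × ℝ} (h : G.PreservesRange F ν)
    (h' : G.PreservesRange F ν') : ∀ᵐ ξ, G.fiberDet F (ν + ν') ξ * G.fiberDet F 0 (ξ - ν) =
      cis (ν.1 * ν'.2) ^ G.K * (G.fiberDet F ν ξ * G.fiberDet F ν' (ξ - ν)) := by
  filter_upwards [h, ae_comp_sub_prod h' ν] with ξ ⟨C, hC⟩ ⟨C', hC'⟩
  have h1 : G.fiber F (ν + ν') ξ = G.fiber F 0 ξ * (cis (ν.1 * ν'.2) • (C * C')) := by
    rw [fiber_add, hC', ← Matrix.mul_assoc, ← fiber_eq, hC, Matrix.mul_smul, Matrix.mul_assoc]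
  rw [G.fiberDet_eq h1, G.fiberDet_eq hC, G.fiberDet_eq hC', Matrix.det_smul, Matrix.det_mul,
    Fintype.card_fin]
  ring

theorem PreservesRange.add {ν ν' : ℝ × ℝ} (h : G.PreservesRange F ν)
    (h' : G.PreservesRange F ν') : G.PreservesRange F (ν + ν') := by
  filter_upwards [h, ae_comp_sub_prod h' ν] with ξ ⟨C, hC⟩ ⟨C', hC'⟩
  refine ⟨cis (ν.1 * ν'.2) • (C * C'), ?_⟩
  rw [fiber_add, hC', ← Matrix.mul_assoc, ← fiber_eq, hC, Matrix.mul_smul, Matrix.mul_assoc]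

/-- If `Φ_ν = Φ C`, then `|det C|²` relates `det Φᴴ Φ` at `ξ` and at `ξ - ν`; this determines the
modulus of `det Φᴴ Φ_ν`. -/
theorem PreservesRange.norm_sq_fiberDet {ν : ℝ × ℝ} (h : G.PreservesRange F ν) :
    ∀ᵐ ξ, (starRingEnd ℂ) (G.fiberDet F ν ξ) * G.fiberDet F ν ξ =
      (starRingEnd ℂ) (G.fiberDet F 0 ξ) * G.fiberDet F 0 (ξ - ν) := by
  filter_upwards [h] with ξ ⟨C, hC⟩
  have h1 : G.fiberDet F 0 (ξ - ν) = (starRingEnd ℂ) C.det * G.fiberDet F 0 ξ * C.det := by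
    have e1 : (G.fiber F ν ξ).conjTranspose * G.fiber F ν ξ =
        (G.fiber F 0 (ξ - ν)).conjTranspose * G.fiber F 0 (ξ - ν) := by
      rw [fiber_eq, Matrix.conjTranspose_mul, Matrix.mul_assoc,
        ← Matrix.mul_assoc (Matrix.conjTranspose (Matrix.diagonal _)),
        Matrix.diagonal_conjTranspose, Matrix.diagonal_mul_diagonal]
      have : (fun j => star (fun j => cis (ν.2 * (ξ + G.pt j).1)) j * cis (ν.2 * (ξ + G.pt j).1)) =
          fun _ => 1 := by
        funext j
        rw [Pi.star_apply, ← starRingEnd_apply, conj_cis, cis_neg_mul_self]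
      rw [this, Matrix.diagonal_one, Matrix.one_mul]
    have e2 : (G.fiber F ν ξ).conjTranspose * G.fiber F ν ξ =
        C.conjTranspose * ((G.fiber F 0 ξ).conjTranspose * G.fiber F 0 ξ) * C := by
      rw [hC, Matrix.conjTranspose_mul]
      simp only [Matrix.mul_assoc]
    rw [fiberDet, ← e1, e2, Matrix.det_mul, Matrix.det_mul, Matrix.det_conjTranspose]
    rfl
  rw [h1, G.fiberDet_eq hC, map_mul]
  ring

end LatticeData

/-! ### Nondegeneracy, periodicity and regularity of the determinants -/

theorem star_dotProduct_self_eq {m : Type*} [Fintype m] (y : m → ℂ) :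
    star y ⬝ᵥ y = ((∑ j, ‖y j‖ ^ 2 : ℝ) : ℂ) := by
  rw [dotProduct]
  push_cast
  exact Finset.sum_congr rfl fun j _ => by
    rw [Pi.star_apply, ← starRingEnd_apply, Complex.conj_mul']

/-- A lower bound for `M` gives one for the determinant of `Mᴴ M`. -/
theorem exists_det_conjTranspose_mul_self_ge {m n : Type*} [Fintype m] [Fintype n] [DecidableEq n]
    (M : Matrix m n ℂ) {c : ℝ} (hc : 0 ≤ c)
    (h : ∀ w : n → ℂ, c * ∑ i, ‖w i‖ ^ 2 ≤ ∑ j, ‖(M.mulVec w) j‖ ^ 2) :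
    ∃ r : ℝ, c ^ Fintype.card n ≤ r ∧ (M.conjTranspose * M).det = r := by
  have hA : (M.conjTranspose * M).IsHermitian := Matrix.isHermitian_conjTranspose_mul_self M
  refine ⟨∏ i, hA.eigenvalues i, ?_, by rw [hA.det_eq_prod_eigenvalues]; push_cast; rfl⟩
  have hi : ∀ i, c ≤ hA.eigenvalues i := fun i => by
    set x : n → ℂ := ⇑(hA.eigenvectorBasis i) with hx
    have h1 : ∑ j, ‖x j‖ ^ 2 = 1 := by
      rw [← EuclideanSpace.norm_sq_eq, hA.eigenvectorBasis.norm_eq_one, one_pow]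
    have h2 : ((∑ j, ‖(M.mulVec x) j‖ ^ 2 : ℝ) : ℂ) = hA.eigenvalues i := by
      rw [← star_dotProduct_self_eq, Matrix.star_mulVec, ← Matrix.dotProduct_mulVec,
        Matrix.mulVec_mulVec, hA.mulVec_eigenvectorBasis, dotProduct_smul, star_dotProduct_self_eq,
        h1]
      simp
    have h3 := h x
    rw [h1, mul_one, Complex.ofReal_injective h2] at h3
    exact h3
  calc c ^ Fintype.card n = ∏ _i : n, c := by simp
    _ ≤ _ := Finset.prod_le_prod (fun _ _ => hc) fun i _ => hi i

namespace UnifVMO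

theorem shift {H : ℝ × ℝ → ℂ} (hH : UnifVMO fun (_ : Unit) => H) (k : ℝ × ℝ) :
    UnifVMO fun (_ : Unit) z => H (z + k) := by
  simpa using hH.comp_sub (a := fun _ => -k) (r := ‖k‖) (by simp)

theorem tau {H : ℝ × ℝ → ℂ} (hH : UnifVMO fun (_ : Unit) => H) (a : ℝ × ℝ) :
    UnifVMO fun (_ : Unit) => tau a H := by
  refine (cis (l := fun _ z => a.2 * z.1) (L := |a.2|) fun _ z z' => ?_).mul
    (hH.comp_sub (a := fun _ => a) (r := ‖a‖) fun _ => le_rfl)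
  rw [← mul_sub, abs_mul]
  exact mul_le_mul_of_nonneg_left (norm_fst_le (z - z')) (abs_nonneg _)

end UnifVMO

namespace LatticeData

variable (G : LatticeData)

theorem unifVMO_fold {H : ℝ × ℝ → ℂ} (hH : UnifVMO fun (_ : Unit) => H) (k : ℝ × ℝ) :
    UnifVMO fun (_ : Unit) => G.fold H k := by
  refine UnifVMO.sum _ fun m _ => UnifVMO.mul ?_ ((hH.tau _).shift k)
  refine UnifVMO.cis (L := m * (|G.l₁.1| + |G.l₁.2|)) fun _ z z' => ?_
  rw [sub_sub_sub_cancel_right, ← mul_sub, abs_mul, ← symp_sub_right, Nat.abs_cast, mul_assoc]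
  exact mul_le_mul_of_nonneg_left (abs_symp_le _ _) (Nat.cast_nonneg _)

variable {G} {F : ℝ × ℝ → ℂ}

/-- The determinants form a uniform family as the shift ranges over a bounded set. -/
theorem unifVMO_fiberDet (hF : UnifVMO fun (_ : Unit) => F) (r : ℝ) :
    UnifVMO fun ν : {ν : ℝ × ℝ // ‖ν‖ ≤ r} => G.fiberDet F ν := by
  have h0 : ∀ j n, UnifVMO fun (_ : Unit) ξ => G.fiber F 0 ξ j n := fun j n => by
    simp only [fiber_zero_apply]
    exact G.unifVMO_fold (hF.tau _) _
  refine UnifVMO.det fun n n' => ?_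
  simp only [Matrix.mul_apply, Matrix.conjTranspose_apply]
  refine UnifVMO.sum _ fun j _ => UnifVMO.mul ?_ ?_
  · exact ((h0 j n).comp_index fun _ => ()).conj
  · simp only [fiber_eq (F := F) (Subtype.val _), Matrix.diagonal_mul]
    refine UnifVMO.mul (UnifVMO.cis (L := r) fun ν z z' => ?_)
      (((h0 j n').comp_index fun _ => ()).comp_sub (r := r) fun ν => ν.2)
    rw [← mul_sub, abs_mul]
    have h1 : |(z - z').1| ≤ ‖z - z'‖ := norm_fst_le (z - z')
    have h2 : |ν.1.2| ≤ r := (norm_snd_le ν.1).trans ν.2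
    rw [show (z + G.pt j).1 - (z' + G.pt j).1 = (z - z').1 by simp]
    exact mul_le_mul h2 h1 (abs_nonneg _) ((abs_nonneg _).trans h2)

/-- The Gram matrix of the samples is invariant under those points of the dual lattice at which
the phases in `fold` are trivial: the grid points are merely permuted, modulo `ℤ²`. -/
theorem sum_conj_fold_mul_fold {H H' : ℝ × ℝ → ℂ} (hH : QuasiPeriodic H) (hH' : QuasiPeriodic H')
    {a b n : ℤ} (hn : symp G.l₁ ((a : ℝ) • G.d₁ + (b : ℝ) • G.d₂) = n) (ξ : ℝ × ℝ) :
    ∑ j, (starRingEnd ℂ) (G.fold H (G.pt j) (ξ + ((a : ℝ) • G.d₁ + (b : ℝ) • G.d₂))) *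
      G.fold H' (G.pt j) (ξ + ((a : ℝ) • G.d₁ + (b : ℝ) • G.d₂)) =
    ∑ j, (starRingEnd ℂ) (G.fold H (G.pt j) ξ) * G.fold H' (G.pt j) ξ := by
  simp only [fold, map_sum, Finset.sum_mul_sum]
  rw [Finset.sum_comm, Finset.sum_comm (s := Finset.univ)]
  refine Finset.sum_congr rfl fun m _ => ?_
  rw [Finset.sum_comm, Finset.sum_comm (s := Finset.univ)]
  refine Finset.sum_congr rfl fun m' _ => ?_
  simp only [map_mul, mul_mul_mul_comm]
  rw [← Finset.mul_sum, ← Finset.mul_sum]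
  have hc : ∀ k : ℕ, cis (k * symp G.l₁ (ξ + ((a : ℝ) • G.d₁ + (b : ℝ) • G.d₂)) -
      (k * (k - 1) / 2 : ℝ) * (G.l₁.1 * G.l₁.2)) =
      cis (k * symp G.l₁ ξ - (k * (k - 1) / 2 : ℝ) * (G.l₁.1 * G.l₁.2)) := fun k => by
    refine cis_congr (k * n) ?_
    rw [symp_add_right, hn]
    push_cast
    ring
  rw [hc, hc, G.sum_pt_add (H := fun z => (starRingEnd ℂ) (tau ((m : ℝ) • G.l₁) H z) *
    tau ((m' : ℝ) • G.l₁) H' z) fun z a ha =>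
      (quasiPeriodic_tau hH _).conj_mul (quasiPeriodic_tau hH' _) ha z]

theorem fiberDet_add_of_symp (hF : QuasiPeriodic F) (ν : ℝ × ℝ) {a b n : ℤ}
    (hn : symp G.l₁ ((a : ℝ) • G.d₁ + (b : ℝ) • G.d₂) = n) (ξ : ℝ × ℝ) :
    G.fiberDet F ν (ξ + ((a : ℝ) • G.d₁ + (b : ℝ) • G.d₂)) = G.fiberDet F ν ξ := by
  rw [fiberDet, fiberDet]
  congr 1
  ext k l
  simp only [Matrix.mul_apply, Matrix.conjTranspose_apply, fiber_zero_apply]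
  exact sum_conj_fold_mul_fold (quasiPeriodic_tau hF _)
    (quasiPeriodic_tau (quasiPeriodic_tau hF _) _) hn ξ

theorem fiberDet_add_d₂ (hF : QuasiPeriodic F) (ν ξ : ℝ × ℝ) :
    G.fiberDet F ν (ξ + G.d₂) = G.fiberDet F ν ξ := by
  have := fiberDet_add_of_symp (G := G) hF ν (a := 0) (b := 1) (n := 0)
    (by simp [G.symp₁₂]) ξ
  simpa using this

variable (G) in
/-- The properties of a bounded representative of the Zak transform of `g`, where the Gabor system
of `g` is a Riesz sequence and the Zak transform is in `VMO_loc`. -/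
structure IsSymbol (F : ℝ × ℝ → ℂ) : Prop where
  quasi : QuasiPeriodic F
  vmo : UnifVMO fun (_ : Unit) => F
  low : ∃ δ : ℝ, 0 < δ ∧ ∀ᵐ ξ, ∃ r : ℝ, δ ≤ r ∧ G.fiberDet F 0 ξ = r

theorem fiber_mulVec (ξ : ℝ × ℝ) (w : Fin G.K → ℂ) (j) : (G.fiber F 0 ξ).mulVec w j =
    ∑ p : Fin G.K × Fin G.K, (cis ((p.1 : ℕ) * symp G.l₁ ξ -
      ((p.1 : ℕ) * ((p.1 : ℕ) - 1) / 2 : ℝ) * (G.l₁.1 * G.l₁.2)) * w p.2) *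
        G.shifts F p (ξ + G.pt j) := by
  rw [Fintype.sum_prod_type_right, Matrix.mulVec, dotProduct]
  refine Finset.sum_congr rfl fun n _ => ?_
  rw [fiber_zero_apply, fold, Finset.sum_mul, Finset.sum_range]
  refine Finset.sum_congr rfl fun m _ => ?_
  rw [shifts]
  ring

/-- The upper Riesz bound makes `zak g` essentially bounded, so that setting it to zero where it
exceeds the bound gives a representative that is bounded everywhere and still quasi-periodic. -/
theorem exists_isSymbol (g : L2R) (hR : IsRieszBasis (gaborFamily g G.lattice))
    (hV : IsVMOLoc (zak g)) : ∃ F, G.IsSymbol F ∧ ∀ᵐ z, F z = zak g z := by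
  obtain ⟨α, β, hα, hae⟩ := G.exists_ae_bounds g hR
  have := NeZero.of_pos G.K_pos
  have hbd : ∀ᵐ z, ‖zak g z‖ ≤ √β := by
    filter_upwards [hae] with z hz
    have h1 := (hz (Pi.single 0 1)).2
    have h2 : ∀ w, ∑ p, (Pi.single 0 1 : Fin G.K × Fin G.K → ℂ) p * G.shifts (zak g) p w =
        zak g w := fun w => by
      rw [Finset.sum_eq_single 0 (fun p _ hp => by simp [hp]) (by simp)]
      simp [shifts, tau_zero]
    have h3 : ∑ p, ‖(Pi.single 0 1 : Fin G.K × Fin G.K → ℂ) p‖ ^ 2 = 1 := by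
      rw [Finset.sum_eq_single 0 (fun p _ hp => by simp [hp]) (by simp)]
      simp
    simp only [h2, h3, mul_one] at h1
    refine Real.le_sqrt_of_sq_le (le_trans ?_ h1)
    have h4 := Finset.single_le_sum (f := fun j => ‖zak g (z + G.pt j)‖ ^ 2)
      (fun j _ => by positivity) (Finset.mem_univ 0)
    simpa [pt] using h4
  set F : ℝ × ℝ → ℂ := {z | ‖zak g z‖ ≤ √β}.indicator (zak g) with hFdef
  have hF1 : ∀ᵐ z, zak g z = F z := by
    filter_upwards [hbd] with z hz
    rw [hFdef, indicator_of_mem (by exact hz)]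
  have hm : Measurable F := (measurable_zak g).indicator
    (measurableSet_le (measurable_zak g).norm measurable_const)
  have hb : ∀ z, ‖F z‖ ≤ √β := fun z => by
    by_cases hz : ‖zak g z‖ ≤ √β
    · rw [hFdef, indicator_of_mem (by exact hz)]; exact hz
    · rw [hFdef, indicator_of_notMem (by exact hz), norm_zero]; exact Real.sqrt_nonneg _
  refine ⟨F, ⟨fun z m n => ?_, unifVMO_of_isVMOLoc hV hm hb hF1, α ^ G.K, by positivity, ?_⟩,
    hF1.mono fun z hz => hz.symm⟩
  · have h1 : ‖zak g (z + ((m : ℝ), (n : ℝ)))‖ = ‖zak g z‖ :=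
      (quasiPeriodic_zak g).norm_add ⟨m, n, rfl⟩ z
    by_cases hz : ‖zak g z‖ ≤ √β
    · rw [hFdef, indicator_of_mem (by exact hz : z ∈ {z | ‖zak g z‖ ≤ √β}),
        indicator_of_mem (by exact h1.trans_le hz), quasiPeriodic_zak]
    · rw [hFdef, indicator_of_notMem (by exact hz : z ∉ {z | ‖zak g z‖ ≤ √β}),
        indicator_of_notMem (by exact fun h => hz (h1.symm.trans_le h)), mul_zero]
  · filter_upwards [hae, G.ae_grid hF1] with ξ h1 h2
    have h3 := exists_det_conjTranspose_mul_self_ge (G.fiber F 0 ξ) hα.le fun w => ?_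
    · rwa [Fintype.card_fin] at h3
    simp only [fiber_mulVec]
    have h4 : ∀ j p, G.shifts F p (ξ + G.pt j) = G.shifts (zak g) p (ξ + G.pt j) := fun j p => by
      simp only [shifts, tau]
      rw [h2]
    simp only [h4]
    refine le_trans (mul_le_mul_of_nonneg_left ?_ hα.le) (h1 _).1
    simp only [norm_mul, norm_cis, one_mul]
    rw [Fintype.sum_prod_type]
    dsimp only
    rw [Finset.sum_const, nsmul_eq_mul, Finset.card_univ, Fintype.card_fin]
    exact le_mul_of_one_le_left (by positivity) (by exact_mod_cast G.K_pos)

end LatticeData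

/-! ### Winding numbers of the averaged determinants -/

namespace LatticeData

variable {G : LatticeData} {F : ℝ × ℝ → ℂ}

theorem oscOf_fiberDet_add (hF : QuasiPeriodic F) (ν ξ : ℝ × ℝ) (ε : ℝ) (a b : ℤ) :
    oscOf (unifSq (ξ + (((a * G.K : ℤ) : ℝ) • G.d₁ + (b : ℝ) • G.d₂)) ε) (G.fiberDet F ν) =
      oscOf (unifSq ξ ε) (G.fiberDet F ν) := by
  refine oscOf_periodic (fun z => fiberDet_add_of_symp hF ν (n := a) ?_ z) ε ξ
  have := G.symp₁₁
  rw [symp_add_right, symp_smul_right, symp_smul_right, G.symp₁₂]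
  push_cast
  linear_combination (a : ℝ) * this

/-- By periodicity, the oscillation of the determinants is uniformly small on all small squares. -/
theorem IsSymbol.exists_oscOf_le (hS : G.IsSymbol F) (r : ℝ) {η : ℝ} (hη : 0 < η) :
    ∃ ε₀ > 0, ∀ ν, ‖ν‖ ≤ r → ∀ ξ ε, 0 < ε → ε < ε₀ →
      oscOf (unifSq ξ ε) (G.fiberDet F ν) ≤ η := by
  obtain ⟨ε₀, h0, h1⟩ := (unifVMO_fiberDet (G := G) hS.vmo r).vmo (G.K * ‖G.d₁‖ + ‖G.d₂‖) η hη
  refine ⟨ε₀, h0, fun ν hν ξ ε hε hε' => ?_⟩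
  have hK : (0 : ℝ) < G.K := Nat.cast_pos.2 G.K_pos
  set x := G.θ₁ ξ / G.K with hx
  set y := G.θ₂ ξ with hy
  have hξ : ξ = (G.K * Int.fract x) • G.d₁ + Int.fract y • G.d₂ +
      (((⌊x⌋ * G.K : ℤ) : ℝ) • G.d₁ + (⌊y⌋ : ℝ) • G.d₂) := by
    conv_lhs => rw [G.eq_θ_smul ξ]
    have e1 : G.θ₁ ξ = G.K * x := by rw [hx]; field_simp
    rw [e1, ← hy]
    have e2 := Int.fract_add_floor x
    have e3 := Int.fract_add_floor y
    push_cast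
    conv_lhs => rw [← e2, ← e3]
    module
  rw [hξ, oscOf_fiberDet_add hS.quasi]
  refine h1 ⟨ν, hν⟩ _ ((norm_add_le _ _).trans (add_le_add ?_ ?_)) ε hε hε'
  · rw [norm_smul, Real.norm_eq_abs, abs_of_nonneg (by positivity)]
    refine mul_le_mul_of_nonneg_right ?_ (norm_nonneg _)
    exact mul_le_of_le_one_right hK.le (Int.fract_lt_one x).le
  · rw [norm_smul, Real.norm_eq_abs, abs_of_nonneg (Int.fract_nonneg _)]
    exact mul_le_of_le_one_left (norm_nonneg _) (Int.fract_lt_one y).le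

variable (G F) in
/-- A scale `ε` at which the averages of the determinants with shifts bounded by `r` are reliable:
`A` bounds the determinants, `δ` bounds the unshifted one from below, and `η` bounds their
oscillation. The last condition makes functions `cis ∘ l`, where `l` is Lipschitz with constant `L`,
nearly constant on squares of side length `ε`. -/
structure IsScale (r A δ η L ε : ℝ) : Prop where
  ε_pos : 0 < ε
  δ_pos : 0 < δ
  bdd : ∀ ν, ‖ν‖ ≤ r → ∀ z, ‖G.fiberDet F ν z‖ ≤ A
  osc : ∀ ν, ‖ν‖ ≤ r → ∀ ξ, oscOf (unifSq ξ ε) (G.fiberDet F ν) ≤ η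
  low : ∀ᵐ ξ, ∃ r : ℝ, δ ≤ r ∧ G.fiberDet F 0 ξ = r
  η_le : η ≤ δ / 2
  A_mul_η : A * η + A * η < δ / 2 * (δ / 2)
  lip : 2 * Real.pi * (L * ε) * A < δ / 2

theorem IsSymbol.exists_isScale (hS : G.IsSymbol F) (r L : ℝ) :
    ∃ A δ η ε, G.IsScale F r A δ η L ε := by
  obtain ⟨A, hA⟩ := (unifVMO_fiberDet (G := G) hS.vmo r).bdd
  obtain ⟨δ, hδ, hlow⟩ := hS.low
  set B := |A| + 1 with hB
  have hB0 : 0 < B := by positivity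
  set η := min (δ / 2) (δ / 2 * (δ / 2) / (4 * B)) with hη
  have hη0 : 0 < η := by positivity
  obtain ⟨ε₀, h0, hosc⟩ := hS.exists_oscOf_le r hη0
  set M := 2 * Real.pi * (|L| + 1) * B with hM
  have hM0 : 0 < M := by have := Real.pi_pos; positivity
  set ε := min (ε₀ / 2) (δ / 4 / M) with hε
  have hε0 : 0 < ε := by positivity
  -- `B`, `|L| + 1` replace `A`, `L`, which might be zero; with these, `η` and `ε` are chosen so
  -- that `2 B η` and `2 π (|L| + 1) ε B` are small compared with `δ²` and `δ`
  refine ⟨B, δ, η, ε, hε0, hδ, fun ν hν z => ?_, fun ν hν ξ => ?_, hlow, min_le_left _ _, ?_, ?_⟩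
  · exact (hA ⟨ν, hν⟩ z).trans ((le_abs_self A).trans (by linarith))
  · exact hosc ν hν ξ ε hε0 ((min_le_left _ _).trans_lt (by linarith))
  · have h1 : η ≤ δ / 2 * (δ / 2) / (4 * B) := min_le_right _ _
    rw [le_div_iff₀ (by positivity)] at h1
    nlinarith [mul_pos hδ hδ]
  · have h1 : ε ≤ δ / 4 / M := min_le_right _ _
    rw [le_div_iff₀ hM0] at h1
    calc 2 * Real.pi * (L * ε) * B ≤ 2 * Real.pi * ((|L| + 1) * ε) * B := by
          have := Real.pi_pos
          have := le_abs_self L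
          gcongr
          linarith
      _ = ε * M := by rw [hM]; ring
      _ < δ / 2 := by linarith

theorem IsSymbol.measurable_fiberDet (hS : G.IsSymbol F) (ν : ℝ × ℝ) :
    Measurable (G.fiberDet F ν) :=
  (unifVMO_fiberDet (G := G) hS.vmo ‖ν‖).meas ⟨ν, le_rfl⟩

theorem IsSymbol.avg_fiberDet_add_d₂ (hS : G.IsSymbol F) (ε : ℝ) (ν ξ : ℝ × ℝ) :
    avg ε (G.fiberDet F ν) (ξ + G.d₂) = avg ε (G.fiberDet F ν) ξ :=
  avg_periodic (fiberDet_add_d₂ hS.quasi ν) ε ξ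

namespace IsScale

variable {r A δ η L ε : ℝ} {ν ν' : ℝ × ℝ}

theorem le_norm_avg (h : G.IsScale F r A δ η L ε) (hS : G.IsSymbol F) (hν : ‖ν‖ ≤ r)
    (hp : G.PreservesRange F ν) (ξ : ℝ × ℝ) : δ / 2 ≤ ‖avg ε (G.fiberDet F ν) ξ‖ := by
  have := isProbabilityMeasure_unifSq ξ h.ε_pos
  have h1 : ∀ᵐ z, δ ≤ ‖G.fiberDet F ν z‖ := by
    filter_upwards [PreservesRange.norm_sq_fiberDet G hp, h.low, ae_comp_sub_prod h.low ν]
      with z h1 ⟨s, hs, hs'⟩ ⟨t, ht, ht'⟩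
    rw [Complex.conj_mul', hs', ht', Complex.conj_ofReal] at h1
    have h2 : ‖G.fiberDet F ν z‖ ^ 2 = s * t := by exact_mod_cast h1
    refine le_of_sq_le_sq ?_ (norm_nonneg _)
    rw [h2, sq]
    exact mul_le_mul hs ht h.δ_pos.le (h.δ_pos.le.trans hs)
  have h2 := le_norm_integral_add_oscOf
    (integrable_of_bdd (P := unifSq ξ ε) (hS.measurable_fiberDet ν) (h.bdd ν hν))
    (ae_unifSq h1 ξ ε)
  have h3 := h.osc ν hν ξ
  have h4 := h.η_le
  change δ / 2 ≤ ‖∫ z, G.fiberDet F ν z ∂(unifSq ξ ε)‖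
  linarith

theorem continuous_avg_fiberDet (h : G.IsScale F r A δ η L ε) (hS : G.IsSymbol F)
    (hν : ‖ν‖ ≤ r) : Continuous (avg ε (G.fiberDet F ν)) :=
  continuous_avg (hS.measurable_fiberDet ν) (h.bdd ν hν) h.ε_pos

theorem exists_hasWinding (h : G.IsScale F r A δ η L ε) (hS : G.IsSymbol F) (hν : ‖ν‖ ≤ r)
    (hp : G.PreservesRange F ν) : ∃ w, HasWinding G.d₂ (avg ε (G.fiberDet F ν)) w :=
  HasWinding.exists_of_continuous (h.continuous_avg_fiberDet hS hν)
    (fun z h0 => by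
      have := h.le_norm_avg hS hν hp z
      rw [h0, norm_zero] at this
      linarith [h.δ_pos])
    (hS.avg_fiberDet_add_d₂ ε ν)

/-- The winding numbers are bounded uniformly in the shift. -/
theorem exists_abs_winding_le (h : G.IsScale F r A δ η L ε) (hS : G.IsSymbol F) :
    ∃ N : ℕ, ∀ ν w, ‖ν‖ ≤ r → G.PreservesRange F ν →
      HasWinding G.d₂ (avg ε (G.fiberDet F ν)) w → |(w : ℝ)| ≤ N := by
  obtain ⟨N, hN⟩ := exists_nat_gt (4 * A / ε * ‖G.d₂‖ / (δ / 2))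
  have hδ := h.δ_pos
  refine ⟨N, fun ν w hν hp hw => ?_⟩
  have hA : 0 ≤ A := (norm_nonneg _).trans (h.bdd ν hν 0)
  refine hw.abs_le_of_lipschitz (δ := δ / 2) (L := 4 * A / ε) (by positivity)
    (div_nonneg (by positivity) h.ε_pos.le) (h.le_norm_avg hS hν hp)
    (norm_avg_sub_avg_le (hS.measurable_fiberDet ν) (h.bdd ν hν) h.ε_pos) ?_
  rwa [div_lt_iff₀ (by positivity)] at hN

theorem hasWinding_zero (h : G.IsScale F r A δ η L ε) (hS : G.IsSymbol F) (hr : 0 ≤ r) :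
    HasWinding G.d₂ (avg ε (G.fiberDet F 0)) 0 := by
  have h0 : ‖(0 : ℝ × ℝ)‖ ≤ r := by simpa using hr
  refine HasWinding.of_re_pos (h.continuous_avg_fiberDet hS h0)
    (hS.avg_fiberDet_add_d₂ ε 0) fun ξ => ?_
  have := isProbabilityMeasure_unifSq ξ h.ε_pos
  have hi := integrable_of_bdd (P := unifSq ξ ε) (hS.measurable_fiberDet 0) (h.bdd 0 h0)
  have h1 : (avg ε (G.fiberDet F 0) ξ).re = ∫ z, (G.fiberDet F 0 z).re ∂(unifSq ξ ε) :=
    (Complex.reCLM.integral_comp_comm hi).symm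
  have h2 : ∫ _z, δ ∂(unifSq ξ ε) ≤ ∫ z, (G.fiberDet F 0 z).re ∂(unifSq ξ ε) := by
    refine integral_mono_ae (integrable_const _) hi.re ?_
    filter_upwards [ae_unifSq h.low ξ ε] with z ⟨s, hs, hs'⟩
    rw [hs']
    exact hs
  rw [h1]
  refine h.δ_pos.trans_le ?_
  simpa using h2

/-- Winding numbers are additive in the shift: by small oscillation the averages inherit the
multiplicativity of the determinants up to an error smaller than their product. -/
theorem winding_add (h : G.IsScale F r A δ η L ε) (hS : G.IsSymbol F) (hν : ‖ν‖ ≤ r)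
    (hν' : ‖ν'‖ ≤ r) (hνν' : ‖ν + ν'‖ ≤ r) (hp : G.PreservesRange F ν)
    (hp' : G.PreservesRange F ν') {w w' : ℤ}
    (hw : HasWinding G.d₂ (avg ε (G.fiberDet F ν)) w)
    (hw' : HasWinding G.d₂ (avg ε (G.fiberDet F ν')) w') :
    HasWinding G.d₂ (avg ε (G.fiberDet F (ν + ν'))) (w + w') := by
  have hr : 0 ≤ r := (norm_nonneg _).trans hν
  have hr0 : ‖(0 : ℝ × ℝ)‖ ≤ r := by simpa using hr
  have hA : 0 ≤ A := (norm_nonneg _).trans (h.bdd ν hν 0)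
  obtain ⟨w₁, hw₁⟩ := h.exists_hasWinding hS hνν' (PreservesRange.add G hp hp')
  set c := cis (ν.1 * ν'.2) ^ G.K with hc
  have hc1 : ‖c‖ = 1 := by simp [hc]
  have hc0 : c ≠ 0 := norm_ne_zero_iff.1 (by rw [hc1]; exact one_ne_zero)
  have hf : HasWinding G.d₂ (fun ξ => c * (avg ε (G.fiberDet F ν) ξ *
      avg ε (G.fiberDet F ν') (ξ - ν))) (0 + (w + w')) :=
    (HasWinding.const hc0).mul (hw.mul (hw'.comp_sub ν))
  have hg : HasWinding G.d₂ (fun ξ => avg ε (G.fiberDet F (ν + ν')) ξ *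
      avg ε (G.fiberDet F 0) (ξ - ν)) (w₁ + 0) :=
    hw₁.mul ((h.hasWinding_zero hS hr).comp_sub ν)
  have key : ∀ ξ, ‖avg ε (G.fiberDet F (ν + ν')) ξ * avg ε (G.fiberDet F 0) (ξ - ν) -
      c * (avg ε (G.fiberDet F ν) ξ * avg ε (G.fiberDet F ν') (ξ - ν))‖ ≤ A * η + A * η := by
    intro ξ
    have := isProbabilityMeasure_unifSq ξ h.ε_pos
    have hmeas : ∀ ν', Measurable fun z => G.fiberDet F ν' (z - ν) := fun ν' =>
      (hS.measurable_fiberDet ν').comp (measurable_id.sub_const ν)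
    have h1 := norm_integral_mul_sub_le (P := unifSq ξ ε) (hS.measurable_fiberDet (ν + ν'))
      (hmeas 0) (h.bdd _ hνν') (fun z => h.bdd 0 hr0 (z - ν))
    have h2 := norm_integral_mul_sub_le (P := unifSq ξ ε) (hS.measurable_fiberDet ν)
      (hmeas ν') (h.bdd _ hν) (fun z => h.bdd ν' hν' (z - ν))
    rw [oscOf_unifSq_comp_sub] at h1 h2
    have e : ∀ ν', ∫ z, G.fiberDet F ν' (z - ν) ∂(unifSq ξ ε) = avg ε (G.fiberDet F ν') (ξ - ν) :=
      fun ν' => avg_comp_sub _ _ _ _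
    rw [e] at h1 h2
    have h3 : ∫ z, G.fiberDet F (ν + ν') z * G.fiberDet F 0 (z - ν) ∂(unifSq ξ ε) =
        c * ∫ z, G.fiberDet F ν z * G.fiberDet F ν' (z - ν) ∂(unifSq ξ ε) := by
      rw [← integral_const_mul]
      exact integral_congr_ae (ae_unifSq (PreservesRange.fiberDet_add G hp hp') ξ ε)
    rw [h3] at h1
    set I := ∫ z, G.fiberDet F ν z * G.fiberDet F ν' (z - ν) ∂(unifSq ξ ε)
    change ‖c * I - avg ε (G.fiberDet F (ν + ν')) ξ * avg ε (G.fiberDet F 0) (ξ - ν)‖ ≤ _ at h1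
    change ‖I - avg ε (G.fiberDet F ν) ξ * avg ε (G.fiberDet F ν') (ξ - ν)‖ ≤ _ at h2
    calc _ = ‖c * (I - avg ε (G.fiberDet F ν) ξ * avg ε (G.fiberDet F ν') (ξ - ν)) -
          (c * I - avg ε (G.fiberDet F (ν + ν')) ξ * avg ε (G.fiberDet F 0) (ξ - ν))‖ := by
          congr 1; ring
      _ ≤ ‖c * (I - avg ε (G.fiberDet F ν) ξ * avg ε (G.fiberDet F ν') (ξ - ν))‖ +
          ‖c * I - avg ε (G.fiberDet F (ν + ν')) ξ * avg ε (G.fiberDet F 0) (ξ - ν)‖ :=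
          norm_sub_le _ _
      _ ≤ A * η + A * η := by
          rw [norm_mul, hc1, one_mul]
          exact add_le_add (h2.trans (mul_le_mul_of_nonneg_left (h.osc _ hν' _) hA))
            (h1.trans (mul_le_mul_of_nonneg_left (h.osc _ hr0 _) hA))
  have hfg := hf.of_close hg.continuous hg.periodic fun ξ => by
    refine (key ξ).trans_lt (h.A_mul_η.trans_le ?_)
    rw [norm_mul, norm_mul, hc1, one_mul]
    exact mul_le_mul (h.le_norm_avg hS hν hp _) (h.le_norm_avg hS hν' hp' _)
      (by linarith [h.δ_pos]) (norm_nonneg _)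
  have := hfg.unique hg
  rw [show w + w' = w₁ by omega]
  exact hw₁

/-- For a determinant that is a character times `det Φᴴ Φ`, the winding number is that of the
character. -/
theorem hasWinding_of_cis (h : G.IsScale F r A δ η L ε) (hS : G.IsSymbol F) (hν : ‖ν‖ ≤ r)
    {l : ℝ × ℝ → ℝ} (hl : Continuous l) (hL : ∀ z z', |l z - l z'| ≤ L * ‖z - z'‖) (hL0 : 0 ≤ L)
    (hlν : ∀ z, G.fiberDet F ν z = cis (l z) * G.fiberDet F 0 z) {w : ℤ}
    (hw : ∀ z, l (z + G.d₂) = l z + w) :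
    HasWinding G.d₂ (avg ε (G.fiberDet F ν)) w := by
  have hr : 0 ≤ r := (norm_nonneg _).trans hν
  have hr0 : ‖(0 : ℝ × ℝ)‖ ≤ r := by simpa using hr
  have hA : 0 ≤ A := (norm_nonneg _).trans (h.bdd ν hν 0)
  have hf : HasWinding G.d₂ (fun ξ => cis (l ξ) * avg ε (G.fiberDet F 0) ξ) (w + 0) :=
    (HasWinding.of_cis hl hw).mul (h.hasWinding_zero hS hr)
  rw [add_zero] at hf
  refine hf.of_close (h.continuous_avg_fiberDet hS hν) (hS.avg_fiberDet_add_d₂ ε ν) fun ξ => ?_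
  have := isProbabilityMeasure_unifSq ξ h.ε_pos
  have hi : ∀ ν, ‖ν‖ ≤ r → Integrable (G.fiberDet F ν) (unifSq ξ ε) := fun ν hν =>
    integrable_of_bdd (hS.measurable_fiberDet ν) (h.bdd ν hν)
  have e : avg ε (G.fiberDet F ν) ξ - cis (l ξ) * avg ε (G.fiberDet F 0) ξ =
      ∫ z, (cis (l z) - cis (l ξ)) * G.fiberDet F 0 z ∂(unifSq ξ ε) := by
    rw [avg, avg, ← integral_const_mul, ← integral_sub (hi ν hν) ((hi 0 hr0).const_mul _)]
    refine integral_congr_ae (Eventually.of_forall fun z => ?_)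
    dsimp only
    rw [hlν, sub_mul]
  have h0 : G.PreservesRange F 0 := Eventually.of_forall fun ξ => ⟨1, by simp⟩
  rw [norm_mul, norm_cis, one_mul]
  refine lt_of_lt_of_le ?_ (h.le_norm_avg hS hr0 h0 ξ)
  refine lt_of_le_of_lt ?_ h.lip
  rw [e]
  have := norm_integral_le_of_norm_le_const (μ := unifSq ξ ε)
    (f := fun z => (cis (l z) - cis (l ξ)) * G.fiberDet F 0 z)
    (C := 2 * Real.pi * (L * ε) * A) ?_
  · simpa using this
  filter_upwards [ae_unifSq_norm_sub_le ξ ε] with z hz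
  rw [norm_mul]
  have hpi := Real.pi_pos
  have h1 : |l z - l ξ| ≤ L * ε := (hL z ξ).trans (mul_le_mul_of_nonneg_left hz hL0)
  refine mul_le_mul ((norm_cis_sub_cis_le _ _).trans ?_) (h.bdd 0 hr0 z) (norm_nonneg _)
    (mul_nonneg (by positivity) (mul_nonneg hL0 h.ε_pos.le))
  gcongr

end IsScale

theorem fiberDet_l₁ (hF : QuasiPeriodic F) (z : ℝ × ℝ) :
    G.fiberDet F G.l₁ z = cis (G.K * -symp G.l₁ z) * G.fiberDet F 0 z := by
  rw [fiberDet, fiberDet, G.fiber_l₁ hF, Matrix.mul_smul, Matrix.det_smul, Fintype.card_fin,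
    cis_nat_mul]

theorem fiberDet_K_l₂ (hF : QuasiPeriodic F) (z : ℝ × ℝ) : G.fiberDet F ((G.K : ℝ) • G.l₂) z =
    cis (G.K * -(G.K * symp G.l₂ z)) * G.fiberDet F 0 z := by
  rw [fiberDet, fiberDet, G.fiber_K_l₂ hF, Matrix.mul_smul, Matrix.det_smul, Fintype.card_fin,
    cis_nat_mul]

/-- The winding numbers along `d₂` of the averaged determinants, at a scale that suits all
range-preserving shifts of norm at most `r`. The values at `l₁` and `K l₂` come from the explicit
characters by which these shifts act. -/
theorem IsSymbol.exists_winding (hS : G.IsSymbol F) {r : ℝ} (h₁ : ‖G.l₁‖ ≤ r)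
    (h₂ : ‖(G.K : ℝ) • G.l₂‖ ≤ r) : ∃ (ω : ℝ × ℝ → ℤ) (N : ℕ),
      (∀ ν, ‖ν‖ ≤ r → G.PreservesRange F ν → |(ω ν : ℝ)| ≤ N) ∧
      (∀ ν ν', ‖ν‖ ≤ r → ‖ν'‖ ≤ r → ‖ν + ν'‖ ≤ r → G.PreservesRange F ν →
        G.PreservesRange F ν' → ω (ν + ν') = ω ν + ω ν') ∧
      ω G.l₁ = 0 ∧ ω ((G.K : ℝ) • G.l₂) = -G.K := by
  set L₁ : ℝ := G.K * (|G.l₁.1| + |G.l₁.2|) with hL₁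
  set L₂ : ℝ := G.K * (G.K * (|G.l₂.1| + |G.l₂.2|)) with hL₂
  have hL₁0 : 0 ≤ L₁ := by positivity
  have hL₂0 : 0 ≤ L₂ := by positivity
  obtain ⟨A, δ, η, ε, h⟩ := hS.exists_isScale r (L₁ + L₂)
  obtain ⟨N, hN⟩ := h.exists_abs_winding_le hS
  choose ω hω using fun ν : {ν : ℝ × ℝ // ‖ν‖ ≤ r ∧ G.PreservesRange F ν} =>
    h.exists_hasWinding hS ν.2.1 ν.2.2
  classical
  set ω' : ℝ × ℝ → ℤ := fun ν => if hν : ‖ν‖ ≤ r ∧ G.PreservesRange F ν then ω ⟨ν, hν⟩ else 0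
    with hω'
  have hW : ∀ ν, ‖ν‖ ≤ r → G.PreservesRange F ν →
      HasWinding G.d₂ (avg ε (G.fiberDet F ν)) (ω' ν) := fun ν hν hp => by
    rw [hω']
    simp only [dif_pos (And.intro hν hp)]
    exact hω ⟨ν, hν, hp⟩
  have hp₁ : G.PreservesRange F G.l₁ := by simpa using G.preservesRange_smul_l₁ hS.quasi 1
  have hp₂ : G.PreservesRange F ((G.K : ℝ) • G.l₂) := by
    simpa using G.preservesRange_smul_K_l₂ hS.quasi 1
  refine ⟨ω', N, fun ν hν hp => hN ν _ hν hp (hW ν hν hp),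
    fun ν ν' hν hν' hνν' hp hp' => ?_, ?_, ?_⟩
  · exact (hW _ hνν' (PreservesRange.add G hp hp')).unique
      (h.winding_add hS hν hν' hνν' hp hp' (hW ν hν hp) (hW ν' hν' hp'))
  · refine (hW _ h₁ hp₁).unique (h.hasWinding_of_cis hS h₁ (l := fun z => G.K * -symp G.l₁ z)
      (continuous_const.mul (continuous_symp _).neg) (fun z z' => ?_) (by positivity)
      (fiberDet_l₁ hS.quasi) fun z => ?_)
    · rw [← mul_sub, neg_sub_neg, ← symp_sub_right, abs_mul, Nat.abs_cast, norm_sub_rev]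
      have := abs_symp_le G.l₁ (z' - z)
      calc _ ≤ G.K * ((|G.l₁.1| + |G.l₁.2|) * ‖z' - z‖) := by gcongr
        _ = L₁ * ‖z' - z‖ := by rw [hL₁]; ring
        _ ≤ _ := mul_le_mul_of_nonneg_right (by linarith) (norm_nonneg _)
    · rw [symp_add_right, G.symp₁₂]; simp
  · refine (hW _ h₂ hp₂).unique (h.hasWinding_of_cis hS h₂
      (l := fun z => G.K * -(G.K * symp G.l₂ z))
      (continuous_const.mul (continuous_const.mul (continuous_symp _)).neg) (fun z z' => ?_)
      (by positivity) (fiberDet_K_l₂ hS.quasi) fun z => ?_)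
    · rw [← mul_sub, neg_sub_neg, ← mul_sub, ← symp_sub_right, abs_mul, abs_mul, Nat.abs_cast,
        norm_sub_rev]
      have := abs_symp_le G.l₂ (z' - z)
      calc _ ≤ G.K * (G.K * ((|G.l₂.1| + |G.l₂.2|) * ‖z' - z‖)) := by gcongr
        _ = L₂ * ‖z' - z‖ := by rw [hL₂]; ring
        _ ≤ _ := mul_le_mul_of_nonneg_right (by linarith) (norm_nonneg _)
    · have := G.symp₂₂
      rw [symp_add_right]
      push_cast
      linear_combination (-(G.K : ℝ)) * this

end LatticeData

/-! ### Integrality of the coordinates -/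

/-- The carry when passing from the fractional part of `n t` to that of `(n + 1) t`. -/
theorem exists_floor_add (n : ℕ) {t : ℝ} (ht0 : 0 ≤ t) (ht1 : t < 1) :
    ∃ b : ℤ, (b = 0 ∨ b = 1) ∧ ⌊((n + 1 : ℕ) : ℝ) * t⌋ = ⌊(n : ℝ) * t⌋ + b ∧
      Int.fract ((n : ℝ) * t) + t = Int.fract (((n + 1 : ℕ) : ℝ) * t) + b := by
  refine ⟨⌊((n + 1 : ℕ) : ℝ) * t⌋ - ⌊(n : ℝ) * t⌋, ?_, by ring, ?_⟩
  · have h1 : ⌊(n : ℝ) * t⌋ ≤ ⌊((n + 1 : ℕ) : ℝ) * t⌋ := Int.floor_le_floor (by push_cast; linarith)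
    have h2 : ⌊((n + 1 : ℕ) : ℝ) * t⌋ ≤ ⌊(n : ℝ) * t⌋ + 1 := by
      rw [← Int.floor_add_one]; exact Int.floor_le_floor (by push_cast; linarith)
    omega
  · rw [Int.fract, Int.fract]
    push_cast
    ring

/-- The terms `n w + c ⌊n t⌋` differ from `n (w + c t)` by a bounded amount, so they can be bounded
only if `w + c t = 0`. -/
theorem add_mul_eq_zero_of_bdd {w c t N : ℝ} (h : ∀ n : ℕ, |n * w + c * ⌊(n : ℝ) * t⌋| ≤ N) :
    w + c * t = 0 := by
  by_contra h0
  have hpos : 0 < |w + c * t| := abs_pos.2 h0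
  obtain ⟨n, hn⟩ := exists_nat_gt ((N + |c|) / |w + c * t|)
  rw [div_lt_iff₀ hpos] at hn
  have e : (n : ℝ) * (w + c * t) = (n * w + c * ⌊(n : ℝ) * t⌋) + c * Int.fract ((n : ℝ) * t) := by
    rw [Int.fract]; ring
  have h1 : |c * Int.fract ((n : ℝ) * t)| ≤ |c| := by
    rw [abs_mul, abs_of_nonneg (Int.fract_nonneg ((n : ℝ) * t))]
    exact mul_le_of_le_one_right (abs_nonneg c) (Int.fract_lt_one _).le
  have h2 : |(n : ℝ) * (w + c * t)| = n * |w + c * t| := by rw [abs_mul, Nat.abs_cast]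
  have h3 := abs_add_le (n * w + c * ⌊(n : ℝ) * t⌋) (c * Int.fract ((n : ℝ) * t))
  rw [← e, h2] at h3
  linarith [h n]

namespace LatticeData

variable {G : LatticeData} {F : ℝ × ℝ → ℂ}

/-- The winding number of a range-preserving shift is determined by its second coordinate, which is
hence integral. The multiples of the shift are reduced modulo the lattice spanned by `l₁` and
`K l₂`, so that their winding numbers stay bounded. -/
theorem IsSymbol.exists_int_of_fract (hS : G.IsSymbol F) {s t : ℝ} (hs0 : 0 ≤ s) (hs1 : s < 1)
    (ht0 : 0 ≤ t) (ht1 : t < 1)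
    (hp : G.PreservesRange F (s • G.l₁ + t • ((G.K : ℝ) • G.l₂))) : ∃ n : ℤ, G.K * t = n := by
  set k₂ := (G.K : ℝ) • G.l₂
  set r : ℝ := 2 * ‖G.l₁‖ + 2 * ‖k₂‖ with hr
  have hnorm : ∀ {x y : ℝ}, 0 ≤ x → x ≤ 2 → 0 ≤ y → y ≤ 2 → ‖x • G.l₁ + y • k₂‖ ≤ r := by
    intro x y hx hx' hy hy'
    refine (norm_add_le _ _).trans ?_
    rw [norm_smul, norm_smul, Real.norm_of_nonneg hx, Real.norm_of_nonneg hy]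
    exact add_le_add (mul_le_mul_of_nonneg_right hx' (norm_nonneg _))
      (mul_le_mul_of_nonneg_right hy' (norm_nonneg _))
  obtain ⟨ω, N, hN, hadd, h₁, h₂⟩ := hS.exists_winding (r := r)
    (by have := hnorm (x := 1) (y := 0) (by simp) (by simp) (by simp) (by simp); simpa using this)
    (by have := hnorm (x := 0) (y := 1) (by simp) (by simp) (by simp) (by simp); simpa using this)
  change ω k₂ = -G.K at h₂
  have hp₁ : ∀ a : ℤ, G.PreservesRange F ((a : ℝ) • G.l₁) := G.preservesRange_smul_l₁ hS.quasi
  have hp₂ : ∀ b : ℤ, G.PreservesRange F ((b : ℝ) • k₂) := G.preservesRange_smul_K_l₂ hS.quasi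
  have h0 : ω 0 = 0 := by
    have hz : ‖(0 : ℝ × ℝ)‖ ≤ r := by rw [norm_zero]; positivity
    have hp0 : G.PreservesRange F 0 := by simpa using hp₁ 0
    have := hadd 0 0 hz hz (by rwa [add_zero]) hp0 hp0
    rw [add_zero] at this
    omega
  -- the reduced multiples of the shift
  set x : ℕ → ℝ := fun n => Int.fract ((n : ℝ) * s) with hx
  set y : ℕ → ℝ := fun n => Int.fract ((n : ℝ) * t) with hy
  have hx0 : ∀ n, 0 ≤ x n := fun n => Int.fract_nonneg _
  have hx1 : ∀ n, x n ≤ 1 := fun n => (Int.fract_lt_one _).le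
  have hy0 : ∀ n, 0 ≤ y n := fun n => Int.fract_nonneg _
  have hy1 : ∀ n, y n ≤ 1 := fun n => (Int.fract_lt_one _).le
  have key : ∀ n : ℕ, G.PreservesRange F (x n • G.l₁ + y n • k₂) ∧
      ω (x n • G.l₁ + y n • k₂) = n * ω (s • G.l₁ + t • k₂) + G.K * ⌊(n : ℝ) * t⌋ := by
    intro n
    induction n with
    | zero =>
      have : x 0 • G.l₁ + y 0 • k₂ = 0 := by simp [hx, hy]
      rw [this]
      exact ⟨by simpa using hp₁ 0, by simp [h0]⟩
    | succ n ih =>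
      obtain ⟨ihp, ihw⟩ := ih
      obtain ⟨a, ha, -, hxa⟩ := exists_floor_add n hs0 hs1
      obtain ⟨b, hb, hfb, hyb⟩ := exists_floor_add n ht0 ht1
      change x n + s = x (n + 1) + a at hxa
      change y n + t = y (n + 1) + b at hyb
      have e : (x n • G.l₁ + y n • k₂) + (s • G.l₁ + t • k₂) =
          (x (n + 1) • G.l₁ + y (n + 1) • k₂) + (a : ℝ) • G.l₁ + (b : ℝ) • k₂ := by
        calc _ = (x n + s) • G.l₁ + (y n + t) • k₂ := by module
          _ = _ := by rw [hxa, hyb]; module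
      have hpn : G.PreservesRange F (x (n + 1) • G.l₁ + y (n + 1) • k₂) := by
        have := PreservesRange.add G (PreservesRange.add G (PreservesRange.add G ihp hp)
          (hp₁ (-a))) (hp₂ (-b))
        rw [e] at this
        convert this using 1
        push_cast
        module
      have ha0 : (0 : ℝ) ≤ a ∧ (a : ℝ) ≤ 1 := by rcases ha with rfl | rfl <;> simp
      have hb0 : (0 : ℝ) ≤ b ∧ (b : ℝ) ≤ 1 := by rcases hb with rfl | rfl <;> simp
      have n1 : ‖x n • G.l₁ + y n • k₂‖ ≤ r :=
        hnorm (hx0 n) (by linarith [hx1 n]) (hy0 n) (by linarith [hy1 n])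
      have n2 : ‖s • G.l₁ + t • k₂‖ ≤ r := hnorm hs0 (by linarith) ht0 (by linarith)
      have n3 : ‖x (n + 1) • G.l₁ + y (n + 1) • k₂‖ ≤ r :=
        hnorm (hx0 _) (by linarith [hx1 (n + 1)]) (hy0 _) (by linarith [hy1 (n + 1)])
      have n4 : ‖x (n + 1) • G.l₁ + y (n + 1) • k₂ + (a : ℝ) • G.l₁‖ ≤ r := by
        rw [show x (n + 1) • G.l₁ + y (n + 1) • k₂ + (a : ℝ) • G.l₁ =
          (x (n + 1) + a) • G.l₁ + y (n + 1) • k₂ by module]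
        exact hnorm (by linarith [hx0 (n + 1)]) (by linarith [hx1 (n + 1)]) (hy0 _)
          (by linarith [hy1 (n + 1)])
      have n5 : ‖x (n + 1) • G.l₁ + y (n + 1) • k₂ + (a : ℝ) • G.l₁ + (b : ℝ) • k₂‖ ≤ r := by
        rw [show x (n + 1) • G.l₁ + y (n + 1) • k₂ + (a : ℝ) • G.l₁ + (b : ℝ) • k₂ =
          (x (n + 1) + a) • G.l₁ + (y (n + 1) + b) • k₂ by module]
        exact hnorm (by linarith [hx0 (n + 1)]) (by linarith [hx1 (n + 1)])
          (by linarith [hy0 (n + 1)]) (by linarith [hy1 (n + 1)])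
      have na : ‖(a : ℝ) • G.l₁‖ ≤ r := by
        have := hnorm (x := a) (y := 0) ha0.1 (by linarith) (by simp) (by simp)
        simpa using this
      have nb : ‖(b : ℝ) • k₂‖ ≤ r := by
        have := hnorm (x := 0) (y := b) (by simp) (by simp) hb0.1 (by linarith)
        simpa using this
      have wa : ω ((a : ℝ) • G.l₁) = 0 := by rcases ha with rfl | rfl <;> simp [h0, h₁]
      have wb : ω ((b : ℝ) • k₂) = -(G.K * b) := by rcases hb with rfl | rfl <;> simp [h0, h₂]
      have e1 := hadd _ _ n1 n2 (by rw [e]; exact n5) ihp hp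
      rw [e, hadd _ _ n4 nb n5 (PreservesRange.add G hpn (hp₁ a)) (hp₂ b),
        hadd _ _ n3 na n4 hpn (hp₁ a), wa, wb, ihw] at e1
      refine ⟨hpn, ?_⟩
      rw [hfb]
      push_cast
      linarith
  have hbdd : ∀ n : ℕ, |n * (ω (s • G.l₁ + t • k₂) : ℝ) + G.K * ⌊(n : ℝ) * t⌋| ≤ N := fun n => by
    have h1 := hN _ (hnorm (hx0 n) (by linarith [hx1 n]) (hy0 n) (by linarith [hy1 n])) (key n).1
    rw [(key n).2] at h1
    push_cast at h1
    exact h1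
  have := add_mul_eq_zero_of_bdd hbdd
  exact ⟨-ω (s • G.l₁ + t • k₂), by push_cast; linarith⟩

/-- Shifts by `ℤ l₁ + ℤ K l₂` preserve the range, so it suffices to consider the fractional parts
of the coordinates. -/
theorem IsSymbol.exists_int (hS : G.IsSymbol F) {s t : ℝ}
    (hp : G.PreservesRange F (s • G.l₁ + t • ((G.K : ℝ) • G.l₂))) : ∃ n : ℤ, G.K * t = n := by
  have h1 := PreservesRange.add G (PreservesRange.add G hp
    (G.preservesRange_smul_l₁ hS.quasi (-⌊s⌋))) (G.preservesRange_smul_K_l₂ hS.quasi (-⌊t⌋))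
  obtain ⟨n, hn⟩ := hS.exists_int_of_fract (Int.fract_nonneg s) (Int.fract_lt_one s)
    (Int.fract_nonneg t) (Int.fract_lt_one t) (by
      convert h1 using 1
      rw [Int.fract, Int.fract]
      push_cast
      module)
  refine ⟨n + G.K * ⌊t⌋, ?_⟩
  rw [Int.fract] at hn
  push_cast
  linarith

/-- If the Zak transform of `g` is in `VMO_loc`, a time-frequency shift that maps `g` into the Gabor
space has an integral second coordinate with respect to the lattice basis. -/
theorem exists_int_of_mem_gaborSpace {g : L2R} (hR : IsRieszBasis (gaborFamily g G.lattice))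
    (hV : IsVMOLoc (zak g)) {x y : ℝ}
    (h : timeFreqShift (x • G.l₁ + y • G.l₂) g ∈ gaborSpace g G.lattice) : ∃ n : ℤ, y = n := by
  obtain ⟨F, hS, hF⟩ := G.exists_isSymbol g hR hV
  have e : x • G.l₁ + (y / G.K) • ((G.K : ℝ) • G.l₂) = x • G.l₁ + y • G.l₂ := by
    rw [smul_smul, div_mul_cancel₀ _ G.K_ne]
  obtain ⟨n, hn⟩ := hS.exists_int (s := x) (t := y / G.K) (by
    rw [e]; exact G.preservesRange_of_mem hS.quasi hF h)
  exact ⟨n, by rw [← hn, mul_div_cancel₀ _ G.K_ne]⟩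

end LatticeData

/-! ### Rational lattices -/

theorem exists_nat_mul_eq_intCast {ι : Type*} [Fintype ι] (f : ι → ℚ) :
    ∃ N : ℕ, 0 < N ∧ ∀ i, ∃ m : ℤ, (N : ℝ) * (f i : ℝ) = m := by
  refine ⟨∏ i, (f i).den, Finset.prod_pos fun i _ => (f i).den_pos, fun i => ?_⟩
  obtain ⟨k, hk⟩ := Finset.dvd_prod_of_mem (fun i => (f i).den) (Finset.mem_univ i)
  refine ⟨(f i).num * k, ?_⟩
  rw [hk]
  have : ((f i).den : ℝ) * (f i : ℝ) = (f i).num := by exact_mod_cast Rat.den_mul_eq_num (f i)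
  push_cast
  linear_combination (k : ℝ) * this

/-- With a common denominator `N` of the entries one may take `K = 2 N²`, where the factor `2`
serves to cancel the denominator in `phase_int`. The dual basis is `d₁ = l₂ / (K D)`,
`d₂ = -l₁ / (K D)`, where `D` is the determinant. -/
theorem exists_latticeData (a b c d : ℚ) (h : a * d - c * b ≠ 0) :
    ∃ G : LatticeData, G.l₁ = ((a : ℝ), (c : ℝ)) ∧ G.l₂ = ((b : ℝ), (d : ℝ)) := by
  obtain ⟨N, hN, hint⟩ := exists_nat_mul_eq_intCast ![a, b, c, d]
  obtain ⟨a', ha⟩ := hint 0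
  obtain ⟨b', hb⟩ := hint 1
  obtain ⟨c', hc⟩ := hint 2
  obtain ⟨d', hd⟩ := hint 3
  simp only [Matrix.cons_val] at ha hb hc hd
  set D : ℚ := a * d - c * b with hD
  set K : ℕ := 2 * N ^ 2 with hK
  have hK0 : 0 < K := by positivity
  have hKD : (K : ℚ) * D ≠ 0 := mul_ne_zero (by positivity) h
  have hKDR : ((K : ℝ) * D) ≠ 0 := by exact_mod_cast hKD
  have hKR : (K : ℝ) = 2 * N ^ 2 := by rw [hK]; push_cast; ring
  obtain ⟨R, hR, hint'⟩ := exists_nat_mul_eq_intCast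
    ![b / (K * D), d / (K * D), -a / (K * D), -c / (K * D)]
  obtain ⟨m₁, h₁⟩ := hint' 0
  obtain ⟨m₂, h₂⟩ := hint' 1
  obtain ⟨m₃, h₃⟩ := hint' 2
  obtain ⟨m₄, h₄⟩ := hint' 3
  simp only [Matrix.cons_val] at h₁ h₂ h₃ h₄
  have hDR : (D : ℝ) = a * d - c * b := by rw [hD]; push_cast; ring
  exact ⟨{
    l₁ := (a, c)
    l₂ := (b, d)
    d₁ := (((b / (K * D) : ℚ) : ℝ), ((d / (K * D) : ℚ) : ℝ))
    d₂ := (((-a / (K * D) : ℚ) : ℝ), ((-c / (K * D) : ℚ) : ℝ))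
    K := K
    R := R
    K_pos := hK0
    R_pos := hR
    int₁ := ⟨2 * N * a', 2 * N * c', by
      simp only [Prod.smul_mk, smul_eq_mul, hKR]
      push_cast
      rw [← ha, ← hc]
      ext <;> dsimp only <;> ring⟩
    int₂ := ⟨2 * N * b', 2 * N * d', by
      simp only [Prod.smul_mk, smul_eq_mul, hKR]
      push_cast
      rw [← hb, ← hd]
      ext <;> dsimp only <;> ring⟩
    symp_ne := by
      simp only [symp]
      rw [← hDR]
      exact_mod_cast h
    symp_int := ⟨2 * (a' * d' - c' * b'), by
      simp only [symp, hKR]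
      push_cast
      rw [← ha, ← hb, ← hc, ← hd]
      ring⟩
    phase_int := ⟨(K - 1) * (a' * c'), by
      push_cast
      rw [← ha, ← hc, hKR]
      ring⟩
    symp₁₁ := by
      simp only [symp]
      push_cast
      field_simp
      rw [hDR]
    symp₁₂ := by
      simp only [symp]
      push_cast
      ring
    symp₂₁ := by
      simp only [symp]
      push_cast
      ring
    symp₂₂ := by
      simp only [symp]
      push_cast
      field_simp
      rw [hDR]
      ring
    intd₁ := ⟨m₁, m₂, by rw [← h₁, ← h₂]; rfl⟩
    intd₂ := ⟨m₃, m₄, by rw [← h₃, ← h₄]; rfl⟩ }, rfl, rfl⟩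

theorem theorem1p5 (g : L2R) (A : GL (Fin 2) ℚ)
    (hRiesz : IsRieszBasis (gaborFamily g (rationalLattice A)))
    (u η : ℝ) (hnot : (u, η) ∉ rationalLattice A)
    (hmem : timeFreqShift (u, η) g ∈ gaborSpace g (rationalLattice A)) :
    ¬ IsVMOLoc (zak g) := by
  intro hV
  have hdet : A.1 0 0 * A.1 1 1 - A.1 1 0 * A.1 0 1 ≠ 0 := by
    have h : A.1.det ≠ 0 := ((Matrix.isUnit_iff_isUnit_det A.1).1 A.isUnit).ne_zero
    rw [Matrix.det_fin_two] at h
    rwa [mul_comm (A.1 1 0)]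
  obtain ⟨G, h₁, h₂⟩ := exists_latticeData _ _ _ _ hdet
  obtain ⟨G', h₁', h₂'⟩ := exists_latticeData (A.1 0 1) (A.1 0 0) (A.1 1 1) (A.1 1 0)
    (by rw [← neg_ne_zero]; convert hdet using 1; ring)
  have hG : G.lattice = rationalLattice A := by
    ext z
    simp only [LatticeData.lattice, rationalLattice, mem_ofPred, h₁, h₂]
    refine exists_congr fun m => exists_congr fun n => ?_
    simp [mul_comm]
  have hG' : G'.lattice = rationalLattice A := by
    ext z
    simp only [LatticeData.lattice, rationalLattice, mem_ofPred, h₁', h₂']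
    rw [exists_comm]
    refine exists_congr fun m => exists_congr fun n => ?_
    simp [mul_comm, add_comm]
  have hne := G.symp_ne
  set D := symp G.l₁ G.l₂ with hD
  -- Cramer's rule
  have hcoord : ((u, η) : ℝ × ℝ) =
      (symp (u, η) G.l₂ / D) • G.l₁ + (symp G.l₁ (u, η) / D) • G.l₂ := by
    ext
    · simp only [Prod.fst_add, Prod.smul_fst, smul_eq_mul]
      field_simp
      simp only [hD, symp]
      ring
    · simp only [Prod.snd_add, Prod.smul_snd, smul_eq_mul]
      field_simp
      simp only [hD, symp]
      ring
  set x := symp (u, η) G.l₂ / D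
  set y := symp G.l₁ (u, η) / D
  -- both coordinates are integral; for the first one, use the basis with its vectors exchanged
  obtain ⟨n, hn⟩ := G.exists_int_of_mem_gaborSpace (g := g) (x := x) (y := y)
    (by rw [hG]; exact hRiesz) hV (by rw [hG, ← hcoord]; exact hmem)
  obtain ⟨m, hm⟩ := G'.exists_int_of_mem_gaborSpace (g := g) (x := y) (y := x)
    (by rw [hG']; exact hRiesz) hV (by
      rw [hG', h₁', h₂', ← h₁, ← h₂, add_comm, ← hcoord]; exact hmem)
  exact hnot (hG ▸ ⟨m, n, by rw [← hm, ← hn]; exact hcoord⟩)
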